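/- **Setting.** Let $q,r,v\in\mathbb C$ with $0<|q|<1$; put $q^x=e^{x\log q}$ (principal $\log q$), $p=q^{2r}$, $w=q^{2v}$, $z=q^{2u}$, $z^s=q^{2us}$, $w^s=q^{2vs}$, and assume $|p|<1$. Let $l\ge 0$ be an integer and let $r$ be generic in the sense that $p^k\ne q^{2j}$ for all integers $k\ge1$, $1\le j\le l$. Put $[x]_q=\frac{q^x-q^{-x}}{q-q^{-1}}$, $(x;p)_\infty=\prod_{n\ge0}(1-xp^n)$, $\{x\}=\prod_{m,n\ge0}(1-xp^mq^{4n})$, $\Theta_p(x)=(x;p)_\infty(p/x;p)_\infty(p;p)_\infty$, $$[u]=\frac{q^{u^2/r-u}}{(p;p)_\infty^3}\Theta_p(q^{2u}),\qquad \varphi_l(u)=-z^{-\frac l{2r}}\rho^+_{1l}(z,p)^{-1}\left[u+\tfrac{l+1}2\right],$$ $$\rho^+_{kl}(z,p)=q^{\frac{kl}2}\frac{\{pq^{k-l+2}z\}\{pq^{-k+l+2}z\}}{\{pq^{k+l+2}z\}\{pq^{-k-l+2}z\}}\frac{\{q^{k+l+2}/z\}\{q^{-k-l+2}/z\}}{\{q^{k-l+2}/z\}\{q^{-k+l+2}/z\}}.$$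 Let $a,a^*\in\mathbb C$ with $a^*a[1]/(q-q^{-1})=1$. **The evaluation representation.** Let $\mathbb F$ be the field of meromorphic functions of $P\in\mathbb C$ and $\widehat V=\bigoplus_{m=0}^l\mathbb F v_m$, with the $\mathbb C$-linear operators $f(P)$ (multiplication), $e^{kQ}(f(P)v_m)=f(P+k)v_m$, and the $\mathbb F$-linear operators $hv_m=(l-2m)v_m$, $S^\pm v_m=v_{m\mp1}$ ($v_{-1}=v_{l+1}=0$). The Drinfeld generators of $U_q(L(\mathfrak{sl}_2))$ (central element $c=0$) act by $$a_n=\frac{w^n}{n}\frac{(q^n+q^{-n})q^{nh}-(q^{(l+1)n}+q^{-(l+1)n})}{q-q^{-1}}\ (n\ne0),\qquad x^\pm(z)=\sum_{n\in\mathbb Z}x^\pm_nz^{-n}=S^\pm\left[\tfrac{\pm h+l+2}2\right]_q\delta\!\left(q^{h\pm1}\tfrac wz\right),\quad \delta(x)=\sum_{n\in\mathbb Z}x^n.$$ With $u^+(z)=\exp\sum_{n>0}\frac{a_{-n}(q^rz)^n}{[rn]_q}$ and $u^-(z)=\exp\left(-\sum_{n>0}\frac{a_n(q^{-r}z)^{-n}}{[rn]_q}\right)$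 the elliptic currents are $$E(u)=u^+(z)x^+(z)e^{2Q}z^{-\frac{P-1}r},\qquad F(u)=x^-(z)u^-(z)z^{\frac{P+h-1}r},$$ $$K(u)=\exp\left(\sum_{n>0}\frac{[n]_q\,a_{-n}z^n}{[2n]_q[rn]_q}\right)\exp\left(-\sum_{n>0}\frac{[n]_q\,a_nz^{-n}}{[2n]_q[rn]_q}\right)e^Qz^{\frac h{2r}},$$ and the half currents are $K^+(u)=K(u+\frac{r+1}2)$ and, integrating over $|pz|<|z'|<|z|$ with $z'=q^{2u'}$, $$E^+(u)=a^*\oint E(u')\frac{[u-u'-P+1][1]}{[u-u'][P-1]}\frac{dz'}{2\pi iz'},\qquad F^+(u)=a\oint F(u')\frac{[u-u'+P+h-1][1]}{[u-u'][P+h-1]}\frac{dz'}{2\pi iz'}.$$ Here each exponential is the meromorphic continuation (in $z$ from $0$, respectively in $1/z$ from $0$) of its convergent series, products with a delta function are formed by $f(z)\delta(\zeta/z)=f(\zeta)\delta(\zeta/z)$, integrals of formal distributions in $z'$ are taken mode by mode, and matrix coefficients of $E^+(u)$, $F^+(u)$, which converge when $|pz|<|\zeta|<|z|$ for the corresponding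 point $\zeta=q^{h\pm1}w$, are continued meromorphically in $u$. The entries of the $L$-operator in this representation are defined by $$\begin{pmatrix}\alpha(u)&\beta(u)\\\gamma(u)&\delta(u)\end{pmatrix}=\begin{pmatrix}1&F^+(u)\\0&1\end{pmatrix}\begin{pmatrix}K^+(u-1)&0\\0&K^+(u)^{-1}\end{pmatrix}\begin{pmatrix}1&0\\E^+(u)&1\end{pmatrix}.$$ **Theorem 4.14.** Let $D$ be the diagonal operator on $\widehat V$ acting on $v_m$ as multiplication by $$c_m\,w^{\frac{hP}{2r}}\,q^{\frac{(h^2-l(l+2))P}{4r}},\qquad h=l-2m,$$ $$c_m=\prod_{j=1}^m\left(-a^*\,\frac{(pq^2;p)_\infty}{(p;p)_\infty}\,\frac{(pq^{-2j};p)_\infty}{(pq^{-2(l+1-j)};p)_\infty}\,q^{\frac{j^2-(l+1-2j)^2}r}\,w^{-\frac{l+1-2j}r}\right).$$ Then $D$ is invertible and, for all $u\in\mathbb C$ outside a closed discrete set, $$D\,\alpha(u)\,D^{-1}=-\frac{[u-v+\frac{h+1}2][P-\frac{l-h}2][P+\frac{l+h+2}2]}{\varphi_l(u-v)[P][P+h+1]}\,e^Q,$$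 $$D\,\beta(u)\,D^{-1}=-S^-\,\frac{[u-v+\frac{h-1}2+P][\frac{l-h+2}2]}{\varphi_l(u-v)[P+h-1]}\,e^{-Q},$$ $$D\,\gamma(u)\,D^{-1}=S^+\,\frac{[u-v-\frac{h+1}2-P][\frac{l+h+2}2]}{\varphi_l(u-v)[P]}\,e^Q,$$ $$D\,\delta(u)\,D^{-1}=-\frac{[u-v-\frac{h-1}2]}{\varphi_l(u-v)}\,e^{-Q}.$$ -/

import Mathlib

open Filter Topology

noncomputable section

namespace EllipticEval

/-! ### The field `𝔽` of meromorphic functions of the dynamical variable `P` -/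

/-- Meromorphic functions on `ℂ` (with arbitrary values at the poles). -/
def MeroFun : Subalgebra ℂ (ℂ → ℂ) where
  carrier := {f | Meromorphic f}
  mul_mem' hf hg := Meromorphic.mul hf hg
  add_mem' hf hg := Meromorphic.add hf hg
  algebraMap_mem' c := Meromorphic.const c

/-- Functions that vanish off a closed discrete set. -/
def nullIdeal : Ideal MeroFun where
  carrier := {f | (f : ℂ → ℂ) =ᶠ[codiscrete ℂ] 0}
  add_mem' {f g} hf hg := by
    change ((f + g : MeroFun) : ℂ → ℂ) =ᶠ[codiscrete ℂ] 0
    change (f : ℂ → ℂ) =ᶠ[codiscrete ℂ] 0 at hf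
    change (g : ℂ → ℂ) =ᶠ[codiscrete ℂ] 0 at hg
    filter_upwards [hf, hg] with x hx hy
    simp_all
  zero_mem' := by
    change ((0 : MeroFun) : ℂ → ℂ) =ᶠ[codiscrete ℂ] 0
    exact EventuallyEq.rfl
  smul_mem' c f hf := by
    change ((c * f : MeroFun) : ℂ → ℂ) =ᶠ[codiscrete ℂ] 0
    change (f : ℂ → ℂ) =ᶠ[codiscrete ℂ] 0 at hf
    filter_upwards [hf] with x hx
    simp_all

/-- The field `𝔽` of meromorphic functions of `P` on `ℂ`: two meromorphic functions are identified
when they agree off a closed discrete set. -/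
def MF : Type := MeroFun ⧸ nullIdeal

instance : CommRing MF := inferInstanceAs (CommRing (MeroFun ⧸ nullIdeal))

instance : Algebra ℂ MF := inferInstanceAs (Algebra ℂ (MeroFun ⧸ nullIdeal))

/-- The class of a meromorphic function in `𝔽`. -/
def toMF : MeroFun →ₐ[ℂ] MF := Ideal.Quotient.mkₐ ℂ nullIdeal

open Classical in
/-- The element of `𝔽` given by a function of `P` (and `0` if the function is not meromorphic). -/
def ofFun (f : ℂ → ℂ) : MF :=
  if h : f ∈ MeroFun then toMF ⟨f, h⟩ else 0

/-- `f(P) ↦ f(P + s)` on meromorphic functions. -/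
def shiftFun (s : ℂ) : MeroFun →ₐ[ℂ] MeroFun where
  toFun f := ⟨fun P => (f : ℂ → ℂ) (P + s),
    Meromorphic.meromorphic_fun_comp_add_const_iff_meromorphic.2 f.2⟩
  map_one' := rfl
  map_mul' _ _ := rfl
  map_zero' := rfl
  map_add' _ _ := rfl
  commutes' _ := rfl

lemma tendsto_add_codiscrete (s : ℂ) :
    Tendsto (fun P : ℂ => P + s) (codiscrete ℂ) (codiscrete ℂ) := by
  intro S hS
  rw [mem_map, mem_codiscrete'] at *
  refine ⟨hS.1.preimage (by fun_prop), ?_⟩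
  have h := (Homeomorph.addRight s).isEmbedding
  rw [← Set.preimage_compl]
  exact hS.2.preimage (f := fun P : ℂ => P + s) (by fun_prop) (add_left_injective s)

/-- The automorphism `f(P) ↦ f(P + s)` of `𝔽`. -/
def shift (s : ℂ) : MF →ₐ[ℂ] MF :=
  Ideal.quotientMapₐ (I := nullIdeal) nullIdeal (shiftFun s)
    (fun _ hf => (tendsto_add_codiscrete s).eventually hf)

/-! ### Operators on `V̂ = V^{(l)} ⊗ ℂ1`, `V^{(l)} = ⊕_{m=0}^{l} 𝔽 v_m` -/

/-- `V̂`; a vector is given by its coordinates with respect to `v_0, …, v_l`. -/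
abbrev VHat (l : ℕ) : Type := Fin (l + 1) → MF

/-- The weight `l - 2m` of `v_m`, i.e. the eigenvalue of `h`. -/
def wt {l : ℕ} (m : Fin (l + 1)) : ℤ := (l : ℤ) - 2 * (m : ℤ)

/-- The operator `v_m ↦ d_m v_m`. -/
def diagOp {l : ℕ} (d : Fin (l + 1) → MF) : Module.End ℂ (VHat l) where
  toFun f i := d i * f i
  map_add' f g := by ext i; simp [mul_add]
  map_smul' c f := by
    ext i
    exact mul_smul_comm c (d i) (f i)

/-- The operator `g(h, P)`: on `v_m` it is multiplication by the function `g(l - 2m, P)` of `P`. -/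
def hP (l : ℕ) (g : ℤ → ℂ → ℂ) : Module.End ℂ (VHat l) :=
  diagOp fun m => ofFun (g (wt m))

/-- `e^{kQ}`, acting by `f(P) v_m ↦ f(P + k) v_m`. -/
def expQ (l : ℕ) (k : ℤ) : Module.End ℂ (VHat l) where
  toFun f i := shift k (f i)
  map_add' f g := by ext i; simp
  map_smul' c f := by ext i; simp

/-- `S⁺ v_m = v_{m-1}`, with `v_{-1} = 0`. -/
def Splus (l : ℕ) : Module.End ℂ (VHat l) where
  toFun f i := if h : (i : ℕ) + 1 < l + 1 then f ⟨i + 1, h⟩ else 0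
  map_add' f g := by
    ext i
    by_cases h : (i : ℕ) + 1 < l + 1
    · simp only [Pi.add_apply, dif_pos h]
    · simp only [Pi.add_apply, dif_neg h, add_zero]
  map_smul' c f := by
    ext i
    by_cases h : (i : ℕ) + 1 < l + 1
    · simp only [Pi.smul_apply, dif_pos h, RingHom.id_apply]
    · simp only [Pi.smul_apply, dif_neg h, RingHom.id_apply, smul_zero]

/-- `S⁻ v_m = v_{m+1}`, with `v_{l+1} = 0`. -/
def Sminus (l : ℕ) : Module.End ℂ (VHat l) where
  toFun f i := if 0 < (i : ℕ) then f ⟨i - 1, by omega⟩ else 0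
  map_add' f g := by
    ext i
    by_cases h : 0 < (i : ℕ)
    · simp only [Pi.add_apply, if_pos h]
    · simp only [Pi.add_apply, if_neg h, add_zero]
  map_smul' c f := by
    ext i
    by_cases h : 0 < (i : ℕ)
    · simp only [Pi.smul_apply, if_pos h, RingHom.id_apply]
    · simp only [Pi.smul_apply, if_neg h, RingHom.id_apply, smul_zero]

/-! ### Special functions.  Throughout `z = q^{2u}`, `w = q^{2v}`, `p = q^{2r}`. -/

/-- `z^s` for `z = q^{2u}`. -/
def zpw (q u s : ℂ) : ℂ := q ^ (2 * u * s)

/-- `(z; p)_∞`. -/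
def poch (z p : ℂ) : ℂ := ∏' n : ℕ, (1 - z * p ^ n)

/-- `{z} = (z; p, q⁴)_∞`. -/
def dpoch (q p z : ℂ) : ℂ := ∏' n : ℕ × ℕ, (1 - z * p ^ n.1 * (q ^ 4) ^ n.2)

/-- `Θ_p(z)`. -/
def Theta (p z : ℂ) : ℂ := poch z p * poch (p / z) p * poch p p

/-- The theta function `[u]`. -/
def theta (q r u : ℂ) : ℂ :=
  q ^ (u ^ 2 / r - u) / poch (q ^ (2 * r)) (q ^ (2 * r)) ^ 3 * Theta (q ^ (2 * r)) (q ^ (2 * u))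

/-- `[x]_q`. -/
def qnum (q x : ℂ) : ℂ := (q ^ x - q ^ (-x)) / (q - q⁻¹)

/-- `ρ⁺_{kl}(z, p)`. -/
def rhoKL (q r : ℂ) (k l : ℤ) (z : ℂ) : ℂ :=
  let p := q ^ (2 * r)
  q ^ ((k * l : ℂ) / 2)
    * (dpoch q p (p * q ^ (k - l + 2) * z) * dpoch q p (p * q ^ (-k + l + 2) * z)
        / (dpoch q p (p * q ^ (k + l + 2) * z) * dpoch q p (p * q ^ (-k - l + 2) * z)))
    * (dpoch q p (q ^ (k + l + 2) / z) * dpoch q p (q ^ (-k - l + 2) / z)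
        / (dpoch q p (q ^ (k - l + 2) / z) * dpoch q p (q ^ (-k + l + 2) / z)))

/-- `φ_l(u) = - z^{-l/2r} ρ⁺_{1l}(z, p)⁻¹ [u + (l+1)/2]`. -/
def phiL (q r : ℂ) (l : ℕ) (u : ℂ) : ℂ :=
  - zpw q u (-(l / (2 * r))) * (rhoKL q r 1 l (q ^ (2 * u)))⁻¹ * theta q r (u + (l + 1) / 2)

/-! ### Meromorphic continuation -/

open Classical in
/-- The meromorphic function on `ℂ` (in normal form: value `0` at each pole, removable
singularities removed) that agrees with `f` along the filter `F`.  It is used for `F = 𝓝 0` and for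
`F = 𝓟 U` with a non-empty open `U`, where it is unique.  (It is `0` if there is none.) -/
def meroExt (F : Filter ℂ) (f : ℂ → ℂ) : ℂ → ℂ :=
  if h : ∃ g : ℂ → ℂ, MeromorphicNFOn g Set.univ ∧ g =ᶠ[F] f then h.choose else 0

/-! ### The evaluation module of the quantum loop algebra -/

/-- The eigenvalue of `π_{l,w}(a_n)` on the vector of weight `h`. -/
def aEv (q v : ℂ) (l : ℕ) (n : ℤ) (h : ℤ) : ℂ :=
  (q ^ (2 * v)) ^ n / n * (1 / (q - q⁻¹)) *
    ((q ^ n + q ^ (-n)) * q ^ (n * h) - (q ^ ((l + 1) * n) + q ^ (-((l + 1) * n))))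

/-- The point `q^{h+1} w` supporting `π_{l,w}(x⁺(z))` on the vector of weight `h`. -/
def zetaPlus (q v : ℂ) (h : ℤ) : ℂ := q ^ (h + 1) * q ^ (2 * v)

/-- The point `q^{h-1} w` supporting `π_{l,w}(x⁻(z))` on the vector of weight `h`. -/
def zetaMinus (q v : ℂ) (h : ℤ) : ℂ := q ^ (h - 1) * q ^ (2 * v)

/-- The coefficient of `S⁺` in `π_{l,w}(x⁺_n)` on weight `h`, where `x⁺(z) = ∑ x⁺_n z^{-n}` acts as
`S⁺ [(h+l+2)/2]_q δ(q^{h+1} w / z)`. -/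
def xPlusMode (q v : ℂ) (l : ℕ) (n : ℤ) (h : ℤ) : ℂ :=
  qnum q ((h + l + 2) / 2) * zetaPlus q v h ^ n

/-- The coefficient of `S⁻` in `π_{l,w}(x⁻_n)` on weight `h`, where `x⁻(z) = ∑ x⁻_n z^{-n}` acts as
`S⁻ [(-h+l+2)/2]_q δ(q^{h-1} w / z)`. -/
def xMinusMode (q v : ℂ) (l : ℕ) (n : ℤ) (h : ℤ) : ℂ :=
  qnum q ((-h + l + 2) / 2) * zetaMinus q v h ^ n

/-! ### Elliptic currents at level `c = 0` (so `r* = r`, `p* = p`) -/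

/-- `u⁺(z,p) = exp(∑_{n>0} a_{-n} (q^r z)^n / [rn]_q)` on weight `h`, continued in `z` from `0`. -/
def uPlus (q r v : ℂ) (l : ℕ) (h : ℤ) : ℂ → ℂ :=
  meroExt (𝓝 0) fun z => Complex.exp (∑' k : ℕ,
    1 / qnum q (r * (k + 1)) * aEv q v l (-(k + 1)) h * (q ^ r * z) ^ (k + 1))

/-- `u⁻(z,p) = exp(-∑_{n>0} a_n (q^{-r} z)^{-n} / [rn]_q)` on weight `h`, as a function of
`y = 1/z`, continued in `y` from `0`. -/
def uMinus (q r v : ℂ) (l : ℕ) (h : ℤ) : ℂ → ℂ :=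
  meroExt (𝓝 0) fun y => Complex.exp (-∑' k : ℕ,
    1 / qnum q (r * (k + 1)) * aEv q v l (k + 1) h * (q ^ r * y) ^ (k + 1))

/-- The first exponential in `K(u)` on weight `h`, a function of `z` continued from `z = 0`. -/
def kPos (q r v : ℂ) (l : ℕ) (h : ℤ) : ℂ → ℂ :=
  meroExt (𝓝 0) fun z => Complex.exp (∑' k : ℕ,
    qnum q (k + 1) / (qnum q (2 * (k + 1)) * qnum q (r * (k + 1)))
      * aEv q v l (-(k + 1)) h * z ^ (k + 1))

/-- The second exponential in `K(u)` on weight `h`, a function of `y = 1/z` continued from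
`y = 0`. -/
def kNeg (q r v : ℂ) (l : ℕ) (h : ℤ) : ℂ → ℂ :=
  meroExt (𝓝 0) fun y => Complex.exp (-∑' k : ℕ,
    qnum q (k + 1) / (qnum q (2 * (k + 1)) * qnum q (r * (k + 1)))
      * aEv q v l (k + 1) h * y ^ (k + 1))

/-- `π̂(K(u))`: the two exponentials times `e^Q z^{h/2r}`. -/
def K (q r v : ℂ) (l : ℕ) (u : ℂ) : Module.End ℂ (VHat l) :=
  hP l (fun h _ => kPos q r v l h (q ^ (2 * u)) * kNeg q r v l h (q ^ (-(2 * u))))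
    * expQ l 1 * hP l (fun h _ => zpw q u (h / (2 * r)))

/-- The `n`-th mode of `φ_r(x⁺(z)) = u⁺(z,p) x⁺(z)` (coefficient of `S⁺`, on weight `h`).  The image
has weight `h + 2`, and `f(z) δ(ζ/z) = f(ζ) δ(ζ/z)`. -/
def eMode (q r v : ℂ) (l : ℕ) (n : ℤ) (h : ℤ) : ℂ :=
  uPlus q r v l (h + 2) (zetaPlus q v h) * xPlusMode q v l n h

/-- The `n`-th mode of `φ_r(x⁻(z)) = x⁻(z) u⁻(z,p)` (coefficient of `S⁻`, on weight `h`). -/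
def fMode (q r v : ℂ) (l : ℕ) (n : ℤ) (h : ℤ) : ℂ :=
  uMinus q r v l h (zetaMinus q v h)⁻¹ * xMinusMode q v l n h

/-! ### Half currents -/

/-- `∮ g dz' / (2πi z')` over the circle `|z'| = |p|^{1/2} |z|`, which lies in the annulus
`|p z| < |z'| < |z|`.  Here `z = q^{2u}`, and `g`, single-valued in `z' = q^{2u'}`, is given as a
function of `u'`; the circle is `u' = u + r/2 + πi t / log q`, `0 ≤ t ≤ 1`. -/
def contour (q r u : ℂ) (g : ℂ → ℂ) : ℂ :=
  ∫ t in (0 : ℝ)..1, g (u + r / 2 + Real.pi * Complex.I * t / Complex.log q)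

/-- The set of `u` with `|p z| < |ζ| < |z|`, `z = q^{2u}`. -/
def strip (q r ζ : ℂ) : Set ℂ :=
  {u | ‖q ^ (2 * r) * q ^ (2 * u)‖ < ‖ζ‖ ∧ ‖ζ‖ < ‖q ^ (2 * u)‖}

/-- The factor of `E⁺(u)` on weight `h` to the right of `S⁺ e^{2Q}`: the integral
`a* ∮ E(u') [u-u'-P+1] [1] / ([u-u'] [P-1]) dz'/(2πi z')` with
`E(u') = φ_r(x⁺(z')) e^{2Q} z'^{-(P-1)/r}`, taken mode by mode.  The sum over the modes converges for
`u` in the strip; it is continued meromorphically in `u`. -/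
def ePlusCoeff (q r v : ℂ) (l : ℕ) (aStar : ℂ) (h : ℤ) (P : ℂ) : ℂ → ℂ :=
  meroExt (𝓟 (strip q r (zetaPlus q v h))) fun u =>
    aStar * ∑' n : ℤ, eMode q r v l n h * contour q r u fun u' =>
      (q ^ (2 * u')) ^ (-n) * zpw q u' (-((P - 1) / r))
        * (theta q r (u - u' - P + 1) * theta q r 1 / (theta q r (u - u') * theta q r (P - 1)))

/-- The factor of `F⁺(u)` on weight `h` to the right of `S⁻`: the integral
`a ∮ F(u') [u-u'+P+h-1] [1] / ([u-u'] [P+h-1]) dz'/(2πi z')` with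
`F(u') = φ_r(x⁻(z')) z'^{(P+h-1)/r}`, treated in the same way. -/
def fPlusCoeff (q r v : ℂ) (l : ℕ) (a : ℂ) (h : ℤ) (P : ℂ) : ℂ → ℂ :=
  meroExt (𝓟 (strip q r (zetaMinus q v h))) fun u =>
    a * ∑' n : ℤ, fMode q r v l n h * contour q r u fun u' =>
      (q ^ (2 * u')) ^ (-n) * zpw q u' ((P + h - 1) / r)
        * (theta q r (u - u' + P + h - 1) * theta q r 1
            / (theta q r (u - u') * theta q r (P + h - 1)))

/-- `π̂(K⁺(u))`. -/
def Kplus (q r v : ℂ) (l : ℕ) (u : ℂ) : Module.End ℂ (VHat l) := K q r v l (u + (r + 1) / 2)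

/-- `π̂(E⁺(u))`. -/
def Eplus (q r v : ℂ) (l : ℕ) (aStar u : ℂ) : Module.End ℂ (VHat l) :=
  Splus l * expQ l 2 * hP l (fun h P => ePlusCoeff q r v l aStar h P u)

/-- `π̂(F⁺(u))`. -/
def Fplus (q r v : ℂ) (l : ℕ) (a u : ℂ) : Module.End ℂ (VHat l) :=
  Sminus l * hP l (fun h P => fPlusCoeff q r v l a h P u)

/-- The image of the `L`-operator, through its Gauss decomposition; its entries are the images of
`α(u), β(u)` (first row) and `γ(u), δ(u)` (second row). -/
def Lop (q r v : ℂ) (l : ℕ) (a aStar u : ℂ) : Matrix (Fin 2) (Fin 2) (Module.End ℂ (VHat l)) :=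
  !![1, Fplus q r v l a u; 0, 1]
    * !![Kplus q r v l (u - 1), 0; 0, Ring.inverse (Kplus q r v l u)]
    * !![1, 0; Eplus q r v l aStar u, 1]

/-! ### The normalization of the weight vectors -/

/-- The constants `c_m`. -/
def gaugeC (q r v : ℂ) (l : ℕ) (aStar : ℂ) (m : ℕ) : ℂ :=
  let p := q ^ (2 * r)
  ∏ j ∈ Finset.Icc 1 m,
    (-aStar * (poch (p * q ^ 2) p / poch p p)
      * (poch (p * q ^ (-(2 * j : ℤ))) p / poch (p * q ^ (-(2 * (l + 1 - j) : ℤ))) p)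
      * q ^ (((j : ℂ) ^ 2 - (l + 1 - 2 * j) ^ 2) / r) * zpw q v (-((l + 1 - 2 * j) / r)))

/-- The diagonal operator `D v_m = c_m w^{hP/2r} q^{(h² - l(l+2)) P/4r} v_m`, `h = l - 2m`. -/
def gaugeD (q r v : ℂ) (l : ℕ) (aStar : ℂ) : Module.End ℂ (VHat l) :=
  diagOp fun m => ofFun fun P =>
    gaugeC q r v l aStar m * zpw q v (wt m * P / (2 * r))
      * q ^ (((wt m : ℂ) ^ 2 - l * (l + 2)) * P / (4 * r))

end EllipticEval

end

open EllipticEval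

noncomputable section

namespace EllipticEval

/-! ### Infinite products `∏ᵢ (1 - x cᵢ)` -/

section ProdOne

variable {ι : Type*} {c : ι → ℂ}

/-- The product `∏ᵢ (1 - x cᵢ)`. -/
def prodOne (c : ι → ℂ) (x : ℂ) : ℂ := ∏' i, (1 - x * c i)

lemma multipliable_prodOne (hc : Summable fun i => ‖c i‖) (x : ℂ) :
    Multipliable fun i => 1 - x * c i := by
  simpa [sub_eq_add_neg] using multipliable_one_add_of_summable (f := fun i => -(x * c i))
    (by simpa using hc.mul_left ‖x‖)

lemma prodOne_ne_zero (hc : Summable fun i => ‖c i‖) {x : ℂ} (hx : ∀ i, x * c i ≠ 1) :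
    prodOne c x ≠ 0 := by
  have := tprod_one_add_ne_zero_of_summable (f := fun i => -(x * c i))
    (fun i h => hx i (by linear_combination -h)) (by simpa using hc.mul_left ‖x‖)
  simpa [prodOne, sub_eq_add_neg] using this

lemma differentiable_prodOne (hc : Summable fun i => ‖c i‖) : Differentiable ℂ (prodOne c) := by
  have key : ∀ R : ℝ, DifferentiableOn ℂ (prodOne c) (Metric.ball 0 R) := by
    intro R
    have h := (hc.mul_left R).hasProdLocallyUniformlyOn_one_add (K := Metric.ball (0 : ℂ) R)
      (f := fun i x => -(x * c i)) Metric.isOpen_ball (Eventually.of_forall fun i x hx => ?_)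
      (fun i => by fun_prop)
    · have h2 := h.differentiableOn (.of_forall fun s => by
        simpa [Finset.prod_fn] using DifferentiableOn.finsetProd (fun _ _ => by fun_prop))
        Metric.isOpen_ball
      refine h2.congr fun x _ => ?_
      simp [prodOne, sub_eq_add_neg]
    · simp only [norm_neg, norm_mul]
      have : ‖x‖ < R := by simpa using hx
      gcongr
  intro x
  exact (key (‖x‖ + 1)).differentiableAt (Metric.isOpen_ball.mem_nhds (by simp))

/-- The power sums `∑ᵢ cᵢ^{n+1}`. -/
def powSum (c : ι → ℂ) (n : ℕ) : ℂ := ∑' i, c i ^ (n + 1)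

lemma hasSum_log_prodOne (hc : Summable fun i => ‖c i‖) (hc1 : ∀ i, ‖c i‖ ≤ 1) {x : ℂ}
    (hx : ‖x‖ < 1) :
    ∃ L : ℂ, HasSum (fun n : ℕ => x ^ (n + 1) / (n + 1) * powSum c n) L ∧
      Complex.exp (-L) = prodOne c x := by
  have hxc : ∀ i, ‖x * c i‖ < 1 := fun i => by
    rw [norm_mul]
    exact lt_of_le_of_lt (mul_le_of_le_one_right (norm_nonneg _) (hc1 i)) hx
  have hlog : ∀ i, HasSum (fun n : ℕ => x ^ (n + 1) / (n + 1) * c i ^ (n + 1))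
      (-Complex.log (1 - x * c i)) := fun i => by
    have := (hasSum_nat_add_iff' 1).2 (Complex.hasSum_taylorSeries_neg_log (hxc i))
    simp only [Finset.range_one, Finset.sum_singleton, pow_zero, CharP.cast_eq_zero,
      div_zero, sub_zero] at this
    have e : (fun n : ℕ => x ^ (n + 1) / (n + 1) * c i ^ (n + 1)) =
        fun n : ℕ => (x * c i) ^ (n + 1) / ((n + 1 : ℕ) : ℂ) := by
      ext n
      rw [mul_pow]; push_cast; ring
    rw [e]
    exact this
  have hsum : Summable fun y : ι × ℕ => x ^ (y.2 + 1) / (y.2 + 1) * c y.1 ^ (y.2 + 1) := by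
    have hg : Summable fun y : ι × ℕ => ‖c y.1‖ * ‖x‖ ^ (y.2 + 1) :=
      Summable.mul_of_nonneg (f := fun i => ‖c i‖) (g := fun n : ℕ => ‖x‖ ^ (n + 1)) hc
        ((summable_nat_add_iff 1).2 (summable_geometric_of_lt_one (norm_nonneg _) hx))
        (fun _ => norm_nonneg _) (fun _ => by positivity)
    refine Summable.of_norm_bounded hg fun y => ?_
    rw [norm_mul, norm_div, norm_pow, norm_pow, mul_comm]
    have h1 : ‖c y.1‖ ^ (y.2 + 1) ≤ ‖c y.1‖ := by
      rw [pow_succ]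
      exact mul_le_of_le_one_left (norm_nonneg _) (pow_le_one₀ (norm_nonneg _) (hc1 _))
    have h2 : ‖x‖ ^ (y.2 + 1) / ‖(y.2 : ℂ) + 1‖ ≤ ‖x‖ ^ (y.2 + 1) := by
      apply div_le_self (by positivity)
      have : ((y.2 : ℂ) + 1) = ((y.2 + 1 : ℕ) : ℂ) := by push_cast; ring
      rw [this, Complex.norm_natCast]
      exact_mod_cast Nat.le_add_left 1 _
    gcongr
  have hI : HasSum (fun i => -Complex.log (1 - x * c i)) (∑' y : ι × ℕ,
      x ^ (y.2 + 1) / (y.2 + 1) * c y.1 ^ (y.2 + 1)) := hsum.hasSum.prod_fiberwise hlog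
  have hN := ((Equiv.prodComm ℕ ι).summable_iff.2 hsum)
  refine ⟨∑' y : ι × ℕ, x ^ (y.2 + 1) / (y.2 + 1) * c y.1 ^ (y.2 + 1), ?_, ?_⟩
  · refine ((Equiv.prodComm ℕ ι).hasSum_iff.2 hsum.hasSum).prod_fiberwise fun n => ?_
    have := (hN.prod_factor n).hasSum
    simp only [Function.comp_def, Equiv.prodComm_apply, Prod.swap_prod_mk] at this ⊢
    rwa [tsum_mul_left] at this
  · have h3 := hI.neg
    simp only [neg_neg] at h3
    have h4 := h3.cexp.tprod_eq
    rw [← h4]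
    refine tprod_congr fun i => ?_
    simp only [Function.comp_apply]
    rw [Complex.exp_log]
    intro h
    have := hxc i
    rw [show x * c i = 1 by linear_combination -h] at this
    simp at this

end ProdOne

/-! ### The products `(z; p)_∞` and `{z}` -/

section Poch

variable {p q : ℂ}

lemma summable_poch (hp : ‖p‖ < 1) : Summable fun n : ℕ => ‖p ^ n‖ := by
  simpa using summable_geometric_of_lt_one (norm_nonneg _) hp

/-- The coefficients `pᵐ q⁴ⁿ` of the double product. -/
def dcoef (q p : ℂ) (n : ℕ × ℕ) : ℂ := p ^ n.1 * (q ^ 4) ^ n.2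

lemma summable_dcoef (hp : ‖p‖ < 1) (hq : ‖q‖ < 1) : Summable fun n => ‖dcoef q p n‖ := by
  have h4 : ‖q ^ 4‖ < 1 := by
    rw [norm_pow]; exact pow_lt_one₀ (norm_nonneg _) hq (by norm_num)
  have := Summable.mul_of_nonneg (summable_poch hp) (summable_poch h4)
    (fun _ => norm_nonneg _) (fun _ => norm_nonneg _)
  refine this.congr fun y => ?_
  simp [dcoef]

lemma dpoch_eq (q p z : ℂ) : dpoch q p z = prodOne (dcoef q p) z := by
  simp [dpoch, prodOne, dcoef, mul_assoc]

lemma differentiable_poch (hp : ‖p‖ < 1) : Differentiable ℂ fun z => poch z p :=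
  differentiable_prodOne (summable_poch hp)

lemma differentiable_dpoch (hp : ‖p‖ < 1) (hq : ‖q‖ < 1) : Differentiable ℂ (dpoch q p) := by
  rw [show dpoch q p = prodOne (dcoef q p) from funext (dpoch_eq q p)]
  exact differentiable_prodOne (summable_dcoef hp hq)

lemma poch_ne_zero (hp : ‖p‖ < 1) {z : ℂ} (h : ∀ n : ℕ, z * p ^ n ≠ 1) : poch z p ≠ 0 :=
  prodOne_ne_zero (summable_poch hp) h

lemma poch_ne_zero_of_norm_lt (hp : ‖p‖ < 1) {z : ℂ} (h : ‖z‖ < 1) : poch z p ≠ 0 := by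
  refine poch_ne_zero hp fun n hn => ?_
  have : ‖z * p ^ n‖ < 1 := by
    rw [norm_mul, norm_pow]
    exact lt_of_le_of_lt (mul_le_of_le_one_right (norm_nonneg _)
      (pow_le_one₀ (norm_nonneg _) hp.le)) h
  rw [hn] at this
  simp at this

lemma poch_succ (hp : ‖p‖ < 1) (z : ℂ) : poch z p = (1 - z) * poch (p * z) p := by
  have hm : Multipliable fun n : ℕ => 1 - z * p ^ (n + 1) :=
    (multipliable_prodOne (summable_poch hp) (p * z)).congr fun n => by ring
  simp only [poch]
  rw [tprod_eq_zero_mul' (f := fun n : ℕ => 1 - z * p ^ n) hm]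
  simp only [pow_zero, mul_one]
  congr 1
  exact tprod_congr fun n => by ring

lemma hasProd_dpoch (hp : ‖p‖ < 1) (hq : ‖q‖ < 1) (z : ℂ) :
    HasProd (fun n : ℕ => poch (z * (q ^ 4) ^ n) p) (dpoch q p z) := by
  have h := (Equiv.prodComm ℕ ℕ).hasProd_iff.2
    (multipliable_prodOne (summable_dcoef hp hq) z).hasProd
  rw [dpoch_eq]
  refine h.prod_fiberwise fun n => ?_
  have h1 := (multipliable_prodOne (summable_poch hp) (z * (q ^ 4) ^ n)).hasProd
  have e : (fun m : ℕ => 1 - z * (q ^ 4) ^ n * p ^ m) =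
      fun m => ((fun i => 1 - z * dcoef q p i) ∘ (Equiv.prodComm ℕ ℕ)) (n, m) := by
    ext m
    simp only [Function.comp_apply, Equiv.prodComm_apply, Prod.swap_prod_mk, dcoef]
    ring
  rw [poch, e]
  rw [e] at h1
  exact h1

lemma dpoch_succ (hp : ‖p‖ < 1) (hq : ‖q‖ < 1) (z : ℂ) :
    dpoch q p z = poch z p * dpoch q p (q ^ 4 * z) := by
  have h := hasProd_dpoch hp hq z
  have h' := hasProd_dpoch hp hq (q ^ 4 * z)
  have e : ∀ n : ℕ, q ^ 4 * z * (q ^ 4) ^ n = z * (q ^ 4) ^ (n + 1) := fun n => by ring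
  simp only [e] at h'
  rw [← h.tprod_eq, tprod_eq_zero_mul' (f := fun n : ℕ => poch (z * (q ^ 4) ^ n) p)
    h'.multipliable, h'.tprod_eq]
  simp

end Poch

/-! ### Entire functions: division, double periodicity -/

lemma codiscrete_ne_zero {f : ℂ → ℂ} (hf : Differentiable ℂ f) {x : ℂ} (hx : f x ≠ 0) :
    ∀ᶠ u in codiscrete ℂ, f u ≠ 0 := by
  have := AnalyticOnNhd.preimage_zero_mem_codiscrete (fun z _ => hf.analyticAt z) hx
  filter_upwards [this] with u hu
  simpa using hu

lemma eq_of_mul_eq_mul_entire {A B g : ℂ → ℂ} (hA : Differentiable ℂ A) (hB : Differentiable ℂ B)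
    (hg : Differentiable ℂ g) {x : ℂ} (hx : g x ≠ 0) (h : ∀ y, A y * g y = B y * g y) : A = B := by
  refine AnalyticOnNhd.eq_of_eventuallyEq (z₀ := x) (fun z _ => hA.analyticAt z)
    (fun z _ => hB.analyticAt z) ?_
  filter_upwards [hg.continuous.continuousAt.eventually_ne hx] with y hy
  exact mul_right_cancel₀ hy (h y)

lemma exists_entire_quotient {F g : ℂ → ℂ} (hF : Differentiable ℂ F) (hg : Differentiable ℂ g)
    (h : ∀ y, g y = 0 → F y = 0 ∧ deriv g y ≠ 0) :
    ∃ H : ℂ → ℂ, Differentiable ℂ H ∧ ∀ y, F y = H y * g y := by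
  classical
  refine ⟨fun y => if g y = 0 then deriv F y / deriv g y else F y / g y, fun y₀ => ?_, fun y => ?_⟩
  · by_cases h0 : g y₀ = 0
    · obtain ⟨hF0, hd⟩ := h y₀ h0
      have dF : DifferentiableAt ℂ (dslope F y₀) y₀ :=
        ((Complex.differentiableOn_dslope Filter.univ_mem).2 hF.differentiableOn).differentiableAt
          Filter.univ_mem
      have dg : DifferentiableAt ℂ (dslope g y₀) y₀ :=
        ((Complex.differentiableOn_dslope Filter.univ_mem).2 hg.differentiableOn).differentiableAt
          Filter.univ_mem
      have hne : dslope g y₀ y₀ ≠ 0 := by rwa [dslope_same]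
      refine (dF.div dg hne).congr_of_eventuallyEq ?_
      filter_upwards [dg.continuousAt.eventually_ne hne] with y hy
      by_cases hyy : y = y₀
      · subst hyy; simp [h0, dslope_same]
      · have e1 := sub_smul_dslope F y₀ y
        have e2 := sub_smul_dslope g y₀ y
        rw [hF0, sub_zero, smul_eq_mul] at e1
        rw [h0, sub_zero, smul_eq_mul] at e2
        have hs : y - y₀ ≠ 0 := sub_ne_zero.2 hyy
        have : g y ≠ 0 := by rw [← e2]; exact mul_ne_zero hs hy
        simp only [this, if_false, Pi.div_apply]
        rw [← e1, ← e2, mul_div_mul_left _ _ hs]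
    · refine ((hF y₀).div (hg y₀) h0).congr_of_eventuallyEq ?_
      filter_upwards [(hg y₀).continuousAt.eventually_ne h0] with y hy
      simp [hy]
  · by_cases h0 : g y = 0
    · simp [h0, (h y h0).1]
    · simp [h0]

lemma eq_const_of_doubly_periodic {H : ℂ → ℂ} (hH : Differentiable ℂ H) {a b : ℂ}
    (ha : Function.Periodic H a) (hb : Function.Periodic H b) (hb0 : b ≠ 0)
    (hab : (a / b).im ≠ 0) (x y : ℂ) : H x = H y := by
  refine hH.apply_eq_apply_of_bounded ?_ x y
  let K : Set ℂ := (fun t : ℝ × ℝ => (t.1 : ℂ) * a + t.2 * b) '' (Set.Icc 0 1 ×ˢ Set.Icc 0 1)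
  have hK : IsCompact K := (isCompact_Icc.prod isCompact_Icc).image (by fun_prop)
  refine (hK.image hH.continuous).isBounded.subset ?_
  rintro _ ⟨z, rfl⟩
  set α : ℝ := (z / b).im / (a / b).im
  set β : ℝ := (z / b - α * (a / b)).re
  have hz : z = α * a + β * b := by
    have : z / b - α * (a / b) = β := by
      apply Complex.ext
      · simp [β]
      · simp only [Complex.sub_im, Complex.im_ofReal_mul, Complex.ofReal_im, α]
        field_simp
        ring
    have h2 : z = (z / b - α * (a / b)) * b + α * a := by field_simp; ring
    rw [h2, this]; ring
  refine ⟨(Int.fract α : ℝ) * a + (Int.fract β : ℝ) * b, ⟨(Int.fract α, Int.fract β),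
    ⟨⟨Int.fract_nonneg _, (Int.fract_lt_one _).le⟩, ⟨Int.fract_nonneg _, (Int.fract_lt_one _).le⟩⟩,
    rfl⟩, ?_⟩
  have e : z = (Int.fract α : ℝ) * a + (Int.fract β : ℝ) * b + ⌊α⌋ * a + ⌊β⌋ * b := by
    conv_lhs => rw [hz, ← Int.floor_add_fract α, ← Int.floor_add_fract β]
    push_cast; ring
  conv_rhs => rw [e]
  rw [hb.int_mul, ha.int_mul]

/-! ### The theta functions -/

section ThetaP

variable {p : ℂ}

lemma Theta_p_mul (hp : ‖p‖ < 1) (hp0 : p ≠ 0) {x : ℂ} (hx : x ≠ 0) :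
    Theta p (p * x) = -x⁻¹ * Theta p x := by
  have h1 : p / (p * x) = x⁻¹ := by field_simp
  have h2 : p * x⁻¹ = p / x := by field_simp
  rw [Theta, Theta, h1, poch_succ hp x⁻¹, poch_succ hp x, h2]
  field_simp
  ring

lemma Theta_inv (hp : ‖p‖ < 1) {x : ℂ} (hx : x ≠ 0) : Theta p x⁻¹ = -x⁻¹ * Theta p x := by
  have h1 : p / x⁻¹ = p * x := by field_simp
  have h2 : p * x⁻¹ = p / x := by field_simp
  rw [Theta, Theta, h1, poch_succ hp x⁻¹, poch_succ hp x, h2]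
  field_simp
  ring

lemma Theta_ne_zero (hp : ‖p‖ < 1) (hp0 : p ≠ 0) {x : ℂ} (hx : x ≠ 0) (h : ∀ k : ℤ, x ≠ p ^ k) :
    Theta p x ≠ 0 := by
  refine mul_ne_zero (mul_ne_zero (poch_ne_zero hp fun n hn => ?_) (poch_ne_zero hp fun n hn => ?_))
    (poch_ne_zero_of_norm_lt hp hp)
  · apply h (-n)
    rw [zpow_neg, zpow_natCast]
    exact eq_inv_of_mul_eq_one_left hn
  · apply h (n + 1)
    rw [zpow_add₀ hp0, zpow_natCast, zpow_one]
    field_simp at hn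
    linear_combination -hn

lemma differentiableAt_Theta (hp : ‖p‖ < 1) {x : ℂ} (hx : x ≠ 0) :
    DifferentiableAt ℂ (Theta p) x := by
  unfold Theta
  exact ((differentiable_poch hp x).mul ((differentiable_poch hp _).comp x
    ((differentiableAt_const p).div differentiableAt_id hx))).mul_const _

end ThetaP

section theta

variable {q r : ℂ}

lemma log_ne_zero_of_norm_lt (hq0 : q ≠ 0) (hq1 : ‖q‖ < 1) : Complex.log q ≠ 0 := by
  intro h
  have := Complex.exp_log hq0
  rw [h, Complex.exp_zero] at this
  rw [← this] at hq1
  simp at hq1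

lemma cpow_ne_zero (hq0 : q ≠ 0) (x : ℂ) : q ^ x ≠ 0 := by simp [Complex.cpow_eq_zero_iff, hq0]

lemma cpow_pi_div (hq0 : q ≠ 0) (hq1 : ‖q‖ < 1) (x : ℂ) :
    q ^ (x / Complex.log q) = Complex.exp x := by
  rw [Complex.cpow_def_of_ne_zero hq0, mul_div_cancel₀ _ (log_ne_zero_of_norm_lt hq0 hq1)]

/-- The second quasi-period `πi / log q` of `[u]`. -/
def omega (q : ℂ) : ℂ := Real.pi * Complex.I / Complex.log q

lemma cpow_omega (hq0 : q ≠ 0) (hq1 : ‖q‖ < 1) : q ^ omega q = -1 := by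
  rw [omega, cpow_pi_div hq0 hq1, Complex.exp_pi_mul_I]

lemma differentiable_theta (hq0 : q ≠ 0) (hp : ‖q ^ (2 * r)‖ < 1) :
    Differentiable ℂ (theta q r) := by
  intro u
  unfold theta
  have h1 : DifferentiableAt ℂ (fun u : ℂ => q ^ (2 * u)) u :=
    DifferentiableAt.const_cpow (by fun_prop) (Or.inl hq0)
  have h2 : DifferentiableAt ℂ (fun u : ℂ => q ^ (u ^ 2 / r - u)) u :=
    DifferentiableAt.const_cpow (by fun_prop) (Or.inl hq0)
  exact (h2.div_const _).mul
    ((differentiableAt_Theta hp (cpow_ne_zero hq0 _)).comp (g := Theta (q ^ (2 * r)))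
      (f := fun u : ℂ => q ^ (2 * u)) u h1)

lemma theta_neg (hq0 : q ≠ 0) (hp : ‖q ^ (2 * r)‖ < 1) (u : ℂ) :
    theta q r (-u) = -theta q r u := by
  unfold theta
  have e1 : q ^ (2 * -u) = (q ^ (2 * u))⁻¹ := by rw [← Complex.cpow_neg]; ring_nf
  have e2 : q ^ ((-u) ^ 2 / r - -u) = q ^ (u ^ 2 / r - u) * q ^ (2 * u) := by
    rw [← Complex.cpow_add _ _ hq0]; ring_nf
  rw [e1, e2, Theta_inv hp (cpow_ne_zero hq0 _)]
  field_simp [cpow_ne_zero hq0]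

lemma theta_zero (hq0 : q ≠ 0) (hp : ‖q ^ (2 * r)‖ < 1) : theta q r 0 = 0 := by
  have := theta_neg hq0 hp 0
  rw [neg_zero] at this
  exact CharZero.eq_neg_self_iff.1 this

lemma r_ne_zero_of_norm_lt (hp : ‖q ^ (2 * r)‖ < 1) : r ≠ 0 := by
  rintro rfl
  simp at hp

lemma theta_add_r (hq0 : q ≠ 0) (hp : ‖q ^ (2 * r)‖ < 1) (u : ℂ) :
    theta q r (u + r) = -theta q r u := by
  have hr := r_ne_zero_of_norm_lt hp
  unfold theta
  have e1 : q ^ (2 * (u + r)) = q ^ (2 * r) * q ^ (2 * u) := by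
    rw [← Complex.cpow_add _ _ hq0]; ring_nf
  have e2 : q ^ ((u + r) ^ 2 / r - (u + r)) = q ^ (u ^ 2 / r - u) * q ^ (2 * u) := by
    rw [← Complex.cpow_add _ _ hq0]
    congr 1
    field_simp
    ring
  rw [e1, e2, Theta_p_mul hp (cpow_ne_zero hq0 _) (cpow_ne_zero hq0 _)]
  field_simp [cpow_ne_zero hq0]

lemma theta_add_omega (hq0 : q ≠ 0) (hq1 : ‖q‖ < 1) (u : ℂ) :
    theta q r (u + omega q) =
      q ^ ((2 * u * omega q + omega q ^ 2) / r - omega q) * theta q r u := by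
  unfold theta
  have e1 : q ^ (2 * (u + omega q)) = q ^ (2 * u) := by
    rw [mul_add, Complex.cpow_add _ _ hq0, two_mul (omega q), Complex.cpow_add _ _ hq0,
      cpow_omega hq0 hq1]
    ring
  have e2 : q ^ ((u + omega q) ^ 2 / r - (u + omega q)) =
      q ^ ((2 * u * omega q + omega q ^ 2) / r - omega q) * q ^ (u ^ 2 / r - u) := by
    rw [← Complex.cpow_add _ _ hq0]
    congr 1
    ring
  rw [e1, e2]
  ring

/-- The additive group of exponential quasi-periods of `[u]`. -/
def quasiPeriods (q r : ℂ) : AddSubgroup ℂ where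
  carrier := {t | ∃ a b : ℂ, ∀ u, theta q r (u + t) = Complex.exp (a * u + b) * theta q r u}
  zero_mem' := ⟨0, 0, by simp⟩
  add_mem' := by
    rintro s t ⟨a, b, h⟩ ⟨a', b', h'⟩
    refine ⟨a + a', b + b' + a' * s, fun u => ?_⟩
    rw [← add_assoc, h', h, ← mul_assoc, ← Complex.exp_add]
    ring_nf
  neg_mem' := by
    rintro t ⟨a, b, h⟩
    refine ⟨-a, a * t - b, fun u => ?_⟩
    have := h (u + -t)
    rw [neg_add_cancel_right] at this
    rw [this, ← mul_assoc, ← Complex.exp_add]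
    ring_nf
    simp

lemma mem_quasiPeriods_of_theta_eq_zero (hq0 : q ≠ 0) (hq1 : ‖q‖ < 1) (hp : ‖q ^ (2 * r)‖ < 1)
    {u : ℂ} (h : theta q r u = 0) : u ∈ quasiPeriods q r := by
  have hL := log_ne_zero_of_norm_lt hq0 hq1
  have hr : r ∈ quasiPeriods q r := ⟨0, Real.pi * Complex.I, fun u => by
    rw [theta_add_r hq0 hp]; simp⟩
  have ho : omega q ∈ quasiPeriods q r := by
    refine ⟨Complex.log q * (2 * omega q / r), Complex.log q * (omega q ^ 2 / r - omega q),
      fun u => ?_⟩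
    rw [theta_add_omega hq0 hq1, Complex.cpow_def_of_ne_zero hq0]
    ring_nf
  have hT : Theta (q ^ (2 * r)) (q ^ (2 * u)) = 0 := by
    unfold theta at h
    rcases mul_eq_zero.1 h with h | h
    · exact absurd h (div_ne_zero (cpow_ne_zero hq0 _) (pow_ne_zero _ (poch_ne_zero_of_norm_lt hp hp)))
    · exact h
  obtain ⟨k, hk⟩ : ∃ k : ℤ, q ^ (2 * u) = (q ^ (2 * r)) ^ k := by
    by_contra! hk
    exact Theta_ne_zero hp (cpow_ne_zero hq0 _) (cpow_ne_zero hq0 _) hk hT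
  rw [← Complex.cpow_mul_int, Complex.cpow_def_of_ne_zero hq0, Complex.cpow_def_of_ne_zero hq0,
    Complex.exp_eq_exp_iff_exists_int] at hk
  obtain ⟨n, hn⟩ := hk
  have : u = k • r + n • omega q := by
    simp only [zsmul_eq_mul, omega]
    field_simp
    linear_combination hn / 2
  rw [this]
  exact add_mem (zsmul_mem hr k) (zsmul_mem ho n)

lemma deriv_theta_zero_ne_zero (hq0 : q ≠ 0) (hq1 : ‖q‖ < 1) (hp : ‖q ^ (2 * r)‖ < 1) :
    deriv (theta q r) 0 ≠ 0 := by
  set p := q ^ (2 * r) with hpd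
  let B : ℂ → ℂ := fun u => q ^ (u ^ 2 / r - u) / poch p p ^ 3 *
    (poch (p * q ^ (2 * u)) p * poch (p / q ^ (2 * u)) p * poch p p)
  have e : theta q r = fun u => (1 - q ^ (2 * u)) * B u := by
    ext u
    simp only [theta, B, Theta, ← hpd]
    rw [poch_succ hp (q ^ (2 * u))]
    ring
  have h1 : ∀ u, HasDerivAt (fun u : ℂ => q ^ (2 * u)) (q ^ (2 * u) * Complex.log q * 2) u :=
    fun u => by
    have := HasDerivAt.const_cpow (c := q) ((hasDerivAt_id u).const_mul 2) (Or.inl hq0)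
    simpa using this
  have h2 : DifferentiableAt ℂ (fun u : ℂ => q ^ (u ^ 2 / r - u)) 0 :=
    DifferentiableAt.const_cpow (by fun_prop) (Or.inl hq0)
  have hB : DifferentiableAt ℂ B 0 := by
    refine (h2.div_const _).mul (DifferentiableAt.mul_const (DifferentiableAt.mul ?_ ?_) _)
    · exact (differentiable_poch hp _).comp (0 : ℂ) ((h1 0).differentiableAt.const_mul p)
    · exact (differentiable_poch hp _).comp (0 : ℂ)
        ((differentiableAt_const p).div (h1 0).differentiableAt (cpow_ne_zero hq0 _))
  have hd := (((h1 0).const_sub 1).mul hB.hasDerivAt).deriv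
  have e' : theta q r = (fun u : ℂ => 1 - q ^ (2 * u)) * B := e
  rw [e', hd]
  have hpp := poch_ne_zero_of_norm_lt hp hp
  simp only [mul_zero, Complex.cpow_zero, sub_self, zero_mul, add_zero, one_mul, mul_one, B,
    div_one, ne_eq, zero_pow two_ne_zero, zero_div]
  have := log_ne_zero_of_norm_lt hq0 hq1
  simp [hpp, this]

lemma deriv_theta_ne_zero (hq0 : q ≠ 0) (hq1 : ‖q‖ < 1) (hp : ‖q ^ (2 * r)‖ < 1) {t : ℂ}
    (ht : theta q r t = 0) : deriv (theta q r) t ≠ 0 := by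
  obtain ⟨a, b, h⟩ := mem_quasiPeriods_of_theta_eq_zero hq0 hq1 hp ht
  have hθ := differentiable_theta (r := r) hq0 hp
  have e : (fun u => theta q r (u + t)) = fun u => Complex.exp (a * u + b) * theta q r u :=
    funext h
  have h1 : deriv (fun u => theta q r (u + t)) 0 = deriv (theta q r) t := by
    rw [deriv_comp_add_const, zero_add]
  have h2 : HasDerivAt (fun u => Complex.exp (a * u + b)) (deriv (fun u => Complex.exp (a * u + b)) 0) 0 :=
    DifferentiableAt.hasDerivAt (by fun_prop)
  have h3 := (h2.mul (hθ 0).hasDerivAt).deriv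
  rw [← h1, e]
  intro h4
  have h5 : Complex.exp (a * 0 + b) * deriv (theta q r) 0 = 0 := by
    have h6 : deriv ((fun u => Complex.exp (a * u + b)) * theta q r) 0 = 0 := h4
    rw [h3, theta_zero hq0 hp, mul_zero, zero_add] at h6
    exact h6
  exact mul_ne_zero (Complex.exp_ne_zero _) (deriv_theta_zero_ne_zero hq0 hq1 hp) h5

lemma exists_theta_ne_zero (hq0 : q ≠ 0) (hq1 : ‖q‖ < 1) (hp : ‖q ^ (2 * r)‖ < 1) :
    ∃ u, theta q r u ≠ 0 := by
  by_contra! h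
  apply deriv_theta_zero_ne_zero hq0 hq1 hp
  rw [show theta q r = fun _ => 0 from funext h]
  simp

lemma im_r_div_omega (hq0 : q ≠ 0) (hq1 : ‖q‖ < 1) (hp : ‖q ^ (2 * r)‖ < 1) :
    (r / omega q).im ≠ 0 := by
  have hL := log_ne_zero_of_norm_lt hq0 hq1
  have hpi : (Real.pi : ℂ) ≠ 0 := by exact_mod_cast Real.pi_ne_zero
  have e : r / omega q = ((-1 / (2 * Real.pi) : ℝ) : ℂ) * (Complex.I * (Complex.log q * (2 * r))) := by
    rw [omega]
    push_cast
    field_simp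
    rw [Complex.I_sq]
    ring
  rw [Complex.cpow_def_of_ne_zero hq0, Complex.norm_exp, Real.exp_lt_one_iff] at hp
  rw [e, Complex.im_ofReal_mul, Complex.I_mul_im]
  exact mul_ne_zero (div_ne_zero (by norm_num) (by positivity)) hp.ne

/-- The three-term (Weierstrass) identity for `[u]`. -/
lemma theta_three_term (hq0 : q ≠ 0) (hq1 : ‖q‖ < 1) (hp : ‖q ^ (2 * r)‖ < 1) {x s : ℂ}
    (h2x : theta q r (2 * x) ≠ 0) (hs : theta q r (x + s) ≠ 0) (hs' : theta q r (x - s) ≠ 0)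
    (y t : ℂ) :
    theta q r (x + s) * theta q r (x - s) * (theta q r (y - t) * theta q r (y + t)) =
      theta q r (x + t) * theta q r (x - t) * (theta q r (y - s) * theta q r (y + s)) -
      theta q r (x + y) * theta q r (x - y) * (theta q r (t - s) * theta q r (t + s)) := by
  have hθ := differentiable_theta (r := r) hq0 hp
  have neg : ∀ u, theta q r (-u) = -theta q r u := theta_neg hq0 hp
  set θ := theta q r with hθdef
  let F : ℂ → ℂ := fun y => θ (x + s) * θ (x - s) * (θ (y - t) * θ (y + t)) -
    (θ (x + t) * θ (x - t) * (θ (y - s) * θ (y + s)) -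
      θ (x + y) * θ (x - y) * (θ (t - s) * θ (t + s)))
  let g : ℂ → ℂ := fun y => θ (y + x) * θ (y - x)
  have hF : Differentiable ℂ F := by fun_prop
  have hg : Differentiable ℂ g := by fun_prop
  have flip : ∀ a b, θ (a - b) = -θ (b - a) := fun a b => by rw [← neg, neg_sub]
  have Fx : F x = 0 := by
    simp only [F, sub_self, show θ 0 = 0 from theta_zero hq0 hp]; ring
  have Feven : ∀ y, F (-y) = F y := fun y => by
    have e1 : θ (-y - t) = -θ (y + t) := by rw [← neg]; ring_nf
    have e2 : θ (-y + t) = -θ (y - t) := by rw [← neg]; ring_nf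
    have e3 : θ (-y - s) = -θ (y + s) := by rw [← neg]; ring_nf
    have e4 : θ (-y + s) = -θ (y - s) := by rw [← neg]; ring_nf
    have e5 : θ (x + -y) = θ (x - y) := by ring_nf
    have e6 : θ (x - -y) = θ (x + y) := by ring_nf
    simp only [F, e1, e2, e3, e4, e5, e6]; ring
  have shiftF : ∀ c a b : ℂ, (∀ u, θ (u + c) = Complex.exp (a * u + b) * θ u) →
      ∀ y, F (y + c) = Complex.exp (2 * a * y + 2 * b) * F y ∧
        g (y + c) = Complex.exp (2 * a * y + 2 * b) * g y := by
    intro c a b h y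
    have key : ∀ d, θ (y + c - d) * θ (y + c + d) =
        Complex.exp (2 * a * y + 2 * b) * (θ (y - d) * θ (y + d)) := fun d => by
      rw [show y + c - d = (y - d) + c by ring, show y + c + d = (y + d) + c by ring, h, h]
      have : Complex.exp (2 * a * y + 2 * b) =
          Complex.exp (a * (y - d) + b) * Complex.exp (a * (y + d) + b) := by
        rw [← Complex.exp_add]; ring_nf
      rw [this]; ring
    have gk : g (y + c) = Complex.exp (2 * a * y + 2 * b) * g y := by
      simp only [g]
      rw [mul_comm, key]; ring
    have e : ∀ z, θ (x + z) * θ (x - z) = -g z := fun z => by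
      simp only [g]; rw [flip x z, add_comm x z]; ring
    refine ⟨?_, gk⟩
    simp only [F]
    rw [e s, e t, e (y + c), e y, gk, key, key]; ring
  have hquot : ∀ y, g y = 0 → F y = 0 ∧ deriv g y ≠ 0 := by
    intro y hy
    have hd : deriv g y = deriv θ (y + x) * θ (y - x) + θ (y + x) * deriv θ (y - x) := by
      have h1 : HasDerivAt (fun y => θ (y + x)) (deriv θ (y + x)) y :=
        HasDerivAt.comp_add_const y x (hθ _).hasDerivAt
      have h2 : HasDerivAt (fun y => θ (y - x)) (deriv θ (y - x)) y :=
        HasDerivAt.comp_sub_const y x (hθ _).hasDerivAt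
      exact (h1.mul h2).deriv
    rcases mul_eq_zero.1 hy with h0 | h0
    · obtain ⟨a, b, h⟩ := mem_quasiPeriods_of_theta_eq_zero hq0 hq1 hp h0
      refine ⟨?_, ?_⟩
      · have := (shiftF _ a b h (-x)).1
        rw [Feven, Fx, mul_zero] at this
        rw [← this]; ring_nf
      · rw [hd, h0, zero_mul, add_zero]
        refine mul_ne_zero (deriv_theta_ne_zero hq0 hq1 hp h0) ?_
        have := h (-(2 * x))
        rw [show -(2 * x) + (y + x) = y - x by ring, ← hθdef] at this
        rw [this, neg]
        exact mul_ne_zero (Complex.exp_ne_zero _) (neg_ne_zero.2 h2x)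
    · obtain ⟨a, b, h⟩ := mem_quasiPeriods_of_theta_eq_zero hq0 hq1 hp h0
      refine ⟨?_, ?_⟩
      · have := (shiftF _ a b h x).1
        rw [Fx, mul_zero] at this
        rw [← this]; ring_nf
      · rw [hd, h0, mul_zero, zero_add]
        refine mul_ne_zero ?_ (deriv_theta_ne_zero hq0 hq1 hp h0)
        have := h (2 * x)
        rw [show 2 * x + (y - x) = y + x by ring, ← hθdef] at this
        rw [this]
        exact mul_ne_zero (Complex.exp_ne_zero _) h2x
  obtain ⟨H, hH, hFH⟩ := exists_entire_quotient hF hg hquot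
  have hgs : g s ≠ 0 := by
    simp only [g]
    rw [flip s x, add_comm]
    exact mul_ne_zero hs (neg_ne_zero.2 hs')
  have per : ∀ c a b : ℂ, (∀ u, θ (u + c) = Complex.exp (a * u + b) * θ u) →
      Function.Periodic H c := by
    intro c a b h
    have : (fun y => H (y + c)) = H := by
      refine eq_of_mul_eq_mul_entire (by fun_prop) hH hg hgs fun y => ?_
      have h1 := hFH (y + c)
      rw [(shiftF c a b h y).1, (shiftF c a b h y).2, hFH y] at h1
      have := Complex.exp_ne_zero (2 * a * y + 2 * b)
      apply mul_left_cancel₀ this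
      linear_combination -h1
    exact fun y => congrFun this y
  have hr : Function.Periodic H r := per r 0 (Real.pi * Complex.I) fun u => by
    rw [hθdef, theta_add_r hq0 hp]; simp
  have ho : Function.Periodic H (omega q) := per _ (Complex.log q * (2 * omega q / r))
      (Complex.log q * (omega q ^ 2 / r - omega q)) fun u => by
    rw [hθdef, theta_add_omega hq0 hq1, Complex.cpow_def_of_ne_zero hq0]
    ring_nf
  have ho0 : omega q ≠ 0 := div_ne_zero
    (mul_ne_zero (by exact_mod_cast Real.pi_ne_zero) Complex.I_ne_zero)
    (log_ne_zero_of_norm_lt hq0 hq1)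
  have Fs : F s = 0 := by
    simp only [F, sub_self, show θ 0 = 0 from theta_zero hq0 hp]
    rw [flip t s, add_comm t s]; ring
  have Hs : H s = 0 := by
    have := hFH s
    rw [Fs] at this
    exact (mul_eq_zero.1 this.symm).resolve_right hgs
  have hy := hFH y
  rw [eq_const_of_doubly_periodic hH hr ho ho0 (im_r_div_omega hq0 hq1 hp) y s, Hs, zero_mul] at hy
  exact sub_eq_zero.1 hy

end theta

/-! ### Uniqueness of meromorphic continuation -/

lemma MeromorphicNFOn.eq_of_eventuallyEq {f g : ℂ → ℂ} (hf : MeromorphicNFOn f Set.univ)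
    (hg : MeromorphicNFOn g Set.univ) {x₀ : ℂ} (h : f =ᶠ[𝓝 x₀] g) : f = g := by
  ext x
  have hd : MeromorphicOn (f - g) Set.univ := hf.meromorphicOn.sub hg.meromorphicOn
  have h0 : meromorphicOrderAt (f - g) x₀ = ⊤ := by
    rw [meromorphicOrderAt_eq_top_iff]
    filter_upwards [h.filter_mono nhdsWithin_le_nhds] with z hz
    simp [hz]
  have h1 : meromorphicOrderAt (f - g) x = ⊤ := by
    by_contra hx
    exact hd.meromorphicOrderAt_ne_top_of_isPreconnected (y := x₀) isPreconnected_univ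
      (Set.mem_univ x) (Set.mem_univ _) hx h0
  rw [meromorphicOrderAt_eq_top_iff] at h1
  have h2 : f =ᶠ[𝓝[≠] x] g := by
    filter_upwards [h1] with z hz
    exact sub_eq_zero.1 hz
  exact ((hf (Set.mem_univ x)).eventuallyEq_nhdsNE_iff_eventuallyEq_nhds
    (hg (Set.mem_univ x))).1 h2 |>.eq_of_nhds

lemma toMeromorphicNFOn_apply_of_analyticAt {g : ℂ → ℂ} (hg : Meromorphic g) {x : ℂ}
    (hx : AnalyticAt ℂ g x) : toMeromorphicNFOn g Set.univ x = g x := by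
  rw [toMeromorphicNFOn_eq_toMeromorphicNFAt hg.meromorphicOn (Set.mem_univ x),
    toMeromorphicNFAt_eq_self.2 hx.meromorphicNFAt]

lemma meroExt_eq {F : Filter ℂ} {x₀ : ℂ} (hF : 𝓝 x₀ ≤ F) {f g : ℂ → ℂ} (hg : Meromorphic g)
    (hfg : ∀ᶠ x in F, AnalyticAt ℂ g x ∧ g x = f x) {x : ℂ} (hx : AnalyticAt ℂ g x) :
    meroExt F f x = g x := by
  have hG : MeromorphicNFOn (toMeromorphicNFOn g Set.univ) Set.univ :=
    meromorphicNFOn_toMeromorphicNFOn _ _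
  have hGf : toMeromorphicNFOn g Set.univ =ᶠ[F] f := by
    filter_upwards [hfg] with y hy
    rw [toMeromorphicNFOn_apply_of_analyticAt hg hy.1, hy.2]
  have hex : ∃ g : ℂ → ℂ, MeromorphicNFOn g Set.univ ∧ g =ᶠ[F] f := ⟨_, hG, hGf⟩
  rw [meroExt, dif_pos hex, MeromorphicNFOn.eq_of_eventuallyEq hex.choose_spec.1 hG
    ((hex.choose_spec.2.trans hGf.symm).filter_mono hF),
    toMeromorphicNFOn_apply_of_analyticAt hg hx]

/-! ### Laurent expansion on an annulus -/

/-- Parametrization of the circle through `z`. -/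
def circ (z : ℂ) (t : ℝ) : ℂ := z * Complex.exp (2 * Real.pi * Complex.I * t)

lemma norm_circ (z : ℂ) (t : ℝ) : ‖circ z t‖ = ‖z‖ := by
  rw [circ, norm_mul, show (2 * Real.pi * Complex.I * t : ℂ) = ((2 * Real.pi * t : ℝ) : ℂ) *
    Complex.I by push_cast; ring, Complex.norm_exp_ofReal_mul_I, mul_one]

lemma integral_circ_eq_circleAverage (Φ : ℂ → ℂ) (z : ℂ) :
    ∫ t in (0 : ℝ)..1, Φ (circ z t) = Real.circleAverage Φ 0 ‖z‖ := by
  rw [Real.circleAverage_eq_integral_add (η := z.arg)]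
  have e : ∀ t : ℝ, circ z t = circleMap 0 ‖z‖ (2 * Real.pi * t + z.arg) := fun t => by
    rw [circ, circleMap]
    conv_lhs => rw [← Complex.norm_mul_exp_arg_mul_I z]
    rw [mul_assoc, ← Complex.exp_add]
    push_cast
    ring_nf
  simp_rw [e]
  rw [intervalIntegral.integral_comp_mul_left
    (fun θ => Φ (circleMap 0 ‖z‖ (θ + z.arg))) (by positivity : (2 * Real.pi) ≠ 0)]
  simp

section Laurent

variable {G : ℂ → ℂ} {R₁ R₂ : ℝ}

lemma circleAverage_eq_of_annulus (hR : 0 ≤ R₁)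
    (hG : ∀ z, R₁ < ‖z‖ → ‖z‖ < R₂ → DifferentiableAt ℂ G z) {a b : ℝ} (ha : R₁ < a) (hab : a ≤ b)
    (hb : b < R₂) : Real.circleAverage G 0 a = Real.circleAverage G 0 b := by
  have ha0 : 0 < a := hR.trans_lt ha
  rw [Real.circleAverage_eq_circleIntegral ha0.ne',
    Real.circleAverage_eq_circleIntegral (ha0.trans_le hab).ne',
    Complex.circleIntegral_sub_center_inv_smul_eq_of_differentiable_on_annulus_off_countable ha0
      hab Set.countable_empty]
  · intro z hz
    simp only [Set.mem_sdiff, Metric.mem_closedBall, dist_zero_right, Metric.mem_ball, not_lt] at hz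
    exact (hG z (by linarith) (by linarith)).continuousAt.continuousWithinAt
  · intro z hz
    simp only [Set.mem_sdiff, Metric.mem_closedBall, dist_zero_right, Metric.mem_ball, not_le] at hz
    exact hG z (by linarith) (by linarith)

lemma circleAverage_eq_of_annulus' (hR : 0 ≤ R₁)
    (hG : ∀ z, R₁ < ‖z‖ → ‖z‖ < R₂ → DifferentiableAt ℂ G z) {a b : ℝ} (ha : R₁ < a) (ha' : a < R₂)
    (hb : R₁ < b) (hb' : b < R₂) : Real.circleAverage G 0 a = Real.circleAverage G 0 b := by
  rcases le_total a b with h | h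
  · exact circleAverage_eq_of_annulus hR hG ha h hb'
  · exact (circleAverage_eq_of_annulus hR hG hb h ha').symm

/-- The Laurent coefficients of `G`, computed on the circle of radius `ρ`. -/
def laurentCoeff (G : ℂ → ℂ) (ρ : ℝ) (n : ℤ) : ℂ :=
  Real.circleAverage (fun z => z ^ (-n) * G z) 0 ρ

lemma differentiableAt_zpow_mul (hR : 0 ≤ R₁)
    (hG : ∀ z, R₁ < ‖z‖ → ‖z‖ < R₂ → DifferentiableAt ℂ G z) (n : ℤ) (z : ℂ) (h1 : R₁ < ‖z‖)
    (h2 : ‖z‖ < R₂) : DifferentiableAt ℂ (fun z => z ^ (-n) * G z) z :=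
  (differentiableAt_zpow.2 (Or.inl (norm_pos_iff.1 (hR.trans_lt h1)))).mul (hG z h1 h2)

lemma norm_laurentCoeff_le (hR : 0 ≤ R₁)
    (hG : ∀ z, R₁ < ‖z‖ → ‖z‖ < R₂ → DifferentiableAt ℂ G z) {ρ : ℝ} (h1 : R₁ < ρ) (h2 : ρ < R₂) :
    ∃ M : ℝ, 0 ≤ M ∧ ∀ n, ‖laurentCoeff G ρ n‖ ≤ M * ρ ^ (-n) := by
  have hρ : 0 < ρ := hR.trans_lt h1
  have hcont : ContinuousOn G (Metric.sphere 0 ρ) := fun z hz => by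
    have hz' : ‖z‖ = ρ := by simpa using hz
    exact (hG z (hz' ▸ h1) (hz' ▸ h2)).continuousAt.continuousWithinAt
  obtain ⟨M, hM⟩ := (isCompact_sphere (0 : ℂ) ρ).exists_bound_of_continuousOn hcont
  refine ⟨|M|, abs_nonneg _, fun n => ?_⟩
  rw [laurentCoeff, Real.circleAverage_def, norm_smul, Real.norm_of_nonneg (by positivity)]
  have := intervalIntegral.norm_integral_le_of_norm_le_const (a := 0) (b := 2 * Real.pi)
    (f := fun θ => (circleMap 0 ρ θ) ^ (-n) * G (circleMap 0 ρ θ)) (C := |M| * ρ ^ (-n))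
    (fun θ _ => by
      rw [norm_mul, norm_zpow, norm_circleMap_zero, abs_of_pos hρ, mul_comm]
      gcongr
      exact (hM _ (circleMap_mem_sphere _ hρ.le _)).trans (le_abs_self _))
  rw [sub_zero, abs_of_pos Real.two_pi_pos] at this
  calc _ ≤ (2 * Real.pi)⁻¹ * (|M| * ρ ^ (-n) * (2 * Real.pi)) := by gcongr
    _ = _ := by field_simp

lemma hasSum_laurent (hR : 0 ≤ R₁)
    (hG : ∀ z, R₁ < ‖z‖ → ‖z‖ < R₂ → DifferentiableAt ℂ G z) {ρ : ℝ} (h1 : R₁ < ρ) (h2 : ρ < R₂)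
    {ζ : ℂ} (hz1 : R₁ < ‖ζ‖) (hz2 : ‖ζ‖ < R₂) :
    HasSum (fun n : ℤ => ζ ^ n * laurentCoeff G ρ n) (G ζ) := by
  have hζ0 : 0 < ‖ζ‖ := hR.trans_lt hz1
  have hζ : ζ ≠ 0 := norm_pos_iff.1 hζ0
  have indep : ∀ {σ}, R₁ < σ → σ < R₂ → ∀ n, laurentCoeff G ρ n = laurentCoeff G σ n :=
    fun hσ hσ' n => circleAverage_eq_of_annulus' hR (differentiableAt_zpow_mul hR hG n) h1 h2 hσ hσ'
  -- summability
  have hsum : Summable fun n : ℤ => ζ ^ n * laurentCoeff G ρ n := by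
    obtain ⟨b, hb1, hb2⟩ := exists_between hz2
    obtain ⟨a, ha1, ha2⟩ := exists_between hz1
    have ha0 : 0 < a := hR.trans_lt ha1
    have hb0 : 0 < b := hζ0.trans hb1
    obtain ⟨Mb, hMb, hb⟩ := norm_laurentCoeff_le hR hG (hz1.trans hb1) hb2
    obtain ⟨Ma, hMa, ha⟩ := norm_laurentCoeff_le hR hG ha1 (ha2.trans hz2)
    refine Summable.of_nat_of_neg ?_ ?_
    · have hg : Summable fun n : ℕ => Mb * (‖ζ‖ / b) ^ n :=
        (summable_geometric_of_lt_one (by positivity) ((div_lt_one hb0).2 hb1)).mul_left _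
      refine Summable.of_norm_bounded hg fun n => ?_
      rw [indep (hz1.trans hb1) hb2, norm_mul, norm_zpow]
      calc _ ≤ ‖ζ‖ ^ (n : ℤ) * (Mb * b ^ (-(n : ℤ))) := by gcongr; exact hb n
        _ = _ := by rw [zpow_neg, zpow_natCast, zpow_natCast, div_pow]; ring
    · have hg : Summable fun n : ℕ => Ma * (a / ‖ζ‖) ^ n :=
        (summable_geometric_of_lt_one (by positivity) ((div_lt_one hζ0).2 ha2)).mul_left _
      refine Summable.of_norm_bounded hg fun n => ?_
      rw [indep ha1 (ha2.trans hz2), norm_mul, norm_zpow]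
      calc _ ≤ ‖ζ‖ ^ (-(n : ℤ)) * (Ma * a ^ (-(-(n : ℤ)))) := by gcongr; exact ha _
        _ = _ := by rw [zpow_neg, neg_neg, zpow_natCast, zpow_natCast, div_pow]; ring
  -- the Fourier series on the circle through `ζ`
  have per : Function.Periodic (fun t : ℝ => G (circ ζ t)) 1 := fun t => by
    simp only [circ]
    congr 2
    rw [show (2 * Real.pi * Complex.I * ((t + 1 : ℝ) : ℂ) : ℂ) = 2 * Real.pi * Complex.I * t +
      2 * Real.pi * Complex.I by push_cast; ring, Complex.exp_add, Complex.exp_two_pi_mul_I, mul_one]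
  have hcirc : Continuous (circ ζ) := by unfold circ; fun_prop
  have hcontG : Continuous fun t : ℝ => G (circ ζ t) := by
    rw [continuous_iff_continuousAt]
    intro t
    have hd : DifferentiableAt ℂ G (circ ζ t) :=
      hG _ (by rw [norm_circ]; exact hz1) (by rw [norm_circ]; exact hz2)
    exact ContinuousAt.comp (g := G) (f := circ ζ) hd.continuousAt hcirc.continuousAt
  let f : C(AddCircle (1 : ℝ), ℂ) := ⟨per.lift, continuous_coinduced_dom.2 hcontG⟩
  have : Fact ((0 : ℝ) < 1) := ⟨one_pos⟩
  have hfc : ∀ n : ℤ, fourierCoeff f n = ζ ^ n * laurentCoeff G ρ n := fun n => by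
    rw [fourierCoeff_eq_intervalIntegral f n 0, indep hz1 hz2, laurentCoeff,
      ← integral_circ_eq_circleAverage, zero_add, ← intervalIntegral.integral_const_mul,
      div_one, one_smul]
    refine intervalIntegral.integral_congr fun t _ => ?_
    have e1 : f (t : AddCircle (1 : ℝ)) = G (circ ζ t) := rfl
    simp only [smul_eq_mul]
    rw [e1, fourier_coe_apply, ← mul_assoc]
    congr 1
    rw [circ, mul_zpow, ← mul_assoc, ← zpow_add₀ hζ, add_neg_cancel, zpow_zero, one_mul,
      ← Complex.exp_int_mul]
    congr 1
    push_cast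
    ring
  have hs : Summable (fourierCoeff f) := hsum.congr fun n => (hfc n).symm
  have key := has_pointwise_sum_fourier_series_of_summable hs (0 : AddCircle (1 : ℝ))
  have e0 : f (0 : AddCircle (1 : ℝ)) = G ζ := by
    have : f ((0 : ℝ) : AddCircle (1 : ℝ)) = G (circ ζ 0) := rfl
    rw [AddCircle.coe_zero] at this
    rw [this, circ]; simp
  rw [e0] at key
  simpa only [fourier_eval_zero, smul_eq_mul, mul_one, hfc] using key

end Laurent

/-! ### Arithmetic in the field `𝔽` -/

lemma ofFun_of_meromorphic {f : ℂ → ℂ} (hf : Meromorphic f) : ofFun f = toMF ⟨f, hf⟩ := by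
  exact dif_pos hf

lemma ofFun_mul {f g : ℂ → ℂ} (hf : Meromorphic f) (hg : Meromorphic g) :
    ofFun f * ofFun g = ofFun fun P => f P * g P := by
  have hfg : Meromorphic fun P => f P * g P := hf.mul hg
  rw [ofFun_of_meromorphic hf, ofFun_of_meromorphic hg, ofFun_of_meromorphic hfg, ← map_mul]
  rfl

lemma ofFun_add {f g : ℂ → ℂ} (hf : Meromorphic f) (hg : Meromorphic g) :
    ofFun f + ofFun g = ofFun fun P => f P + g P := by
  have hfg : Meromorphic fun P => f P + g P := hf.add hg
  rw [ofFun_of_meromorphic hf, ofFun_of_meromorphic hg, ofFun_of_meromorphic hfg, ← map_add]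
  rfl

lemma ofFun_neg {f : ℂ → ℂ} (hf : Meromorphic f) : -ofFun f = ofFun fun P => -f P := by
  have hf' : Meromorphic fun P => -f P := hf.neg
  rw [ofFun_of_meromorphic hf, ofFun_of_meromorphic hf', ← map_neg]
  rfl

lemma ofFun_congr {f g : ℂ → ℂ} (hf : Meromorphic f) (h : ∀ᶠ P in codiscrete ℂ, f P = g P) :
    ofFun f = ofFun g := by
  have hg : Meromorphic g := hf.congr_codiscrete h
  rw [ofFun_of_meromorphic hf, ofFun_of_meromorphic hg]
  refine Ideal.Quotient.eq.2 ?_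
  change (fun P => f P - g P) =ᶠ[codiscrete ℂ] 0
  filter_upwards [h] with P hP
  simp [hP]

lemma meromorphic_shift {f : ℂ → ℂ} (hf : Meromorphic f) (s : ℂ) :
    Meromorphic fun P => f (P + s) :=
  Meromorphic.meromorphic_fun_comp_add_const_iff_meromorphic.2 hf

lemma shift_ofFun {f : ℂ → ℂ} (hf : Meromorphic f) (s : ℂ) :
    shift s (ofFun f) = ofFun fun P => f (P + s) := by
  rw [ofFun_of_meromorphic hf, ofFun_of_meromorphic (meromorphic_shift hf s)]
  rfl

lemma ofFun_one : ofFun (fun _ => 1) = 1 := by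
  rw [ofFun_of_meromorphic (Meromorphic.const 1)]
  exact map_one toMF

lemma shift_shift (s t : ℂ) (x : MF) : shift s (shift t x) = shift (t + s) x := by
  obtain ⟨f, rfl⟩ := Ideal.Quotient.mkₐ_surjective ℂ nullIdeal x
  change toMF _ = toMF _
  congr 1
  apply Subtype.ext
  funext P
  change (f : ℂ → ℂ) (P + s + t) = (f : ℂ → ℂ) (P + (t + s))
  ring_nf

lemma shift_zero (x : MF) : shift 0 x = x := by
  obtain ⟨f, rfl⟩ := Ideal.Quotient.mkₐ_surjective ℂ nullIdeal x
  change toMF _ = toMF _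
  congr 1
  apply Subtype.ext
  funext P
  change (f : ℂ → ℂ) (P + 0) = (f : ℂ → ℂ) P
  rw [add_zero]

/-! ### Operators on `V̂` -/

section Operators

variable {l : ℕ}

lemma diagOp_apply (d : Fin (l + 1) → MF) (f : VHat l) (i : Fin (l + 1)) :
    diagOp d f i = d i * f i := rfl

lemma hP_apply (g : ℤ → ℂ → ℂ) (f : VHat l) (i : Fin (l + 1)) :
    hP l g f i = ofFun (g (wt i)) * f i := rfl

lemma expQ_apply (k : ℤ) (f : VHat l) (i : Fin (l + 1)) : expQ l k f i = shift k (f i) := rfl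

lemma Splus_apply (f : VHat l) (i : Fin (l + 1)) :
    Splus l f i = if h : (i : ℕ) + 1 < l + 1 then f ⟨i + 1, h⟩ else 0 := rfl

lemma Sminus_apply (f : VHat l) (i : Fin (l + 1)) :
    Sminus l f i = if 0 < (i : ℕ) then f ⟨i - 1, by omega⟩ else 0 := rfl

lemma isUnit_diagOp {d : Fin (l + 1) → MF} (hd : ∀ i, IsUnit (d i)) : IsUnit (diagOp d) := by
  choose e he using fun i => (hd i).exists_right_inv
  refine ⟨⟨diagOp d, diagOp e, ?_, ?_⟩, rfl⟩
  · refine LinearMap.ext fun f => funext fun i => ?_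
    simp [diagOp_apply, ← mul_assoc, he]
  · refine LinearMap.ext fun f => funext fun i => ?_
    rw [Module.End.mul_apply, diagOp_apply, diagOp_apply, ← mul_assoc, mul_comm (e i), he]
    simp

/-- An operator `c(h) e^{kQ}` with constants `c(h)`. -/
def constShift (l : ℕ) (c : ℤ → ℂ) (k : ℤ) : Module.End ℂ (VHat l) :=
  hP l (fun h _ => c h) * expQ l k

lemma constShift_apply (c : ℤ → ℂ) (k : ℤ) (f : VHat l) (i : Fin (l + 1)) :
    constShift l c k f i = ofFun (fun _ => c (wt i)) * shift k (f i) := rfl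

lemma hP_mul_expQ_mul_hP_const (c d : ℤ → ℂ) (k : ℤ) :
    hP l (fun h _ => c h) * expQ l k * hP l (fun h _ => d h) =
      constShift l (fun h => c h * d h) k := by
  refine LinearMap.ext fun f => funext fun i => ?_
  simp only [Module.End.mul_apply, hP_apply, expQ_apply, constShift_apply, map_mul,
    shift_ofFun (Meromorphic.const _), ← mul_assoc]
  rw [ofFun_mul (Meromorphic.const _) (Meromorphic.const _)]

lemma constShift_mul (c d : ℤ → ℂ) (k m : ℤ)
    (h : ∀ i : Fin (l + 1), c (wt i) * d (wt i) = 1) (hkm : m + k = 0) :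
    constShift l c k * constShift l d m = 1 := by
  refine LinearMap.ext fun f => funext fun i => ?_
  simp only [Module.End.mul_apply, constShift_apply, map_mul, shift_ofFun (Meromorphic.const _),
    ← mul_assoc, shift_shift]
  rw [ofFun_mul (Meromorphic.const _) (Meromorphic.const _), h, ofFun_one, ← Int.cast_add, hkm,
    Int.cast_zero, shift_zero, one_mul]
  rfl

lemma inverse_constShift (c : ℤ → ℂ) (k : ℤ) (hc : ∀ i : Fin (l + 1), c (wt i) ≠ 0) :
    Ring.inverse (constShift l c k) = constShift l (fun h => (c h)⁻¹) (-k) :=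
  Ring.inverse_unit ⟨constShift l c k, constShift l (fun h => (c h)⁻¹) (-k),
    constShift_mul _ _ _ _ (fun i => mul_inv_cancel₀ (hc i)) (by ring),
    constShift_mul _ _ _ _ (fun i => inv_mul_cancel₀ (hc i)) (by ring)⟩

variable {D : Fin (l + 1) → ℂ → ℂ} {k k' gd : ℤ → ℂ} {ec fc ga gb gc : ℤ → ℂ → ℂ}

lemma gauge_delta (hD : ∀ i, Meromorphic (D i))
    (h : ∀ i, ∀ᶠ P in codiscrete ℂ, D i P * k (wt i) = -gd (wt i) * D i (P - 1)) :
    diagOp (fun i => ofFun (D i)) * constShift l k (-1) =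
      -(hP l (fun h _ => gd h) * expQ l (-1)) * diagOp fun i => ofFun (D i) := by
  refine LinearMap.ext fun f => funext fun i => ?_
  simp only [Module.End.mul_apply, LinearMap.neg_apply, Pi.neg_apply, diagOp_apply, hP_apply,
    expQ_apply, constShift_apply, map_mul, shift_ofFun (hD _), ← mul_assoc]
  have hD' := meromorphic_shift (hD i)
  rw [ofFun_mul (hD i) (Meromorphic.const _), ofFun_mul (Meromorphic.const _) (hD' _), ← neg_mul,
    ofFun_neg ((Meromorphic.const _).fun_mul (hD' _))]
  congr 1
  refine ofFun_congr ((hD i).fun_mul (Meromorphic.const _)) ?_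
  filter_upwards [h i] with P hP
  rw [hP]
  push_cast
  ring_nf

lemma gauge_beta (hD : ∀ i, Meromorphic (D i))
    (hfc : ∀ i j : Fin (l + 1), (i : ℕ) = j + 1 → Meromorphic (fc (wt j)))
    (hgb : ∀ i j : Fin (l + 1), (i : ℕ) = j + 1 → Meromorphic (gb (wt j)))
    (h : ∀ i j : Fin (l + 1), (i : ℕ) = j + 1 → ∀ᶠ P in codiscrete ℂ,
      D i P * (fc (wt j) P * k (wt j)) = -gb (wt j) P * D j (P - 1)) :
    diagOp (fun i => ofFun (D i)) * (Sminus l * hP l fc * constShift l k (-1)) =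
      -(Sminus l * hP l gb * expQ l (-1)) * diagOp fun i => ofFun (D i) := by
  refine LinearMap.ext fun f => funext fun i => ?_
  simp only [Module.End.mul_apply, LinearMap.neg_apply, Pi.neg_apply, diagOp_apply,
    Sminus_apply]
  split_ifs with hi
  swap
  · simp
  have hij : (i : ℕ) = (⟨i - 1, by omega⟩ : Fin (l + 1)) + 1 := (Nat.sub_add_cancel hi).symm
  set j : Fin (l + 1) := ⟨i - 1, by omega⟩
  simp only [hP_apply, diagOp_apply, expQ_apply, constShift_apply, map_mul, shift_ofFun (hD _),
    ← mul_assoc]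
  have hD' := meromorphic_shift (hD j)
  have m1 := hfc i j hij
  have m2 := hgb i j hij
  rw [ofFun_mul (hD i) m1, ofFun_mul ((hD i).fun_mul m1) (Meromorphic.const _), ofFun_mul m2 (hD' _),
    ← neg_mul, ofFun_neg (m2.fun_mul (hD' _))]
  congr 1
  refine ofFun_congr (((hD i).fun_mul m1).fun_mul (Meromorphic.const _)) ?_
  filter_upwards [h i j hij] with P hP
  rw [mul_assoc, hP]
  push_cast
  ring_nf

lemma gauge_gamma (hD : ∀ i, Meromorphic (D i))
    (hec : ∀ i j : Fin (l + 1), (j : ℕ) = i + 1 → Meromorphic (ec (wt j)))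
    (hgc : ∀ i j : Fin (l + 1), (j : ℕ) = i + 1 → Meromorphic (gc (wt j)))
    (h : ∀ i j : Fin (l + 1), (j : ℕ) = i + 1 → ∀ᶠ P in codiscrete ℂ,
      D i P * (k (wt i) * ec (wt j) (P + 1)) = gc (wt j) P * D j (P + 1)) :
    diagOp (fun i => ofFun (D i)) * (constShift l k (-1) * (Splus l * expQ l 2 * hP l ec)) =
      (Splus l * hP l gc * expQ l 1) * diagOp fun i => ofFun (D i) := by
  refine LinearMap.ext fun f => funext fun i => ?_
  simp only [Module.End.mul_apply, diagOp_apply, constShift_apply, Splus_apply]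
  split_ifs with hi
  swap
  · simp
  have hij : ((⟨i + 1, hi⟩ : Fin (l + 1)) : ℕ) = i + 1 := rfl
  set j : Fin (l + 1) := ⟨i + 1, hi⟩
  have m1 := hec i j hij
  have m2 := hgc i j hij
  have m1' := meromorphic_shift m1
  have m1'' := fun s => meromorphic_shift (m1' s)
  simp only [hP_apply, diagOp_apply, expQ_apply, map_mul, shift_ofFun (hD _), shift_shift,
    shift_ofFun m1, shift_ofFun (m1' _), ← mul_assoc]
  have hD' := meromorphic_shift (hD j)
  rw [ofFun_mul (hD i) (Meromorphic.const _),
    ofFun_mul ((hD i).fun_mul (Meromorphic.const _)) (m1'' _ _), ofFun_mul m2 (hD' _)]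
  congr 1
  · refine ofFun_congr (((hD i).fun_mul (Meromorphic.const _)).fun_mul (m1'' _ _)) ?_
    filter_upwards [h i j hij] with P hP
    push_cast
    rw [mul_assoc, show P + -1 + 2 = P + 1 by ring, hP]
  · congr 2
    push_cast
    ring

lemma gauge_alpha (hD : ∀ i, Meromorphic (D i))
    (hec : ∀ i j : Fin (l + 1), (j : ℕ) = i + 1 → Meromorphic (ec (wt j)))
    (hfc : ∀ i j : Fin (l + 1), (i : ℕ) = j + 1 → Meromorphic (fc (wt j)))
    (hga : ∀ i : Fin (l + 1), Meromorphic (ga (wt i)))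
    (h0 : ∀ᶠ P in codiscrete ℂ, D 0 P * k' (wt (0 : Fin (l + 1))) =
      -ga (wt (0 : Fin (l + 1))) P * D 0 (P + 1))
    (h : ∀ i j : Fin (l + 1), (i : ℕ) = j + 1 → ∀ᶠ P in codiscrete ℂ,
      D i P * (k' (wt i) + fc (wt j) P * k (wt j) * ec (wt i) (P + 1)) =
        -ga (wt i) P * D i (P + 1)) :
    diagOp (fun i => ofFun (D i)) * (constShift l k' 1 +
        Sminus l * hP l fc * constShift l k (-1) * (Splus l * expQ l 2 * hP l ec)) =
      -(hP l ga * expQ l 1) * diagOp fun i => ofFun (D i) := by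
  refine LinearMap.ext fun f => funext fun i => ?_
  have m0 := hga i
  have hD' := meromorphic_shift (hD i)
  simp only [Module.End.mul_apply, LinearMap.neg_apply, LinearMap.add_apply, Pi.add_apply,
    Pi.neg_apply, diagOp_apply, Sminus_apply]
  split_ifs with hi
  swap
  · obtain rfl : i = 0 := Fin.ext (by simpa using hi)
    simp only [hP_apply, diagOp_apply, expQ_apply, constShift_apply, map_mul, shift_ofFun (hD _),
      ← mul_assoc, add_zero]
    rw [ofFun_mul (hD _) (Meromorphic.const _), ofFun_mul m0 (hD' _), ← neg_mul,
      ofFun_neg (m0.fun_mul (hD' _))]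
    congr 1
    refine ofFun_congr ((hD 0).fun_mul (Meromorphic.const _)) ?_
    filter_upwards [h0] with P hP
    rw [hP]
    push_cast
    ring_nf
  have hij : (i : ℕ) = (⟨i - 1, by omega⟩ : Fin (l + 1)) + 1 := (Nat.sub_add_cancel hi).symm
  set j : Fin (l + 1) := ⟨i - 1, by omega⟩
  have hj1 : (j : ℕ) + 1 < l + 1 := by rw [← hij]; exact i.2
  have hji : (⟨j + 1, hj1⟩ : Fin (l + 1)) = i := Fin.ext hij.symm
  have m1 := hec j i hij
  have m2 := hfc i j hij
  have m1' := meromorphic_shift m1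
  have m1'' := fun s => meromorphic_shift (m1' s)
  simp only [hP_apply, diagOp_apply, expQ_apply, constShift_apply,
    Splus_apply, dif_pos hj1, hji, map_mul, shift_ofFun (hD _), shift_shift, shift_ofFun m1,
    shift_ofFun (m1' _),
    ← mul_assoc]
  rw [ofFun_mul m2 (Meromorphic.const _), ofFun_mul (m2.fun_mul (Meromorphic.const _)) (m1'' _ _),
    ofFun_mul m0 (hD' _), show ((2 : ℤ) : ℂ) + ((-1 : ℤ) : ℂ) = ((1 : ℤ) : ℂ) by norm_num,
    ← add_mul, ofFun_add (Meromorphic.const _) ((m2.fun_mul (Meromorphic.const _)).fun_mul (m1'' _ _)),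
    ← mul_assoc, ofFun_mul (hD i) ((Meromorphic.const _).fun_add
      ((m2.fun_mul (Meromorphic.const _)).fun_mul (m1'' _ _))), ← neg_mul, ofFun_neg (m0.fun_mul (hD' _))]
  congr 1
  refine ofFun_congr ((hD i).fun_mul ((Meromorphic.const _).fun_add
      ((m2.fun_mul (Meromorphic.const _)).fun_mul (m1'' _ _)))) ?_
  filter_upwards [h i j hij] with P hP
  push_cast
  rw [show P + -1 + 2 = P + 1 by ring, hP]
  ring

end Operators

/-! ### The exponentials of the bosons as infinite products -/

section Bosons

variable {q r : ℂ}

lemma powSum_pow {p : ℂ} (hp : ‖p‖ < 1) (k : ℕ) :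
    powSum (fun n : ℕ => p ^ n) k = (1 - p ^ (k + 1))⁻¹ := by
  have h : ‖p ^ (k + 1)‖ < 1 := by
    rw [norm_pow]; exact pow_lt_one₀ (norm_nonneg _) hp (Nat.succ_ne_zero k)
  rw [powSum, ← tsum_geometric_of_norm_lt_one h]
  exact tsum_congr fun n => by rw [← pow_mul, ← pow_mul, mul_comm]

lemma powSum_dcoef {p : ℂ} (hp : ‖p‖ < 1) (hq : ‖q‖ < 1) (k : ℕ) :
    powSum (dcoef q p) k = (1 - p ^ (k + 1))⁻¹ * (1 - q ^ (4 * (k + 1)))⁻¹ := by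
  have h : ‖p ^ (k + 1)‖ < 1 := by
    rw [norm_pow]; exact pow_lt_one₀ (norm_nonneg _) hp (Nat.succ_ne_zero k)
  have h' : ‖q ^ (4 * (k + 1))‖ < 1 := by
    rw [norm_pow]; exact pow_lt_one₀ (norm_nonneg _) hq (by omega)
  have s1 : Summable fun n : ℕ => ‖(p ^ (k + 1)) ^ n‖ := summable_poch h
  have s2 : Summable fun n : ℕ => ‖(q ^ (4 * (k + 1))) ^ n‖ := summable_poch h'
  rw [powSum, ← tsum_geometric_of_norm_lt_one h, ← tsum_geometric_of_norm_lt_one h',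
    tsum_mul_tsum_of_summable_norm s1 s2]
  refine tsum_congr fun n => ?_
  rw [dcoef]
  ring

lemma hasSum_log_poch {p : ℂ} (hp : ‖p‖ < 1) {x : ℂ} (hx : ‖x‖ < 1) :
    ∃ L : ℂ, HasSum (fun k : ℕ => x ^ (k + 1) / (k + 1) * (1 - p ^ (k + 1))⁻¹) L ∧
      Complex.exp (-L) = poch x p := by
  obtain ⟨L, h1, h2⟩ := hasSum_log_prodOne (summable_poch hp)
    (fun n => by rw [norm_pow]; exact pow_le_one₀ (norm_nonneg _) hp.le) hx
  exact ⟨L, by simpa only [powSum_pow hp] using h1, h2⟩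

lemma hasSum_log_dpoch {p : ℂ} (hp : ‖p‖ < 1) (hq : ‖q‖ < 1) {x : ℂ} (hx : ‖x‖ < 1) :
    ∃ L : ℂ, HasSum (fun k : ℕ => x ^ (k + 1) / (k + 1) *
        ((1 - p ^ (k + 1))⁻¹ * (1 - q ^ (4 * (k + 1)))⁻¹)) L ∧
      Complex.exp (-L) = dpoch q p x := by
  obtain ⟨L, h1, h2⟩ := hasSum_log_prodOne (summable_dcoef hp hq) (fun n => by
    rw [dcoef, norm_mul, norm_pow, norm_pow, norm_pow]
    exact mul_le_one₀ (pow_le_one₀ (norm_nonneg _) hp.le) (by positivity)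
      (pow_le_one₀ (by positivity) (pow_le_one₀ (norm_nonneg _) hq.le))) hx
  exact ⟨L, by simpa only [powSum_dcoef hp hq] using h1, by rw [h2, dpoch_eq]⟩

lemma one_sub_pow_ne_zero {x : ℂ} (hx : ‖x‖ < 1) {n : ℕ} (hn : n ≠ 0) : 1 - x ^ n ≠ 0 := by
  intro h
  have : ‖x ^ n‖ < 1 := by rw [norm_pow]; exact pow_lt_one₀ (norm_nonneg _) hx hn
  rw [← sub_eq_zero.1 h] at this
  simp at this

lemma sub_inv_ne_zero (hq0 : q ≠ 0) (hq1 : ‖q‖ < 1) : q - q⁻¹ ≠ 0 := by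
  intro h
  apply one_sub_pow_ne_zero hq1 two_ne_zero
  field_simp at h
  linear_combination -h

lemma cpow_two_mul_eq_sq (hq0 : q ≠ 0) (x : ℂ) : q ^ (2 * x) = (q ^ x) ^ 2 := by
  rw [two_mul, Complex.cpow_add _ _ hq0, sq]

lemma cpow_mul_succ (x : ℂ) (k : ℕ) : q ^ (x * (k + 1)) = (q ^ x) ^ (k + 1) := by
  rw [← Complex.cpow_mul_nat]; push_cast; rfl

/-- `1 / ([rn]_q (q - q⁻¹)) = -q^{rn} / (1 - pⁿ)`. -/
lemma inv_qnum_mul (hq0 : q ≠ 0) (hq1 : ‖q‖ < 1) (hp : ‖q ^ (2 * r)‖ < 1) (k : ℕ) :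
    1 / qnum q (r * (k + 1)) * (1 / (q - q⁻¹)) =
      -(q ^ r) ^ (k + 1) * (1 - (q ^ (2 * r)) ^ (k + 1))⁻¹ := by
  have h1 := sub_inv_ne_zero hq0 hq1
  have h2 := one_sub_pow_ne_zero hp (Nat.succ_ne_zero k)
  have h3 : (q ^ r) ^ (k + 1) ≠ 0 := pow_ne_zero _ (cpow_ne_zero hq0 _)
  rw [cpow_two_mul_eq_sq hq0, ← pow_mul, mul_comm 2, pow_mul] at h2 ⊢
  rw [qnum, Complex.cpow_neg, cpow_mul_succ]
  set A := (q ^ r) ^ (k + 1)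
  have h4 : A - A⁻¹ ≠ 0 := by
    intro h
    apply h2
    field_simp at h
    linear_combination -h
  have h5 : A ^ 2 - 1 ≠ 0 := fun h => h2 (by linear_combination -h)
  generalize q - q⁻¹ = d at h1 ⊢
  field_simp
  ring

/-- The eigenvalue of `a_n`, `n = k + 1`. -/
lemma aEv_succ (q v : ℂ) (l k : ℕ) (h : ℤ) : aEv q v l (k + 1) h =
    (q ^ (2 * v)) ^ (k + 1) / (k + 1) * (1 / (q - q⁻¹)) *
      ((q ^ (k + 1) + (q ^ (k + 1))⁻¹) * (q ^ h) ^ (k + 1) -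
        ((q ^ ((l : ℤ) + 1)) ^ (k + 1) + (q ^ (-((l : ℤ) + 1))) ^ (k + 1))) := by
  have e : ((k : ℤ) + 1) = ((k + 1 : ℕ) : ℤ) := by push_cast; ring
  simp only [aEv, e, zpow_neg, ← zpow_natCast, ← zpow_mul]
  push_cast
  congr 1
  congr 3
  · rw [mul_comm]
  · rw [← zpow_neg, ← zpow_neg, ← zpow_mul]; ring_nf

lemma aEv_neg (q v : ℂ) (l : ℕ) (n h : ℤ) : aEv q v l (-n) h = -aEv q (-v) l n (-h) := by
  simp only [aEv, neg_neg, mul_neg, neg_mul, Complex.cpow_neg, inv_zpow, zpow_neg]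
  push_cast
  ring

lemma uPlus_eq_uMinus (q r v : ℂ) (l : ℕ) (h : ℤ) :
    uPlus q r v l h = uMinus q r (-v) l (-h) := by
  unfold uPlus uMinus
  congr 1
  ext z
  rw [← tsum_neg]
  congr 1
  refine tsum_congr fun k => ?_
  rw [aEv_neg]
  ring

lemma kPos_eq_kNeg (q r v : ℂ) (l : ℕ) (h : ℤ) :
    kPos q r v l h = kNeg q r (-v) l (-h) := by
  unfold kPos kNeg
  congr 1
  ext z
  rw [← tsum_neg]
  congr 1
  refine tsum_congr fun k => ?_
  rw [aEv_neg]
  ring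

lemma eventually_norm_mul_lt (c : ℂ) : ∀ᶠ y in 𝓝 (0 : ℂ), ‖c * y‖ < 1 := by
  have : ContinuousAt (fun y : ℂ => ‖c * y‖) 0 := by fun_prop
  exact this.eventually_lt continuousAt_const (by simp)

lemma meromorphic_of_differentiable {f : ℂ → ℂ} (hf : Differentiable ℂ f) : Meromorphic f :=
  fun x => (hf.analyticAt x).meromorphicAt

lemma uMinus_eq (hq0 : q ≠ 0) (hq1 : ‖q‖ < 1) (hp : ‖q ^ (2 * r)‖ < 1) (v : ℂ) (l : ℕ) (h : ℤ)
    {y p Y : ℂ} (hpd : q ^ (2 * r) = p) (hY : p * q ^ (2 * v) * y = Y)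
    (h1 : poch (q ^ (h + 1) * Y) p ≠ 0) (h2 : poch (q ^ (h - 1) * Y) p ≠ 0) :
    uMinus q r v l h y = poch (q ^ ((l : ℤ) + 1) * Y) p * poch (q ^ (-((l : ℤ) + 1)) * Y) p /
      (poch (q ^ (h + 1) * Y) p * poch (q ^ (h - 1) * Y) p) := by
  rw [hpd] at hp
  set c := p * q ^ (2 * v) with hc
  subst hY
  have hd : ∀ s, Differentiable ℂ fun y => poch (s * (c * y)) p := fun s =>
    (differentiable_poch hp).comp (g := fun z => poch z p) (by fun_prop)
  have hdn := (hd (q ^ ((l : ℤ) + 1))).mul (hd (q ^ (-((l : ℤ) + 1))))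
  have hdd := (hd (q ^ (h + 1))).mul (hd (q ^ (h - 1)))
  have han : ∀ y, poch (q ^ (h + 1) * (c * y)) p ≠ 0 → poch (q ^ (h - 1) * (c * y)) p ≠ 0 →
      AnalyticAt ℂ (fun y => poch (q ^ ((l : ℤ) + 1) * (c * y)) p *
        poch (q ^ (-((l : ℤ) + 1)) * (c * y)) p /
      (poch (q ^ (h + 1) * (c * y)) p * poch (q ^ (h - 1) * (c * y)) p)) y := fun y h1 h2 =>
    (hdn.analyticAt y).div (hdd.analyticAt y) (mul_ne_zero h1 h2)
  refine meroExt_eq le_rfl (g := fun y => poch (q ^ ((l : ℤ) + 1) * (c * y)) p *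
      poch (q ^ (-((l : ℤ) + 1)) * (c * y)) p /
      (poch (q ^ (h + 1) * (c * y)) p * poch (q ^ (h - 1) * (c * y)) p))
    ((meromorphic_of_differentiable hdn).div (meromorphic_of_differentiable hdd)) ?_ (han y h1 h2)
  filter_upwards [eventually_norm_mul_lt (q ^ ((l : ℤ) + 1) * c),
    eventually_norm_mul_lt (q ^ (-((l : ℤ) + 1)) * c), eventually_norm_mul_lt (q ^ (h + 1) * c),
    eventually_norm_mul_lt (q ^ (h - 1) * c)] with y n1 n2 n3 n4
  rw [mul_assoc] at n1 n2 n3 n4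
  refine ⟨han y (poch_ne_zero_of_norm_lt hp n3) (poch_ne_zero_of_norm_lt hp n4), ?_⟩
  obtain ⟨L1, s1, e1⟩ := hasSum_log_poch hp n1
  obtain ⟨L2, s2, e2⟩ := hasSum_log_poch hp n2
  obtain ⟨L3, s3, e3⟩ := hasSum_log_poch hp n3
  obtain ⟨L4, s4, e4⟩ := hasSum_log_poch hp n4
  have key := (s1.add s2).sub (s3.add s4)
  rw [← e1, ← e2, ← e3, ← e4, ← Complex.exp_add, ← Complex.exp_add, ← Complex.exp_sub,
    show -L1 + -L2 - (-L3 + -L4) = -(L1 + L2 - (L3 + L4)) by ring, ← key.tsum_eq]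
  congr 2
  refine tsum_congr fun k => ?_
  rw [aEv_succ]
  have hk := inv_qnum_mul hq0 hq1 (hpd ▸ hp) k
  rw [hpd] at hk
  rw [show ∀ a b c d e : ℂ, a * (b * c * d) * e = (a * c) * (b * d * e) from
    fun a b c d e => by ring]
  rw [hk]
  have eh1 : q ^ (h + 1) = q ^ h * q := by rw [zpow_add₀ hq0, zpow_one]
  have eh2 : q ^ (h - 1) = q ^ h * q⁻¹ := by rw [zpow_sub₀ hq0, zpow_one, div_eq_mul_inv]
  have e5 : p ^ (k + 1) = (q ^ r) ^ (k + 1) * (q ^ r) ^ (k + 1) := by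
    rw [← hpd, cpow_two_mul_eq_sq hq0, sq, mul_pow]
  rw [eh1, eh2, hc]
  generalize q ^ ((l : ℤ) + 1) = B
  generalize q ^ (-((l : ℤ) + 1)) = B'
  generalize q ^ h = H
  simp only [mul_pow, inv_pow]
  rw [e5]
  generalize (1 - (q ^ r) ^ (k + 1) * (q ^ r) ^ (k + 1))⁻¹ = T
  ring

/-- `[n]_q / ([2n]_q [rn]_q (q - q⁻¹))` in terms of `qⁿ` and `pⁿ`. -/
lemma qnum_ratio (hq0 : q ≠ 0) (hq1 : ‖q‖ < 1) (hp : ‖q ^ (2 * r)‖ < 1) (k : ℕ) :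
    qnum q (k + 1) / (qnum q (2 * (k + 1)) * qnum q (r * (k + 1))) * (1 / (q - q⁻¹)) =
      -(q ^ r) ^ (k + 1) * (1 - (q ^ (2 * r)) ^ (k + 1))⁻¹ *
        ((q ^ (k + 1) - (q ^ (k + 1)) ^ 3) * (1 - q ^ (4 * (k + 1)))⁻¹) := by
  rw [← inv_qnum_mul hq0 hq1 hp k]
  have e1 : q ^ ((k : ℂ) + 1) = q ^ (k + 1) := by
    rw [← Complex.cpow_natCast]; push_cast; rfl
  have h1 := sub_inv_ne_zero hq0 hq1
  have h4 := one_sub_pow_ne_zero hq1 (n := 4 * (k + 1)) (by omega)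
  have h2 := one_sub_pow_ne_zero hq1 (n := 2 * (k + 1)) (by omega)
  have hA : q ^ (k + 1) ≠ 0 := pow_ne_zero _ hq0
  have e : qnum q (k + 1) / qnum q (2 * (k + 1)) =
      (q ^ (k + 1) - (q ^ (k + 1)) ^ 3) * (1 - q ^ (4 * (k + 1)))⁻¹ := by
    rw [qnum, qnum, Complex.cpow_neg, Complex.cpow_neg, cpow_two_mul_eq_sq hq0, e1]
    rw [mul_comm, pow_mul] at h2 h4
    rw [mul_comm 4, pow_mul]
    generalize q ^ (k + 1) = A at hA h2 h4 ⊢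
    generalize q - q⁻¹ = d at h1 ⊢
    have h5 : A ^ 4 - 1 ≠ 0 := fun h => h4 (by linear_combination -h)
    have h6 : (A ^ 2) ^ 2 - 1 ≠ 0 := fun h => h4 (by linear_combination -h)
    have h7 : A ^ 2 - 1 ≠ 0 := fun h => h2 (by linear_combination -h)
    field_simp
    ring
  rw [← e]
  ring

lemma kNeg_eq (hq0 : q ≠ 0) (hq1 : ‖q‖ < 1) (hp : ‖q ^ (2 * r)‖ < 1) (v : ℂ) (l : ℕ) (h : ℤ)
    {y p Y : ℂ} (hpd : q ^ (2 * r) = p) (hY : q ^ r * q ^ (2 * v) * y = Y)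
    (h1 : poch (q ^ h * Y) p ≠ 0) (h2 : dpoch q p (q ^ ((l : ℤ) + 4) * Y) ≠ 0)
    (h3 : dpoch q p (q ^ (-(l : ℤ) + 2) * Y) ≠ 0) :
    kNeg q r v l h y = dpoch q p (q ^ ((l : ℤ) + 2) * Y) * dpoch q p (q ^ (-(l : ℤ)) * Y) /
      (dpoch q p (q ^ ((l : ℤ) + 4) * Y) * dpoch q p (q ^ (-(l : ℤ) + 2) * Y) *
        poch (q ^ h * Y) p) := by
  rw [hpd] at hp
  set c := q ^ r * q ^ (2 * v) with hc
  subst hY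
  have hd : ∀ s, Differentiable ℂ fun y => dpoch q p (s * (c * y)) := fun s =>
    (differentiable_dpoch hp hq1).comp (by fun_prop)
  have hd' : ∀ s, Differentiable ℂ fun y => poch (s * (c * y)) p := fun s =>
    (differentiable_poch hp).comp (g := fun z => poch z p) (by fun_prop)
  have hdn := (hd (q ^ ((l : ℤ) + 2))).mul (hd (q ^ (-(l : ℤ))))
  have hdd := ((hd (q ^ ((l : ℤ) + 4))).mul (hd (q ^ (-(l : ℤ) + 2)))).mul (hd' (q ^ h))
  have han : ∀ y, poch (q ^ h * (c * y)) p ≠ 0 → dpoch q p (q ^ ((l : ℤ) + 4) * (c * y)) ≠ 0 →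
      dpoch q p (q ^ (-(l : ℤ) + 2) * (c * y)) ≠ 0 →
      AnalyticAt ℂ (fun y => dpoch q p (q ^ ((l : ℤ) + 2) * (c * y)) *
          dpoch q p (q ^ (-(l : ℤ)) * (c * y)) /
        (dpoch q p (q ^ ((l : ℤ) + 4) * (c * y)) * dpoch q p (q ^ (-(l : ℤ) + 2) * (c * y)) *
          poch (q ^ h * (c * y)) p)) y := fun y h1 h2 h3 =>
    (hdn.analyticAt y).div (hdd.analyticAt y) (mul_ne_zero (mul_ne_zero h2 h3) h1)
  refine meroExt_eq le_rfl (g := fun y => dpoch q p (q ^ ((l : ℤ) + 2) * (c * y)) *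
          dpoch q p (q ^ (-(l : ℤ)) * (c * y)) /
        (dpoch q p (q ^ ((l : ℤ) + 4) * (c * y)) * dpoch q p (q ^ (-(l : ℤ) + 2) * (c * y)) *
          poch (q ^ h * (c * y)) p))
    ((meromorphic_of_differentiable hdn).div (meromorphic_of_differentiable hdd)) ?_
    (han y h1 h2 h3)
  filter_upwards [eventually_norm_mul_lt (q ^ ((l : ℤ) + 2) * c),
    eventually_norm_mul_lt (q ^ (-(l : ℤ)) * c), eventually_norm_mul_lt (q ^ ((l : ℤ) + 4) * c),
    eventually_norm_mul_lt (q ^ (-(l : ℤ) + 2) * c), eventually_norm_mul_lt (q ^ h * c)]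
    with y n1 n2 n3 n4 n5
  rw [mul_assoc] at n1 n2 n3 n4 n5
  obtain ⟨L1, s1, e1⟩ := hasSum_log_dpoch hp hq1 n1
  obtain ⟨L2, s2, e2⟩ := hasSum_log_dpoch hp hq1 n2
  obtain ⟨L3, s3, e3⟩ := hasSum_log_dpoch hp hq1 n3
  obtain ⟨L4, s4, e4⟩ := hasSum_log_dpoch hp hq1 n4
  obtain ⟨L5, s5, e5⟩ := hasSum_log_poch hp n5
  have key := (s1.add s2).sub ((s3.add s4).add s5)
  refine ⟨han y (e5 ▸ Complex.exp_ne_zero _) (e3 ▸ Complex.exp_ne_zero _)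
    (e4 ▸ Complex.exp_ne_zero _), ?_⟩
  rw [← e1, ← e2, ← e3, ← e4, ← e5, ← Complex.exp_add, ← Complex.exp_add, ← Complex.exp_add,
    ← Complex.exp_sub,
    show -L1 + -L2 - (-L3 + -L4 + -L5) = -(L1 + L2 - (L3 + L4 + L5)) by ring, ← key.tsum_eq]
  congr 2
  refine tsum_congr fun k => ?_
  rw [aEv_succ]
  have hk := qnum_ratio hq0 hq1 (hpd ▸ hp) k
  rw [hpd] at hk
  rw [show ∀ a b c d e : ℂ, a * (b * c * d) * e = (a * c) * (b * d * e) from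
    fun a b c d e => by ring]
  rw [hk]
  have eh1 : q ^ ((l : ℤ) + 2) = q ^ (l : ℤ) * q ^ 2 := by rw [zpow_add₀ hq0]; rfl
  have eh2 : q ^ ((l : ℤ) + 4) = q ^ (l : ℤ) * q ^ 4 := by rw [zpow_add₀ hq0]; rfl
  have eh3 : q ^ (-(l : ℤ) + 2) = q ^ (-(l : ℤ)) * q ^ 2 := by rw [zpow_add₀ hq0]; rfl
  have eh4 : q ^ ((l : ℤ) + 1) = q ^ (l : ℤ) * q := by rw [zpow_add₀ hq0, zpow_one]
  have eh5 : q ^ (-((l : ℤ) + 1)) = q ^ (-(l : ℤ)) * q⁻¹ := by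
    rw [neg_add, zpow_add₀ hq0, zpow_neg_one]
  have e6 : q ^ (4 * (k + 1)) = (q ^ (k + 1)) ^ 4 := by rw [← pow_mul, mul_comm]
  rw [eh1, eh2, eh3, eh4, eh5, hc, e6]
  have hA : q ^ (k + 1) ≠ 0 := pow_ne_zero _ hq0
  have h4 : 1 - (q ^ (k + 1)) ^ 4 ≠ 0 := by
    rw [← e6]; exact one_sub_pow_ne_zero hq1 (by omega)
  generalize q ^ (l : ℤ) = B
  generalize q ^ (-(l : ℤ)) = B'
  generalize q ^ h = H
  simp only [mul_pow, inv_pow, ← pow_mul]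
  simp only [mul_comm _ (k + 1), pow_mul]
  generalize (1 - p ^ (k + 1))⁻¹ = T
  generalize q ^ (k + 1) = A at hA h4 ⊢
  have hk1 : (k : ℂ) + 1 ≠ 0 := by exact_mod_cast Nat.succ_ne_zero k
  generalize (k : ℂ) + 1 = N at hk1 ⊢
  have h5 : 1 - A ^ 4 ≠ 0 := h4
  field_simp
  ring

end Bosons

/-! ### The half currents -/

section HalfCurrents

variable {q r : ℂ}

/-- The kernel of the half currents, as a single-valued function of `z' = q^{2u'}`. -/
lemma kernel_eq (hq0 : q ≠ 0) (hp : ‖q ^ (2 * r)‖ < 1) (u u' M : ℂ) :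
    zpw q u' (M / r) * (theta q r (u - u' + M) / theta q r (u - u')) =
      q ^ ((2 * u * M + M ^ 2) / r - M) *
        (Theta (q ^ (2 * r)) (q ^ (2 * (u + M)) / q ^ (2 * u')) /
          Theta (q ^ (2 * r)) (q ^ (2 * u) / q ^ (2 * u'))) := by
  have hr := r_ne_zero_of_norm_lt hp
  have hpp := poch_ne_zero_of_norm_lt hp hp
  have e1 : q ^ (2 * (u - u' + M)) = q ^ (2 * (u + M)) / q ^ (2 * u') := by
    rw [← Complex.cpow_sub _ _ hq0]; ring_nf
  have e2 : q ^ (2 * (u - u')) = q ^ (2 * u) / q ^ (2 * u') := by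
    rw [← Complex.cpow_sub _ _ hq0]; ring_nf
  have e3 : zpw q u' (M / r) * q ^ ((u - u' + M) ^ 2 / r - (u - u' + M)) =
      q ^ ((2 * u * M + M ^ 2) / r - M) * q ^ ((u - u') ^ 2 / r - (u - u')) := by
    rw [zpw, ← Complex.cpow_add _ _ hq0, ← Complex.cpow_add _ _ hq0]
    congr 1
    field_simp
    ring
  have hne : q ^ ((u - u') ^ 2 / r - (u - u')) ≠ 0 := cpow_ne_zero hq0 _
  simp only [theta]
  rw [e1, e2]
  set T1 := Theta (q ^ (2 * r)) (q ^ (2 * (u + M)) / q ^ (2 * u'))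
  set T2 := Theta (q ^ (2 * r)) (q ^ (2 * u) / q ^ (2 * u'))
  generalize poch (q ^ (2 * r)) (q ^ (2 * r)) = c at hpp
  generalize q ^ ((u - u') ^ 2 / r - (u - u')) = α at e3 hne ⊢
  generalize q ^ ((u - u' + M) ^ 2 / r - (u - u' + M)) = β at e3 ⊢
  generalize q ^ ((2 * u * M + M ^ 2) / r - M) = γ at e3 ⊢
  by_cases hT : T2 = 0
  · simp [hT]
  · field_simp
    linear_combination T1 * e3

lemma Theta_ne_zero_of_annulus {p : ℂ} (hp : ‖p‖ < 1) (hp0 : p ≠ 0) {z z' : ℂ}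
    (h1 : ‖p * z‖ < ‖z'‖) (h2 : ‖z'‖ < ‖z‖) : Theta p (z / z') ≠ 0 := by
  have hz' : 0 < ‖z'‖ := (norm_nonneg _).trans_lt h1
  have hz : 0 < ‖z‖ := hz'.trans h2
  have hpn : 0 < ‖p‖ := norm_pos_iff.2 hp0
  rw [norm_mul] at h1
  refine Theta_ne_zero hp hp0 (div_ne_zero (norm_pos_iff.1 hz) (norm_pos_iff.1 hz')) fun k hk => ?_
  have hn : ‖z‖ / ‖z'‖ = ‖p‖ ^ k := by rw [← norm_div, hk, norm_zpow]
  rcases lt_or_ge k 0 with h | h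
  · have : ‖p‖ ^ (-1 : ℤ) ≤ ‖p‖ ^ k := zpow_le_zpow_right_of_le_one₀ hpn hp.le (by omega)
    rw [← hn, zpow_neg_one, le_div_iff₀ hz', inv_mul_le_iff₀ hpn] at this
    linarith
  · have : ‖p‖ ^ k ≤ ‖p‖ ^ (0 : ℤ) := zpow_le_zpow_right_of_le_one₀ hpn hp.le h
    rw [← hn, zpow_zero, div_le_one hz'] at this
    linarith

lemma theta_ne_zero_of_mem_strip (hq0 : q ≠ 0) (hp : ‖q ^ (2 * r)‖ < 1) {u u₀ : ℂ}
    (hu : u ∈ strip q r (q ^ (2 * u₀))) : theta q r (u - u₀) ≠ 0 := by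
  have e : q ^ (2 * (u - u₀)) = q ^ (2 * u) / q ^ (2 * u₀) := by
    rw [← Complex.cpow_sub _ _ hq0]; ring_nf
  rw [theta, e]
  exact mul_ne_zero (div_ne_zero (cpow_ne_zero hq0 _)
    (pow_ne_zero _ (poch_ne_zero_of_norm_lt hp hp)))
    (Theta_ne_zero_of_annulus hp (cpow_ne_zero hq0 _) hu.1 hu.2)

lemma norm_cpow_r_lt_one (hq0 : q ≠ 0) (hp : ‖q ^ (2 * r)‖ < 1) : ‖q ^ r‖ < 1 := by
  rw [cpow_two_mul_eq_sq hq0, norm_pow] at hp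
  exact (pow_lt_one_iff_of_nonneg (norm_nonneg _) two_ne_zero).1 hp

/-- The mode sums defining the half currents converge to the value of the kernel at the support of
the delta function. -/
lemma hasSum_contour (hq0 : q ≠ 0) (hq1 : ‖q‖ < 1) (hp : ‖q ^ (2 * r)‖ < 1) (M A B : ℂ) {u u₀ : ℂ}
    (hu : u ∈ strip q r (q ^ (2 * u₀))) :
    HasSum (fun n : ℤ => (q ^ (2 * u₀)) ^ n * contour q r u fun u' =>
        (q ^ (2 * u')) ^ (-n) * zpw q u' (M / r) *
          (theta q r (u - u' + M) * A / (theta q r (u - u') * B)))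
      (zpw q u₀ (M / r) * (theta q r (u - u₀ + M) * A / (theta q r (u - u₀) * B))) := by
  set p := q ^ (2 * r) with hpd
  set z := q ^ (2 * u) with hz
  set C := q ^ ((2 * u * M + M ^ 2) / r - M) with hC
  let G : ℂ → ℂ := fun z' => C * (Theta p (q ^ (2 * (u + M)) / z') / Theta p (z / z')) * (A / B)
  have hG0 : ∀ u', zpw q u' (M / r) * (theta q r (u - u' + M) * A / (theta q r (u - u') * B)) =
      G (q ^ (2 * u')) := fun u' => by
    simp only [G]
    rw [hC, ← kernel_eq hq0 hp, mul_div_mul_comm, mul_assoc]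
  have hG : ∀ z', ‖p * z‖ < ‖z'‖ → ‖z'‖ < ‖z‖ → DifferentiableAt ℂ G z' := by
    intro z' h1 h2
    have hz' : z' ≠ 0 := norm_pos_iff.1 ((norm_nonneg _).trans_lt h1)
    have hdiv : ∀ c : ℂ, c ≠ 0 → DifferentiableAt ℂ (fun x => Theta p (c / x)) z' := fun c hc =>
      (differentiableAt_Theta hp (div_ne_zero hc hz')).comp (g := Theta p) (f := fun x => c / x) z'
        ((differentiableAt_const c).div differentiableAt_id hz')
    exact (((hdiv _ (cpow_ne_zero hq0 _)).div (hdiv _ (cpow_ne_zero hq0 _))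
      (Theta_ne_zero_of_annulus hp (cpow_ne_zero hq0 _) h1 h2)).const_mul C).mul_const (A / B)
  have hR := norm_cpow_r_lt_one hq0 hp
  have hR0 : 0 < ‖q ^ r‖ := norm_pos_iff.2 (cpow_ne_zero hq0 _)
  have hz0 : 0 < ‖z‖ := norm_pos_iff.2 (cpow_ne_zero hq0 _)
  have hρ1 : ‖p * z‖ < ‖z * q ^ r‖ := by
    rw [hpd, cpow_two_mul_eq_sq hq0, norm_mul, norm_mul, norm_pow, mul_comm ‖z‖, sq]
    exact mul_lt_mul_of_pos_right (mul_lt_of_lt_one_left hR0 hR) hz0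
  have hρ2 : ‖z * q ^ r‖ < ‖z‖ := by
    rw [norm_mul]; exact mul_lt_of_lt_one_right hz0 hR
  have key := hasSum_laurent (norm_nonneg _) hG hρ1 hρ2 hu.1 hu.2
  rw [hG0]
  convert key using 3 with n
  rw [laurentCoeff, ← integral_circ_eq_circleAverage, contour]
  refine intervalIntegral.integral_congr fun t _ => ?_
  have e : q ^ (2 * (u + r / 2 + Real.pi * Complex.I * t / Complex.log q)) = circ (z * q ^ r) t := by
    rw [circ, hz, ← Complex.cpow_add _ _ hq0, ← cpow_pi_div hq0 hq1 (2 * Real.pi * Complex.I * t),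
      ← Complex.cpow_add _ _ hq0]
    congr 1
    ring
  change (q ^ (2 * (u + r / 2 + Real.pi * Complex.I * t / Complex.log q))) ^ (-n) * _ * _ = _
  rw [mul_assoc, hG0, e]

/-- Meromorphic continuation of the mode sums defining the half currents. -/
lemma meroExt_contour (hq0 : q ≠ 0) (hq1 : ‖q‖ < 1) (hp : ‖q ^ (2 * r)‖ < 1) (M A B c C : ℂ)
    {u u₀ ζ : ℂ} (hζ : q ^ (2 * u₀) = ζ) (hu : theta q r (u - u₀) ≠ 0) :
    meroExt (𝓟 (strip q r ζ)) (fun u => c * ∑' n : ℤ, C * ζ ^ n * contour q r u fun u' =>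
        (q ^ (2 * u')) ^ (-n) * zpw q u' (M / r) *
          (theta q r (u - u' + M) * A / (theta q r (u - u') * B))) u =
      c * C * (zpw q u₀ (M / r) * (theta q r (u - u₀ + M) * A / (theta q r (u - u₀) * B))) := by
  subst hζ
  have hθ := differentiable_theta (r := r) hq0 hp
  have hn : Differentiable ℂ fun u => zpw q u₀ (M / r) * (A / B) * theta q r (u - u₀ + M) := by
    fun_prop
  have hd : Differentiable ℂ fun u => theta q r (u - u₀) := by fun_prop
  have e : ∀ u, c * C * (zpw q u₀ (M / r) * (theta q r (u - u₀ + M) * A / (theta q r (u - u₀) * B)))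
      = c * C * (zpw q u₀ (M / r) * (A / B) * theta q r (u - u₀ + M) / theta q r (u - u₀)) :=
    fun u => by rw [mul_div_mul_comm]; ring
  have han : ∀ u, theta q r (u - u₀) ≠ 0 → AnalyticAt ℂ (fun u =>
      c * C * (zpw q u₀ (M / r) * (A / B) * theta q r (u - u₀ + M) / theta q r (u - u₀))) u :=
    fun u hu => analyticAt_const.mul ((hn.analyticAt u).div (hd.analyticAt u) hu)
  have hopen : IsOpen (strip q r (q ^ (2 * u₀))) := by
    have hc : Continuous fun u : ℂ => q ^ (2 * u) :=
      Continuous.const_cpow (by fun_prop) (Or.inl hq0)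
    exact (isOpen_lt (continuous_const.mul hc).norm continuous_const).inter
      (isOpen_lt continuous_const hc.norm)
  have hmem : u₀ - r / 2 ∈ strip q r (q ^ (2 * u₀)) := by
    have hR := norm_cpow_r_lt_one hq0 hp
    have hR0 : 0 < ‖q ^ r‖ := norm_pos_iff.2 (cpow_ne_zero hq0 _)
    have hz0 : 0 < ‖q ^ (2 * u₀)‖ := norm_pos_iff.2 (cpow_ne_zero hq0 _)
    have e1 : q ^ (2 * r) * q ^ (2 * (u₀ - r / 2)) = q ^ r * q ^ (2 * u₀) := by
      rw [← Complex.cpow_add _ _ hq0, ← Complex.cpow_add _ _ hq0]; ring_nf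
    have e2 : q ^ (2 * u₀) = q ^ r * q ^ (2 * (u₀ - r / 2)) := by
      rw [← Complex.cpow_add _ _ hq0]; ring_nf
    refine ⟨?_, ?_⟩
    · rw [e1, norm_mul]; exact mul_lt_of_lt_one_left hz0 hR
    · conv_lhs => rw [e2]
      rw [norm_mul]
      exact mul_lt_of_lt_one_left (norm_pos_iff.2 (cpow_ne_zero hq0 _)) hR
  rw [e]
  refine meroExt_eq (x₀ := u₀ - r / 2) (le_principal_iff.2 (hopen.mem_nhds hmem)) (g := fun u =>
      c * C * (zpw q u₀ (M / r) * (A / B) * theta q r (u - u₀ + M) / theta q r (u - u₀)))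
    ((Meromorphic.const _).mul ((meromorphic_of_differentiable hn).div
      (meromorphic_of_differentiable hd))) ?_ (han u hu)
  filter_upwards [mem_principal_self _] with u hu
  refine ⟨han u (theta_ne_zero_of_mem_strip hq0 hp hu), ?_⟩
  rw [← e, ← (hasSum_contour hq0 hq1 hp M A B hu).tsum_eq, mul_assoc, ← tsum_mul_left]
  simp only [mul_assoc]

lemma zetaPlus_eq (hq0 : q ≠ 0) (v : ℂ) (h : ℤ) :
    q ^ (2 * (v + (h + 1) / 2)) = zetaPlus q v h := by
  rw [zetaPlus, ← Complex.cpow_intCast, ← Complex.cpow_add _ _ hq0]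
  congr 1; push_cast; ring

lemma zetaMinus_eq (hq0 : q ≠ 0) (v : ℂ) (h : ℤ) :
    q ^ (2 * (v + (h - 1) / 2)) = zetaMinus q v h := by
  rw [zetaMinus, ← Complex.cpow_intCast, ← Complex.cpow_add _ _ hq0]
  congr 1; push_cast; ring

lemma ePlusCoeff_eq (hq0 : q ≠ 0) (hq1 : ‖q‖ < 1) (hp : ‖q ^ (2 * r)‖ < 1) (v : ℂ) (l : ℕ)
    (aStar : ℂ) (h : ℤ) (P : ℂ) {u : ℂ} (hu : theta q r (u - v - (h + 1) / 2) ≠ 0) :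
    ePlusCoeff q r v l aStar h P u =
      aStar * (uPlus q r v l (h + 2) (zetaPlus q v h) * qnum q ((h + l + 2) / 2)) *
        (q ^ (-((2 * v + h + 1) * (P - 1) / r)) *
          (theta q r (u - v - (h + 1) / 2 - (P - 1)) * theta q r 1 /
            (theta q r (u - v - (h + 1) / 2) * theta q r (P - 1)))) := by
  rw [sub_sub] at hu
  have := meroExt_contour hq0 hq1 hp (-(P - 1)) (theta q r 1) (theta q r (P - 1)) aStar
    (uPlus q r v l (h + 2) (zetaPlus q v h) * qnum q ((h + l + 2) / 2)) (zetaPlus_eq hq0 v h) hu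
  rw [sub_sub u, sub_eq_add_neg _ (P - 1)]
  have e : q ^ (-((2 * v + h + 1) * (P - 1) / r)) = zpw q (v + (h + 1) / 2) (-(P - 1) / r) := by
    rw [zpw]; congr 1; ring
  rw [e, ← this, ePlusCoeff]
  refine congrFun (congrArg (meroExt _) (funext fun u => ?_)) u
  congr 1
  refine tsum_congr fun n => ?_
  rw [eMode, xPlusMode, ← mul_assoc]
  refine congrArg _ (congrArg (contour q r u) (funext fun u' => ?_))
  rw [neg_div, show u - u' - P + 1 = u - u' + -(P - 1) by ring]

lemma fPlusCoeff_eq (hq0 : q ≠ 0) (hq1 : ‖q‖ < 1) (hp : ‖q ^ (2 * r)‖ < 1) (v : ℂ) (l : ℕ)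
    (a : ℂ) (h : ℤ) (P : ℂ) {u : ℂ} (hu : theta q r (u - v - (h - 1) / 2) ≠ 0) :
    fPlusCoeff q r v l a h P u =
      a * (uMinus q r v l h (zetaMinus q v h)⁻¹ * qnum q ((-h + l + 2) / 2)) *
        (q ^ ((2 * v + h - 1) * (P + h - 1) / r) *
          (theta q r (u - v - (h - 1) / 2 + (P + h - 1)) * theta q r 1 /
            (theta q r (u - v - (h - 1) / 2) * theta q r (P + h - 1)))) := by
  rw [sub_sub] at hu
  have := meroExt_contour hq0 hq1 hp (P + h - 1) (theta q r 1) (theta q r (P + h - 1)) a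
    (uMinus q r v l h (zetaMinus q v h)⁻¹ * qnum q ((-h + l + 2) / 2)) (zetaMinus_eq hq0 v h) hu
  rw [sub_sub u]
  have e : q ^ ((2 * v + h - 1) * (P + h - 1) / r) =
      zpw q (v + (h - 1) / 2) ((P + h - 1) / r) := by
    rw [zpw]; congr 1; ring
  rw [e, ← this, fPlusCoeff]
  refine congrFun (congrArg (meroExt _) (funext fun u => ?_)) u
  congr 1
  refine tsum_congr fun n => ?_
  rw [fMode, xMinusMode, ← mul_assoc]
  refine congrArg _ (congrArg (contour q r u) (funext fun u' => ?_))
  rw [show u - u' + P + h - 1 = u - u' + (P + h - 1) by ring]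

end HalfCurrents

/-! ### Generic values of the spectral parameter -/

section Generic

variable {q r : ℂ}

/-- The products occurring in `ρ⁺` and in the eigenvalues of `K⁺` do not vanish at `x`. -/
def Generic (q r : ℂ) (l : ℕ) (x : ℂ) : Prop :=
  ∀ e ∈ Finset.Icc (-((l : ℤ) + 6)) (l + 6),
    dpoch q (q ^ (2 * r)) (q ^ (2 * r) * q ^ e * q ^ (2 * x)) ≠ 0 ∧
      dpoch q (q ^ (2 * r)) (q ^ e / q ^ (2 * x)) ≠ 0

lemma dpoch_ne_zero_of_norm_lt {p : ℂ} (hp : ‖p‖ < 1) (hq1 : ‖q‖ < 1) {z : ℂ} (hz : ‖z‖ < 1) :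
    dpoch q p z ≠ 0 := by
  obtain ⟨L, -, h⟩ := hasSum_log_dpoch hp hq1 hz
  rw [← h]
  exact Complex.exp_ne_zero _

lemma exists_cpow_eq (hq0 : q ≠ 0) (hq1 : ‖q‖ < 1) {c : ℂ} (hc : c ≠ 0) :
    ∃ x : ℂ, q ^ (2 * x) = c := by
  refine ⟨Complex.log c / Complex.log q / 2, ?_⟩
  rw [mul_div_cancel₀ _ two_ne_zero, cpow_pi_div hq0 hq1, Complex.exp_log hc]

lemma eventually_generic (hq0 : q ≠ 0) (hq1 : ‖q‖ < 1) (hp : ‖q ^ (2 * r)‖ < 1) (l : ℕ) (v : ℂ) :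
    ∀ᶠ u in codiscrete ℂ, Generic q r l (u - v) := by
  refine (Finset.eventually_all _).2 fun e _ => ?_
  have hd : Differentiable ℂ fun u : ℂ => q ^ (2 * (u - v)) := fun u =>
    DifferentiableAt.const_cpow (by fun_prop) (Or.inl hq0)
  have hF := differentiable_dpoch hp hq1
  have hpe : q ^ (2 * r) * q ^ e ≠ 0 := mul_ne_zero (cpow_ne_zero hq0 _) (zpow_ne_zero _ hq0)
  obtain ⟨x, hx⟩ := exists_cpow_eq hq0 hq1 (c := (q ^ (2 * r) * q ^ e)⁻¹ * 2⁻¹)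
    (mul_ne_zero (inv_ne_zero hpe) (by norm_num))
  obtain ⟨y, hy⟩ := exists_cpow_eq hq0 hq1 (c := q ^ e * 2)
    (mul_ne_zero (zpow_ne_zero _ hq0) two_ne_zero)
  have hhalf : ‖(2 : ℂ)⁻¹‖ < 1 := by norm_num
  have h1 := codiscrete_ne_zero (f := fun u => dpoch q (q ^ (2 * r))
      (q ^ (2 * r) * q ^ e * q ^ (2 * (u - v))))
    (hF.comp (hd.const_mul _)) (x := x + v) (by
      simp only [add_sub_cancel_right, hx]
      rw [mul_inv_cancel_left₀ hpe]
      exact dpoch_ne_zero_of_norm_lt hp hq1 hhalf)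
  have h2 := codiscrete_ne_zero (f := fun u => dpoch q (q ^ (2 * r)) (q ^ e / q ^ (2 * (u - v))))
    (hF.comp fun u => (differentiableAt_const _).div (hd u) (cpow_ne_zero hq0 _))
    (x := y + v) (by
      simp only [add_sub_cancel_right, hy]
      rw [div_mul_cancel_left₀ (zpow_ne_zero _ hq0)]
      exact dpoch_ne_zero_of_norm_lt hp hq1 hhalf)
  exact h1.and h2

end Generic

section Identities

variable {q r : ℂ}

lemma zpow_eq_cpow (q : ℂ) (e : ℤ) : q ^ e = q ^ (e : ℂ) := (Complex.cpow_intCast _ _).symm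

/-- `[e/2 - x]` in terms of `Θ_p`. -/
lemma theta_half_sub (hq0 : q ≠ 0) (e : ℤ) (x : ℂ) : theta q r (e / 2 - x) =
    q ^ ((e / 2 - x) ^ 2 / r - (e / 2 - x)) / poch (q ^ (2 * r)) (q ^ (2 * r)) ^ 3 *
      Theta (q ^ (2 * r)) (q ^ e / q ^ (2 * x)) := by
  rw [theta, zpow_eq_cpow, ← Complex.cpow_sub _ _ hq0]
  ring_nf

lemma Generic.poch_ne_zero {l : ℕ} {x : ℂ} (hq1 : ‖q‖ < 1) (hp : ‖q ^ (2 * r)‖ < 1)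
    (hx : Generic q r l x) {e : ℤ} (h1 : -((l : ℤ) + 6) ≤ e) (h2 : e ≤ l + 6) :
    poch (q ^ (2 * r) * q ^ e * q ^ (2 * x)) (q ^ (2 * r)) ≠ 0 ∧
      poch (q ^ e / q ^ (2 * x)) (q ^ (2 * r)) ≠ 0 := by
  obtain ⟨h3, h4⟩ := hx e (Finset.mem_Icc.2 ⟨h1, h2⟩)
  rw [dpoch_succ hp hq1] at h3 h4
  exact ⟨left_ne_zero_of_mul h3, left_ne_zero_of_mul h4⟩

lemma Theta_div_eq (hq0 : q ≠ 0) (e : ℤ) (x : ℂ) :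
    Theta (q ^ (2 * r)) (q ^ e / q ^ (2 * x)) = poch (q ^ e / q ^ (2 * x)) (q ^ (2 * r)) *
      poch (q ^ (2 * r) * q ^ (-e) * q ^ (2 * x)) (q ^ (2 * r)) *
      poch (q ^ (2 * r)) (q ^ (2 * r)) := by
  rw [Theta]
  congr 3
  rw [zpow_neg]
  field_simp

lemma Generic.theta_ne_zero {l : ℕ} {x : ℂ} (hq0 : q ≠ 0) (hq1 : ‖q‖ < 1) (hp : ‖q ^ (2 * r)‖ < 1)
    (hx : Generic q r l x) {e : ℤ} (h1 : -((l : ℤ) + 6) ≤ e) (h2 : e ≤ l + 6) :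
    theta q r (x - e / 2) ≠ 0 := by
  rw [← neg_sub, theta_neg hq0 hp, theta_half_sub hq0, neg_ne_zero, Theta_div_eq hq0]
  have hpp := poch_ne_zero_of_norm_lt hp hp
  exact mul_ne_zero (div_ne_zero (cpow_ne_zero hq0 _) (pow_ne_zero _ hpp))
    (mul_ne_zero (mul_ne_zero (hx.poch_ne_zero hq1 hp h1 h2).2
      (hx.poch_ne_zero hq1 hp (e := -e) (by omega) (by omega)).1) hpp)

/-- The eigenvalue of `K⁺(u)` on weight `h`, without `e^Q`. -/
def kCoeff (q r v : ℂ) (l : ℕ) (u : ℂ) (h : ℤ) : ℂ :=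
  kPos q r v l h (q ^ (2 * (u + (r + 1) / 2))) * kNeg q r v l h (q ^ (-(2 * (u + (r + 1) / 2)))) *
    zpw q (u + (r + 1) / 2) (h / (2 * r))

lemma Kplus_eq (q r v : ℂ) (l : ℕ) (u : ℂ) :
    Kplus q r v l u = constShift l (kCoeff q r v l u) 1 :=
  hP_mul_expQ_mul_hP_const _ _ _

lemma kPos_mul_kNeg (hq0 : q ≠ 0) (hq1 : ‖q‖ < 1) (hp : ‖q ^ (2 * r)‖ < 1) {u v : ℂ} {l : ℕ} {h : ℤ}
    (h1 : -(l : ℤ) ≤ h) (h2 : h ≤ l) (hx : Generic q r l (u - v)) :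
    kPos q r v l h (q ^ (2 * (u + (r + 1) / 2))) * kNeg q r v l h (q ^ (-(2 * (u + (r + 1) / 2)))) ≠ 0
    ∧ (kPos q r v l h (q ^ (2 * (u + (r + 1) / 2))) *
        kNeg q r v l h (q ^ (-(2 * (u + (r + 1) / 2)))))⁻¹ =
      rhoKL q r 1 l (q ^ (2 * (u - v))) * q ^ (-(l : ℂ) / 2) *
        (Theta (q ^ (2 * r)) (q ^ (h - 1) / q ^ (2 * (u - v))) /
          Theta (q ^ (2 * r)) (q ^ (-((l : ℤ) + 1)) / q ^ (2 * (u - v)))) := by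
  set X := q ^ (2 * (u - v)) with hX
  set p := q ^ (2 * r) with hpd
  have hX0 : X ≠ 0 := cpow_ne_zero hq0 _
  have hpp := poch_ne_zero_of_norm_lt hp hp
  have eY : q ^ r * q ^ (2 * v) * q ^ (-(2 * (u + (r + 1) / 2))) = q⁻¹ / X := by
    rw [hX, ← Complex.cpow_neg_one, ← Complex.cpow_sub _ _ hq0, ← Complex.cpow_add _ _ hq0,
      ← Complex.cpow_add _ _ hq0]
    ring_nf
  have eY' : q ^ r * q ^ (2 * -v) * q ^ (2 * (u + (r + 1) / 2)) = p * q * X := by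
    have h1 : p * q * X = q ^ (2 * r) * q ^ (1 : ℂ) * q ^ (2 * (u - v)) := by
      rw [Complex.cpow_one]
    rw [h1, ← Complex.cpow_add _ _ hq0, ← Complex.cpow_add _ _ hq0, ← Complex.cpow_add _ _ hq0,
      ← Complex.cpow_add _ _ hq0]
    ring_nf
  have E' : ∀ e f : ℤ, f = e + 1 → q ^ e * (p * q * X) = p * q ^ f * X := fun e f hf => by
    rw [hf, zpow_add₀ hq0, zpow_one]; ring
  have E : ∀ e f : ℤ, f = e - 1 → q ^ e * (q⁻¹ / X) = q ^ f / X := fun e f hf => by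
    rw [hf, zpow_sub₀ hq0, zpow_one]; field_simp
  have dn : ∀ e : ℤ, -((l : ℤ) + 6) ≤ e → e ≤ l + 6 →
      dpoch q p (p * q ^ e * X) ≠ 0 ∧ dpoch q p (q ^ e / X) ≠ 0 :=
    fun e h1 h2 => hx e (Finset.mem_Icc.2 ⟨h1, h2⟩)
  have pn : ∀ e : ℤ, -((l : ℤ) + 6) ≤ e → e ≤ l + 6 →
      poch (p * q ^ e * X) p ≠ 0 ∧ poch (q ^ e / X) p ≠ 0 :=
    fun e h1 h2 => hx.poch_ne_zero hq1 hp h1 h2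
  rw [kPos_eq_kNeg,
    kNeg_eq hq0 hq1 hp v l h rfl eY (by rw [E h (h - 1) rfl]; exact (pn _ (by omega) (by omega)).2)
      (by rw [E ((l : ℤ) + 4) ((l : ℤ) + 3) (by ring)]; exact (dn _ (by omega) (by omega)).2)
      (by rw [E (-(l : ℤ) + 2) (1 - (l : ℤ)) (by ring)]; exact (dn _ (by omega) (by omega)).2),
    kNeg_eq hq0 hq1 hp (-v) l (-h) rfl eY'
      (by rw [E' (-h) (1 - h) (by ring)]; exact (pn _ (by omega) (by omega)).1)
      (by rw [E' ((l : ℤ) + 4) ((l : ℤ) + 5) (by ring)]; exact (dn _ (by omega) (by omega)).1)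
      (by rw [E' (-(l : ℤ) + 2) (3 - (l : ℤ)) (by ring)]; exact (dn _ (by omega) (by omega)).1),
    ← hpd, E h (h - 1) rfl, E ((l : ℤ) + 4) ((l : ℤ) + 3) (by ring),
      E (-(l : ℤ) + 2) (1 - (l : ℤ)) (by ring),
    E ((l : ℤ) + 2) ((l : ℤ) + 1) (by ring), E (-(l : ℤ)) (-(l : ℤ) - 1) (by ring),
    E' (-h) (1 - h) (by ring), E' ((l : ℤ) + 4) ((l : ℤ) + 5) (by ring), E' (-(l : ℤ) + 2) (3 - (l : ℤ)) (by ring),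
    E' ((l : ℤ) + 2) ((l : ℤ) + 3) (by ring), E' (-(l : ℤ)) (1 - (l : ℤ)) (by ring),
    Theta_div_eq hq0, Theta_div_eq hq0, ← hpd, ← hX]
  have d1 : dpoch q p (p * q ^ ((l : ℤ) + 1) * X) =
      poch (p * q ^ ((l : ℤ) + 1) * X) p * dpoch q p (p * q ^ ((l : ℤ) + 5) * X) := by
    rw [dpoch_succ hp hq1]
    congr 2
    rw [show (l : ℤ) + 5 = 4 + (l + 1) by ring, zpow_add₀ hq0 4]
    norm_cast
    ring
  have d2 : dpoch q p (q ^ (-(l : ℤ) - 1) / X) =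
      poch (q ^ (-(l : ℤ) - 1) / X) p * dpoch q p (q ^ (3 - (l : ℤ)) / X) := by
    rw [dpoch_succ hp hq1]
    congr 2
    rw [show 3 - (l : ℤ) = 4 + (-l - 1) by ring, zpow_add₀ hq0 4, mul_div_assoc]
    norm_cast
  have a1 := (dn ((l : ℤ) + 3) (by omega) (by omega))
  have a2 := (dn (1 - (l : ℤ)) (by omega) (by omega))
  have a3 := (dn ((l : ℤ) + 1) (by omega) (by omega)).2
  have a4 := (dn (3 - (l : ℤ)) (by omega) (by omega))
  have a5 := (dn ((l : ℤ) + 5) (by omega) (by omega)).1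
  have b1 := (pn (h - 1) (by omega) (by omega)).2
  have b2 := (pn (1 - h) (by omega) (by omega)).1
  have b3 := (pn ((l : ℤ) + 1) (by omega) (by omega)).1
  have b4 := (pn (-(l : ℤ) - 1) (by omega) (by omega)).2
  have a6 : dpoch q p (q ^ (-(l : ℤ) - 1) / X) ≠ 0 := (dn _ (by omega) (by omega)).2
  have hql : q ^ ((l : ℂ) / 2) ≠ 0 := cpow_ne_zero hq0 _
  have eql : q ^ (-(l : ℂ) / 2) = (q ^ ((l : ℂ) / 2))⁻¹ := by
    rw [← Complex.cpow_neg]; ring_nf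
  refine ⟨?_, ?_⟩
  · exact mul_ne_zero (div_ne_zero (mul_ne_zero a1.1 a2.1) (mul_ne_zero (mul_ne_zero a5 a4.1) b2))
      (div_ne_zero (mul_ne_zero a3 a6) (mul_ne_zero (mul_ne_zero a1.2 a2.2) b1))
  · simp only [rhoKL, ← hpd]
    rw [show (1 : ℤ) - l + 2 = 3 - l by ring, show -(1 : ℤ) + l + 2 = l + 1 by ring,
      show (1 : ℤ) + l + 2 = l + 3 by ring, show -(1 : ℤ) - l + 2 = 1 - l by ring, d1, d2, eql,
      show -(h - 1) = 1 - h by ring, show -((l : ℤ) + 1) = -l - 1 by ring,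
      show -(-(l : ℤ) - 1) = l + 1 by ring]
    have a7 := a4.1
    have a8 := a4.2
    have a9 := a1.1
    have a10 := a1.2
    have a11 := a2.1
    have a12 := a2.2
    push_cast
    rw [one_mul]
    clear_value X p
    clear dn pn E E' d1 d2 eY eY' a1 a2 a4 h1 h2 hx hX hpd
    generalize dpoch q p (p * q ^ ((l : ℤ) + 1) * X) = A1 at *
    generalize dpoch q p (p * q ^ ((l : ℤ) + 3) * X) = A3 at *
    generalize dpoch q p (p * q ^ ((l : ℤ) + 5) * X) = A5 at *
    generalize dpoch q p (p * q ^ (1 - (l : ℤ)) * X) = A6 at *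
    generalize dpoch q p (p * q ^ (3 - (l : ℤ)) * X) = A7 at *
    generalize dpoch q p (q ^ ((l : ℤ) + 1) / X) = B1 at *
    generalize dpoch q p (q ^ ((l : ℤ) + 3) / X) = B3 at *
    generalize dpoch q p (q ^ (1 - (l : ℤ)) / X) = B6 at *
    generalize dpoch q p (q ^ (3 - (l : ℤ)) / X) = B7 at *
    generalize poch (q ^ (h - 1) / X) p = C1 at *
    generalize poch (p * q ^ (1 - h) * X) p = C2 at *
    generalize poch (p * q ^ ((l : ℤ) + 1) * X) p = C3 at *
    generalize poch (q ^ (-(l : ℤ) - 1) / X) p = C4 at *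
    generalize poch p p = C5 at *
    field_simp

lemma rho_mul_rho (hq0 : q ≠ 0) (hq1 : ‖q‖ < 1) (hp : ‖q ^ (2 * r)‖ < 1) {x : ℂ} {l : ℕ}
    (hx : Generic q r l x) :
    rhoKL q r 1 l (q ^ (2 * x)) * rhoKL q r 1 l (q ^ (2 * (x - 1))) *
        Theta (q ^ (2 * r)) (q ^ ((l : ℤ) + 1) / q ^ (2 * x)) =
      q ^ (l : ℂ) * Theta (q ^ (2 * r)) (q ^ (1 - (l : ℤ)) / q ^ (2 * x)) ∧
    rhoKL q r 1 l (q ^ (2 * x)) ≠ 0 ∧ rhoKL q r 1 l (q ^ (2 * (x - 1))) ≠ 0 := by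
  set X := q ^ (2 * x) with hX
  set p := q ^ (2 * r) with hpd
  have hX0 : X ≠ 0 := cpow_ne_zero hq0 _
  have eX : q ^ (2 * (x - 1)) = X / q ^ 2 := by
    rw [mul_sub, Complex.cpow_sub _ _ hq0, mul_one]; norm_cast
  have dn : ∀ e : ℤ, -((l : ℤ) + 6) ≤ e → e ≤ l + 6 →
      dpoch q p (p * q ^ e * X) ≠ 0 ∧ dpoch q p (q ^ e / X) ≠ 0 :=
    fun e h1 h2 => hx e (Finset.mem_Icc.2 ⟨h1, h2⟩)
  have E1 : ∀ e f : ℤ, f = e - 2 → p * q ^ e * (X / q ^ 2) = p * q ^ f * X := fun e f hf => by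
    rw [hf, zpow_sub₀ hq0]; norm_cast; field_simp
  have E2 : ∀ e f : ℤ, f = e + 2 → q ^ e / (X / q ^ 2) = q ^ f / X := fun e f hf => by
    rw [hf, zpow_add₀ hq0]; norm_cast; field_simp
  have d1 : ∀ e f : ℤ, f = e + 4 → dpoch q p (p * q ^ e * X) =
      poch (p * q ^ e * X) p * dpoch q p (p * q ^ f * X) := fun e f hf => by
    rw [dpoch_succ hp hq1]
    congr 2
    rw [hf, zpow_add₀ hq0 e]
    norm_cast
    ring
  have d2 : ∀ e f : ℤ, f = e + 4 → dpoch q p (q ^ e / X) =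
      poch (q ^ e / X) p * dpoch q p (q ^ f / X) := fun e f hf => by
    rw [dpoch_succ hp hq1]
    congr 2
    rw [hf, zpow_add₀ hq0 e]
    norm_cast
    ring
  have hql : q ^ ((l : ℂ) / 2) ≠ 0 := cpow_ne_zero hq0 _
  have eql : q ^ (l : ℂ) = q ^ ((l : ℂ) / 2) * q ^ ((l : ℂ) / 2) := by
    rw [← Complex.cpow_add _ _ hq0]; ring_nf
  have R1 : rhoKL q r 1 l X = q ^ ((l : ℂ) / 2) *
      (dpoch q p (p * q ^ (3 - (l : ℤ)) * X) * dpoch q p (p * q ^ ((l : ℤ) + 1) * X) /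
        (dpoch q p (p * q ^ ((l : ℤ) + 3) * X) * dpoch q p (p * q ^ (1 - (l : ℤ)) * X))) *
      (dpoch q p (q ^ ((l : ℤ) + 3) / X) * dpoch q p (q ^ (1 - (l : ℤ)) / X) /
        (dpoch q p (q ^ (3 - (l : ℤ)) / X) * dpoch q p (q ^ ((l : ℤ) + 1) / X))) := by
    simp only [rhoKL, ← hpd]
    rw [show (1 : ℤ) - l + 2 = 3 - l by ring, show -(1 : ℤ) + l + 2 = l + 1 by ring,
      show (1 : ℤ) + l + 2 = l + 3 by ring, show -(1 : ℤ) - l + 2 = 1 - l by ring]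
    push_cast
    rw [one_mul]
  have R2 : rhoKL q r 1 l (X / q ^ 2) = q ^ ((l : ℂ) / 2) *
      (dpoch q p (p * q ^ (1 - (l : ℤ)) * X) * dpoch q p (p * q ^ ((l : ℤ) - 1) * X) /
        (dpoch q p (p * q ^ ((l : ℤ) + 1) * X) * dpoch q p (p * q ^ (-(l : ℤ) - 1) * X))) *
      (dpoch q p (q ^ ((l : ℤ) + 5) / X) * dpoch q p (q ^ (3 - (l : ℤ)) / X) /
        (dpoch q p (q ^ (5 - (l : ℤ)) / X) * dpoch q p (q ^ ((l : ℤ) + 3) / X))) := by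
    simp only [rhoKL, ← hpd]
    rw [E1 _ (1 - (l : ℤ)) (by ring), E1 _ ((l : ℤ) - 1) (by ring), E1 _ ((l : ℤ) + 1) (by ring),
      E1 _ (-(l : ℤ) - 1) (by ring), E2 _ ((l : ℤ) + 5) (by ring), E2 _ (3 - (l : ℤ)) (by ring),
      E2 _ (5 - (l : ℤ)) (by ring), E2 _ ((l : ℤ) + 3) (by ring)]
    push_cast
    rw [one_mul]
  have a1 := dn ((l : ℤ) + 3) (by omega) (by omega)
  have a2 := dn (1 - (l : ℤ)) (by omega) (by omega)
  have a3 := dn ((l : ℤ) + 1) (by omega) (by omega)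
  have a4 := dn (3 - (l : ℤ)) (by omega) (by omega)
  have a5 := (dn ((l : ℤ) + 5) (by omega) (by omega)).2
  have a6 := (dn (5 - (l : ℤ)) (by omega) (by omega)).2
  have a7 := (dn ((l : ℤ) - 1) (by omega) (by omega)).1
  have a8 := (dn (-(l : ℤ) - 1) (by omega) (by omega)).1
  obtain ⟨a1, a1'⟩ := a1
  obtain ⟨a2, a2'⟩ := a2
  obtain ⟨a3, a3'⟩ := a3
  obtain ⟨a4, a4'⟩ := a4
  rw [eX, R1, R2]
  refine ⟨?_, mul_ne_zero (mul_ne_zero hql (div_ne_zero (mul_ne_zero a4 a3) (mul_ne_zero a1 a2)))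
      (div_ne_zero (mul_ne_zero a1' a2') (mul_ne_zero a4' a3')),
    mul_ne_zero (mul_ne_zero hql (div_ne_zero (mul_ne_zero a2 a7) (mul_ne_zero a3 a8)))
      (div_ne_zero (mul_ne_zero a5 a4') (mul_ne_zero a6 a1'))⟩
  rw [Theta_div_eq hq0, Theta_div_eq hq0, ← hpd, ← hX, eql,
    show -((l : ℤ) + 1) = -l - 1 by ring, show -(1 - (l : ℤ)) = l - 1 by ring]
  have f1 := d1 (-(l : ℤ) - 1) (3 - (l : ℤ)) (by ring)
  have f2 := d1 ((l : ℤ) - 1) ((l : ℤ) + 3) (by ring)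
  have f3 := d2 (1 - (l : ℤ)) (5 - (l : ℤ)) (by ring)
  have f4 := d2 ((l : ℤ) + 1) ((l : ℤ) + 5) (by ring)
  rw [f1] at a8
  rw [f4] at a3'
  have a8' := left_ne_zero_of_mul a8
  have a3'' := left_ne_zero_of_mul a3'
  rw [f1, f2, f3, f4]
  clear_value X p
  clear dn d1 d2 E1 E2 R1 R2 f1 f2 f3 f4 hx hX hpd eX
  generalize dpoch q p (p * q ^ ((l : ℤ) + 1) * X) = A1 at *
  generalize dpoch q p (p * q ^ ((l : ℤ) + 3) * X) = A3 at *
  generalize dpoch q p (p * q ^ (1 - (l : ℤ)) * X) = A6 at *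
  generalize dpoch q p (p * q ^ (3 - (l : ℤ)) * X) = A7 at *
  generalize dpoch q p (q ^ ((l : ℤ) + 5) / X) = B1 at *
  generalize dpoch q p (q ^ ((l : ℤ) + 3) / X) = B3 at *
  generalize dpoch q p (q ^ (5 - (l : ℤ)) / X) = B6 at *
  generalize dpoch q p (q ^ (3 - (l : ℤ)) / X) = B7 at *
  generalize poch (q ^ (1 - (l : ℤ)) / X) p = C1 at *
  generalize poch (p * q ^ (-(l : ℤ) - 1) * X) p = C2 at *
  generalize poch (p * q ^ ((l : ℤ) - 1) * X) p = C3 at *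
  generalize poch (q ^ ((l : ℤ) + 1) / X) p = C4 at *
  generalize poch p p = C5 at *
  field_simp

end Identities

section Identities

variable {q r : ℂ}

lemma Generic.phiL_ne_zero {l : ℕ} {x : ℂ} (hq0 : q ≠ 0) (hq1 : ‖q‖ < 1) (hp : ‖q ^ (2 * r)‖ < 1)
    (hx : Generic q r l x) : phiL q r l x ≠ 0 := by
  have h1 := hx.theta_ne_zero hq0 hq1 hp (e := -((l : ℤ) + 1)) (by omega) (by omega)
  have h2 : x - ((-((l : ℤ) + 1) : ℤ) : ℂ) / 2 = x + (l + 1) / 2 := by push_cast; ring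
  rw [h2] at h1
  exact mul_ne_zero (mul_ne_zero (neg_ne_zero.2 (cpow_ne_zero hq0 _))
    (inv_ne_zero (rho_mul_rho hq0 hq1 hp hx).2.1)) h1

lemma theta_sub_half (hq0 : q ≠ 0) (hp : ‖q ^ (2 * r)‖ < 1) (e : ℤ) {c x : ℂ} (hc : c = x - e / 2) :
    theta q r c =
    -(q ^ ((x - e / 2) ^ 2 / r + (x - e / 2)) / poch (q ^ (2 * r)) (q ^ (2 * r)) ^ 3 *
      Theta (q ^ (2 * r)) (q ^ e / q ^ (2 * x))) := by
  rw [hc, ← neg_sub, theta_neg hq0 hp, theta_half_sub hq0]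
  ring_nf

/-- The inverse of the eigenvalue of `K⁺(u)`. -/
lemma kCoeff_inv (hq0 : q ≠ 0) (hq1 : ‖q‖ < 1) (hp : ‖q ^ (2 * r)‖ < 1) {u v : ℂ} {l : ℕ} {h : ℤ}
    (h1 : -(l : ℤ) ≤ h) (h2 : h ≤ l) (hx : Generic q r l (u - v)) :
    kCoeff q r v l u h ≠ 0 ∧ (kCoeff q r v l u h)⁻¹ =
      -(theta q r (u - v - (h - 1) / 2) / phiL q r l (u - v)) *
        q ^ (-(h * v + ((h : ℂ) ^ 2 - l * (l + 2)) / 4) / r) := by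
  have hr := r_ne_zero_of_norm_lt hp
  obtain ⟨hk, hk'⟩ := kPos_mul_kNeg hq0 hq1 hp h1 h2 hx
  have hpp := poch_ne_zero_of_norm_lt hp hp
  have hρ := (rho_mul_rho hq0 hq1 hp hx).2.1
  refine ⟨mul_ne_zero hk (cpow_ne_zero hq0 _), ?_⟩
  have ht := hx.theta_ne_zero hq0 hq1 hp (e := -((l : ℤ) + 1)) (by omega) (by omega)
  rw [theta_sub_half hq0 hp _ rfl] at ht
  have hT := right_ne_zero_of_mul (neg_ne_zero.1 ht)
  rw [kCoeff, mul_inv, hk', phiL,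
    theta_sub_half hq0 hp (h - 1) (x := u - v) (by push_cast; ring),
    theta_sub_half hq0 hp (-((l : ℤ) + 1)) (x := u - v) (by push_cast; ring), zpw, zpw,
    ← Complex.cpow_neg]
  generalize Theta (q ^ (2 * r)) (q ^ (-((l : ℤ) + 1)) / q ^ (2 * (u - v))) = T1 at *
  generalize Theta (q ^ (2 * r)) (q ^ (h - 1) / q ^ (2 * (u - v))) = T2 at *
  generalize rhoKL q r 1 l (q ^ (2 * (u - v))) = R at *
  generalize poch (q ^ (2 * r)) (q ^ (2 * r)) = C at *
  have key : q ^ (-(l : ℂ) / 2) * q ^ (-(2 * (u + (r + 1) / 2) * (h / (2 * r)))) *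
      (q ^ (2 * (u - v) * -(l / (2 * r))) *
        q ^ ((u - v - ((-((l : ℤ) + 1) : ℤ) : ℂ) / 2) ^ 2 / r +
          (u - v - ((-((l : ℤ) + 1) : ℤ) : ℂ) / 2))) =
      q ^ ((u - v - ((h - 1 : ℤ) : ℂ) / 2) ^ 2 / r + (u - v - ((h - 1 : ℤ) : ℂ) / 2)) *
        q ^ (-(h * v + ((h : ℂ) ^ 2 - l * (l + 2)) / 4) / r) := by
    simp only [← Complex.cpow_add _ _ hq0]
    congr 1
    push_cast
    field_simp
    ring
  have n1 := cpow_ne_zero hq0 (2 * (u - v) * -(l / (2 * r)))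
  have n2 := cpow_ne_zero hq0 ((u - v - ((-((l : ℤ) + 1) : ℤ) : ℂ) / 2) ^ 2 / r +
          (u - v - ((-((l : ℤ) + 1) : ℤ) : ℂ) / 2))
  generalize q ^ (2 * (u - v) * -(l / (2 * r))) = G1 at *
  generalize q ^ ((u - v - ((-((l : ℤ) + 1) : ℤ) : ℂ) / 2) ^ 2 / r +
          (u - v - ((-((l : ℤ) + 1) : ℤ) : ℂ) / 2)) = G2 at *
  generalize q ^ ((u - v - ((h - 1 : ℤ) : ℂ) / 2) ^ 2 / r + (u - v - ((h - 1 : ℤ) : ℂ) / 2)) = G3 at *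
  generalize q ^ (-(h * v + ((h : ℂ) ^ 2 - l * (l + 2)) / 4) / r) = G4 at *
  generalize q ^ (-(l : ℂ) / 2) = G5 at *
  generalize q ^ (-(2 * (u + (r + 1) / 2) * (h / (2 * r)))) = G6 at *
  clear ht hk hk' hx
  field_simp
  linear_combination T2 * key

lemma phiL_mul_phiL (hq0 : q ≠ 0) (hq1 : ‖q‖ < 1) (hp : ‖q ^ (2 * r)‖ < 1) {x : ℂ} {l : ℕ}
    (hx : Generic q r l x) :
    phiL q r l (x - 1) * phiL q r l x = theta q r (x + (l + 1) / 2) * theta q r (x - (l + 1) / 2) := by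
  have hr := r_ne_zero_of_norm_lt hp
  obtain ⟨h, h1, h2⟩ := rho_mul_rho hq0 hq1 hp hx
  have hpp := poch_ne_zero_of_norm_lt hp hp
  have ht := hx.theta_ne_zero hq0 hq1 hp (e := (l : ℤ) + 1) (by omega) (by omega)
  rw [theta_sub_half hq0 hp _ rfl] at ht
  have hT := right_ne_zero_of_mul (neg_ne_zero.1 ht)
  rw [phiL, phiL, theta_sub_half hq0 hp (c := x - 1 + (l + 1) / 2) (1 - (l : ℤ)) (x := x)
      (by push_cast; ring),
    theta_sub_half hq0 hp (c := x - (l + 1) / 2) ((l : ℤ) + 1) (x := x) (by push_cast; ring), zpw, zpw]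
  generalize theta q r (x + (l + 1) / 2) = T0
  generalize Theta (q ^ (2 * r)) (q ^ ((l : ℤ) + 1) / q ^ (2 * x)) = T1 at *
  generalize Theta (q ^ (2 * r)) (q ^ (1 - (l : ℤ)) / q ^ (2 * x)) = T2 at *
  generalize rhoKL q r 1 l (q ^ (2 * x)) = R at *
  generalize rhoKL q r 1 l (q ^ (2 * (x - 1))) = R' at *
  generalize poch (q ^ (2 * r)) (q ^ (2 * r)) = C at *
  have key : q ^ (2 * x * -(l / (2 * r))) * q ^ (2 * (x - 1) * -(l / (2 * r))) *
      q ^ ((x - ((1 - (l : ℤ) : ℤ) : ℂ) / 2) ^ 2 / r + (x - ((1 - (l : ℤ) : ℤ) : ℂ) / 2)) =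
      q ^ (l : ℂ) *
      q ^ ((x - (((l : ℤ) + 1 : ℤ) : ℂ) / 2) ^ 2 / r + (x - (((l : ℤ) + 1 : ℤ) : ℂ) / 2)) := by
    simp only [← Complex.cpow_add _ _ hq0]
    congr 1
    push_cast
    field_simp
    ring
  generalize q ^ (2 * x * -(l / (2 * r))) = G1 at *
  generalize q ^ (2 * (x - 1) * -(l / (2 * r))) = G2 at *
  generalize q ^ ((x - ((1 - (l : ℤ) : ℤ) : ℂ) / 2) ^ 2 / r + (x - ((1 - (l : ℤ) : ℤ) : ℂ) / 2)) = G3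
    at *
  generalize q ^ ((x - (((l : ℤ) + 1 : ℤ) : ℂ) / 2) ^ 2 / r + (x - (((l : ℤ) + 1 : ℤ) : ℂ) / 2)) = G4
    at *
  generalize q ^ (l : ℂ) = G5 at *
  clear ht hx
  field_simp
  linear_combination (-T0 * T2) * key + T0 * G4 * h

lemma theta_eq_mul_poch (hq0 : q ≠ 0) (hp : ‖q ^ (2 * r)‖ < 1) (x : ℂ) :
    theta q r x = q ^ (x ^ 2 / r) * (q ^ (-x) - q ^ x) *
      (poch (q ^ (2 * r) * q ^ (2 * x)) (q ^ (2 * r)) *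
        poch (q ^ (2 * r) * q ^ (-(2 * x))) (q ^ (2 * r)) / poch (q ^ (2 * r)) (q ^ (2 * r)) ^ 2) := by
  have hpp := poch_ne_zero_of_norm_lt hp hp
  rw [theta, Theta, poch_succ hp (q ^ (2 * x)), Complex.cpow_sub _ _ hq0, Complex.cpow_neg q (2 * x),
    ← div_eq_mul_inv, cpow_two_mul_eq_sq hq0 x, Complex.cpow_neg q x]
  have := cpow_ne_zero hq0 x
  generalize poch (q ^ (2 * r) * (q ^ x) ^ 2) (q ^ (2 * r)) = A
  generalize poch (q ^ (2 * r) / (q ^ x) ^ 2) (q ^ (2 * r)) = B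
  field_simp

lemma poch_ne_zero_of_generic {p : ℂ} (hq0 : q ≠ 0) (hp : ‖p‖ < 1) {l : ℕ}
    (hgen : ∀ j k : ℕ, 1 ≤ j → j ≤ l → 1 ≤ k → p ^ k ≠ q ^ (2 * j)) {j : ℕ} (h1 : 1 ≤ j)
    (h2 : j ≤ l) : poch (p * q ^ (-(2 * (j : ℂ)))) p ≠ 0 := by
  refine poch_ne_zero hp fun n => ?_
  have hj : q ^ (-(2 * (j : ℂ))) = (q ^ (2 * j))⁻¹ := by
    rw [Complex.cpow_neg]; norm_cast
  rw [hj]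
  intro h
  refine hgen j (n + 1) h1 h2 (by omega) ?_
  have := pow_ne_zero (2 * j) hq0
  field_simp at h
  rw [pow_succ, mul_comm, h]

lemma poch_mul_sq_ne_zero (hq1 : ‖q‖ < 1) (hp : ‖q ^ (2 * r)‖ < 1) :
    poch (q ^ (2 * r) * q ^ (2 : ℂ)) (q ^ (2 * r)) ≠ 0 := by
  refine poch_ne_zero_of_norm_lt hp ?_
  have : ‖q ^ (2 : ℂ)‖ ≤ 1 := by
    norm_cast
    rw [norm_pow]
    exact pow_le_one₀ (norm_nonneg _) hq1.le
  rw [norm_mul]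
  exact mul_lt_one_of_nonneg_of_lt_one_left (norm_nonneg _) hp this

end Identities

section Gauge

variable {q r : ℂ}

/-- The residue of `F⁺(u)`, up to elementary factors. -/
lemma uMinus_zetaMinus (hq0 : q ≠ 0) (hq1 : ‖q‖ < 1) (hp : ‖q ^ (2 * r)‖ < 1) (v : ℂ) (l : ℕ)
    (h : ℤ) : uMinus q r v l h (zetaMinus q v h)⁻¹ =
      poch (q ^ (2 * r) * q ^ (l + 2 - h : ℂ)) (q ^ (2 * r)) *
        poch (q ^ (2 * r) * q ^ (-(l + h) : ℂ)) (q ^ (2 * r)) /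
      (poch (q ^ (2 * r) * q ^ (2 : ℂ)) (q ^ (2 * r)) * poch (q ^ (2 * r)) (q ^ (2 * r))) := by
  have hpp := poch_ne_zero_of_norm_lt hp hp
  have hpq := poch_mul_sq_ne_zero hq1 hp
  have hY : q ^ (2 * r) * q ^ (2 * v) * (zetaMinus q v h)⁻¹ = q ^ (2 * r) * q ^ (1 - h : ℂ) := by
    rw [zetaMinus, zpow_eq_cpow, mul_inv, ← Complex.cpow_neg]
    have := cpow_ne_zero hq0 (2 * v)
    field_simp
    congr 1
    push_cast
    ring_nf
  have e : ∀ (e : ℤ) (c : ℂ), c = e + (1 - h) →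
      q ^ e * (q ^ (2 * r) * q ^ (1 - h : ℂ)) = q ^ (2 * r) * q ^ c := fun e c hc => by
    rw [hc, zpow_eq_cpow, mul_left_comm, ← Complex.cpow_add _ _ hq0]
  have e1 := e (h + 1) 2 (by push_cast; ring)
  have e2 : q ^ (h - 1) * (q ^ (2 * r) * q ^ (1 - h : ℂ)) = q ^ (2 * r) := by
    rw [e (h - 1) 0 (by push_cast; ring), Complex.cpow_zero, mul_one]
  rw [uMinus_eq hq0 hq1 hp v l h rfl hY (by rwa [e1]) (by rwa [e2]), e1, e2,
    e ((l : ℤ) + 1) (l + 2 - h) (by push_cast; ring),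
    e (-((l : ℤ) + 1)) (-(l + h)) (by push_cast; ring)]

/-- The residue of `E⁺(u)`, up to elementary factors. -/
lemma uPlus_zetaPlus (hq0 : q ≠ 0) (hq1 : ‖q‖ < 1) (hp : ‖q ^ (2 * r)‖ < 1) (v : ℂ) (l : ℕ)
    (h : ℤ) (h0 : poch (q ^ (2 * r) * q ^ (-2 : ℂ)) (q ^ (2 * r)) ≠ 0) :
    uPlus q r v l (h + 2) (zetaPlus q v h) =
      poch (q ^ (2 * r) * q ^ (l + h + 2 : ℂ)) (q ^ (2 * r)) *
        poch (q ^ (2 * r) * q ^ (-(l - h) : ℂ)) (q ^ (2 * r)) /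
      (poch (q ^ (2 * r)) (q ^ (2 * r)) * poch (q ^ (2 * r) * q ^ (-2 : ℂ)) (q ^ (2 * r))) := by
  have hpp := poch_ne_zero_of_norm_lt hp hp
  have hY : q ^ (2 * r) * q ^ (2 * -v) * zetaPlus q v h = q ^ (2 * r) * q ^ (h + 1 : ℂ) := by
    rw [zetaPlus, zpow_eq_cpow, mul_neg, Complex.cpow_neg]
    have := cpow_ne_zero hq0 (2 * v)
    field_simp
    push_cast
    rfl
  have e : ∀ (e : ℤ) (c : ℂ), c = e + (h + 1) →
      q ^ e * (q ^ (2 * r) * q ^ (h + 1 : ℂ)) = q ^ (2 * r) * q ^ c := fun e c hc => by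
    rw [hc, zpow_eq_cpow, mul_left_comm, ← Complex.cpow_add _ _ hq0]
  have e1 : q ^ (-(h + 2) + 1) * (q ^ (2 * r) * q ^ (h + 1 : ℂ)) = q ^ (2 * r) := by
    rw [e (-(h + 2) + 1) 0 (by push_cast; ring), Complex.cpow_zero, mul_one]
  have e2 := e (-(h + 2) - 1) (-2) (by push_cast; ring)
  rw [uPlus_eq_uMinus, uMinus_eq hq0 hq1 hp (-v) l (-(h + 2)) rfl hY (by rwa [e1]) (by rwa [e2]), e1,
    e2, e ((l : ℤ) + 1) (l + h + 2) (by push_cast; ring),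
    e (-((l : ℤ) + 1)) (-(l - h)) (by push_cast; ring)]

/-- The eigenvalues of `gaugeD`. -/
def gaugeFun (q r v : ℂ) (l : ℕ) (aStar : ℂ) (m : Fin (l + 1)) (P : ℂ) : ℂ :=
  gaugeC q r v l aStar m * zpw q v (wt m * P / (2 * r))
    * q ^ (((wt m : ℂ) ^ 2 - l * (l + 2)) * P / (4 * r))

lemma gaugeD_eq (q r v : ℂ) (l : ℕ) (aStar : ℂ) :
    gaugeD q r v l aStar = diagOp fun m => ofFun (gaugeFun q r v l aStar m) := rfl

lemma gaugeFun_eq (hq0 : q ≠ 0) (hr : r ≠ 0) (v : ℂ) (l : ℕ) (aStar : ℂ) (m : Fin (l + 1)) (P : ℂ) :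
    gaugeFun q r v l aStar m P = gaugeC q r v l aStar m *
      q ^ ((wt m * v + ((wt m : ℂ) ^ 2 - l * (l + 2)) / 4) * P / r) := by
  rw [gaugeFun, zpw, mul_assoc, ← Complex.cpow_add _ _ hq0]
  congr 2
  field_simp

lemma gaugeFun_sub_one (hq0 : q ≠ 0) (hr : r ≠ 0) (v : ℂ) (l : ℕ) (aStar : ℂ) (m : Fin (l + 1))
    (P : ℂ) : gaugeFun q r v l aStar m P *
      q ^ (-(wt m * v + ((wt m : ℂ) ^ 2 - l * (l + 2)) / 4) / r) =
      gaugeFun q r v l aStar m (P - 1) := by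
  rw [gaugeFun_eq hq0 hr, gaugeFun_eq hq0 hr, mul_assoc, ← Complex.cpow_add _ _ hq0]
  congr 2
  ring

lemma wt_eq_of_succ {l : ℕ} {i j : Fin (l + 1)} (hij : (i : ℕ) = j + 1) : wt j = wt i + 2 := by
  simp only [wt, hij]; push_cast; ring

lemma gaugeC_succ (hq0 : q ≠ 0) (v : ℂ) (l : ℕ) (aStar : ℂ) (m : ℕ) : gaugeC q r v l aStar (m + 1) =
    gaugeC q r v l aStar m *
      (-aStar * (poch (q ^ (2 * r) * q ^ (2 : ℂ)) (q ^ (2 * r)) / poch (q ^ (2 * r)) (q ^ (2 * r)))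
      * (poch (q ^ (2 * r) * q ^ (-(2 * (m + 1 : ℂ)))) (q ^ (2 * r)) /
          poch (q ^ (2 * r) * q ^ (-(2 * (l - m : ℂ)))) (q ^ (2 * r)))
      * q ^ (((m + 1 : ℂ) ^ 2 - (l - 1 - 2 * m) ^ 2) / r - 2 * v * (l - 1 - 2 * m) / r)) := by
  refine (Finset.prod_Icc_succ_top (by omega) _).trans (congrArg (_ * ·) ?_)
  have e1 : ((-(2 * (l + 1 - (m + 1 : ℕ)) : ℤ) : ℤ) : ℂ) = -(2 * (l - m : ℂ)) := by push_cast; ring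
  have e2 : ((-(2 * (m + 1 : ℕ) : ℤ) : ℤ) : ℂ) = -(2 * (m + 1 : ℂ)) := by push_cast; ring
  have e3 : 2 * v * -(((l : ℂ) + 1 - 2 * (m + 1 : ℕ)) / r) = -(2 * v * (l - 1 - 2 * m) / r) := by
    push_cast; ring
  have e4 : (((m + 1 : ℕ) : ℂ) ^ 2 - (l + 1 - 2 * (m + 1 : ℕ)) ^ 2) / r =
      ((m + 1 : ℂ) ^ 2 - (l - 1 - 2 * m) ^ 2) / r := by push_cast; ring
  have e5 : q ^ 2 = q ^ (2 : ℂ) := by norm_cast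
  simp only [zpw, zpow_eq_cpow]
  rw [e1, e2, e3, e4, e5, sub_eq_add_neg _ (2 * v * (l - 1 - 2 * m) / r), Complex.cpow_add _ _ hq0,
    mul_assoc _ (q ^ (_ / r))]

end Gauge

section Relations

variable {q r v a aStar : ℂ} {l : ℕ}

lemma coe_wt (i : Fin (l + 1)) : ((wt i : ℤ) : ℂ) = l - 2 * (i : ℕ) := by
  simp [wt]

lemma wt_bounds (i : Fin (l + 1)) : -(l : ℤ) ≤ wt i ∧ wt i ≤ l := by
  have := i.2
  simp only [wt]
  omega

lemma sub_inv_ne_zero_of_gauge (ha : aStar * a * theta q r 1 / (q - q⁻¹) = 1) : q - q⁻¹ ≠ 0 := by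
  rintro h
  simp [h] at ha

lemma gauge_mul_fPlusCoeff (hq0 : q ≠ 0) (hq1 : ‖q‖ < 1) (hp : ‖q ^ (2 * r)‖ < 1)
    (hgen : ∀ j k : ℕ, 1 ≤ j → j ≤ l → 1 ≤ k → (q ^ (2 * r)) ^ k ≠ q ^ (2 * j))
    (ha : aStar * a * theta q r 1 / (q - q⁻¹) = 1) {i j : Fin (l + 1)} (hij : (i : ℕ) = j + 1)
    {u : ℂ} (hx : Generic q r l (u - v)) (P : ℂ) :
    gaugeFun q r v l aStar i P * fPlusCoeff q r v l a (wt j) P u =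
      gaugeFun q r v l aStar j P * (theta q r ((l - wt j + 2) / 2) *
        theta q r (u - v + (wt j - 1) / 2 + P) /
        (theta q r (u - v - (wt j - 1) / 2) * theta q r (P + wt j - 1))) := by
  have hr := r_ne_zero_of_norm_lt hp
  have hpp := poch_ne_zero_of_norm_lt hp hp
  have hqq := sub_inv_ne_zero_of_gauge ha
  have hu := hx.theta_ne_zero hq0 hq1 hp (e := wt j - 1) (by have := wt_bounds j; omega)
    (by have := wt_bounds j; omega)
  push_cast at hu
  have hwi : ((wt i : ℤ) : ℂ) = wt j - 2 := by rw [wt_eq_of_succ hij]; push_cast; ring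
  have hjl : (j : ℕ) + 1 ≤ l := by have := i.2; omega
  have hk := poch_ne_zero_of_generic hq0 hp hgen (j := l - j) (by omega) (by omega)
  rw [Nat.cast_sub (by omega)] at hk
  have hwj := coe_wt j
  rw [fPlusCoeff_eq hq0 hq1 hp v l a _ P hu, uMinus_zetaMinus hq0 hq1 hp, gaugeFun_eq hq0 hr,
    gaugeFun_eq hq0 hr, hwi, hij, gaugeC_succ hq0, qnum, theta_eq_mul_poch hq0 hp ((l - wt j + 2) / 2)]
  have c1 : -(2 * (((l : ℂ) - wt j + 2) / 2)) = -(2 * ((j : ℕ) + 1 : ℂ)) := by rw [hwj]; ring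
  have c2 : 2 * (((l : ℂ) - wt j + 2) / 2) = l + 2 - wt j := by ring
  have c3 : (-(l + wt j) : ℂ) = -(2 * (l - (j : ℕ) : ℂ)) := by rw [hwj]; ring
  have c4 : ((-wt j + l + 2) / 2 : ℂ) = (l - wt j + 2) / 2 := by ring
  have c5 : u - v - (wt j - 1) / 2 + (P + wt j - 1) = u - v + (wt j - 1) / 2 + P := by ring
  rw [c1, c2, c3, c4, c5]
  have key : q ^ ((((j : ℕ) + 1 : ℂ) ^ 2 - (l - 1 - 2 * (j : ℕ)) ^ 2) / r -
        2 * v * (l - 1 - 2 * (j : ℕ)) / r) *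
      q ^ ((((wt j : ℂ) - 2) * v + (((wt j : ℂ) - 2) ^ 2 - l * (l + 2)) / 4) * P / r) *
      q ^ ((2 * v + wt j - 1) * (P + wt j - 1) / r) =
      q ^ ((wt j * v + ((wt j : ℂ) ^ 2 - l * (l + 2)) / 4) * P / r) *
        q ^ (((l - wt j + 2) / 2 : ℂ) ^ 2 / r) := by
    simp only [← Complex.cpow_add _ _ hq0]
    congr 1
    rw [hwj]
    field_simp
    ring
  have hpq := poch_mul_sq_ne_zero hq1 hp
  rw [div_eq_one_iff_eq hqq] at ha
  clear hx
  generalize theta q r (u - v + (wt j - 1) / 2 + P) = T1 at *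
  generalize theta q r (u - v - (wt j - 1) / 2) = T2 at *
  generalize theta q r (P + wt j - 1) = T3 at *
  generalize theta q r 1 = T4 at *
  generalize poch (q ^ (2 * r)) (q ^ (2 * r)) = C0 at *
  generalize poch (q ^ (2 * r) * q ^ (2 : ℂ)) (q ^ (2 * r)) = C1 at *
  generalize poch (q ^ (2 * r) * q ^ (-(2 * (l - (j : ℕ) : ℂ)))) (q ^ (2 * r)) = C2 at *
  generalize poch (q ^ (2 * r) * q ^ (-(2 * ((j : ℕ) + 1 : ℂ)))) (q ^ (2 * r)) = C3 at *
  generalize poch (q ^ (2 * r) * q ^ (l + 2 - wt j : ℂ)) (q ^ (2 * r)) = C4 at *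
  generalize q ^ ((((j : ℕ) + 1 : ℂ) ^ 2 - (l - 1 - 2 * (j : ℕ)) ^ 2) / r -
        2 * v * (l - 1 - 2 * (j : ℕ)) / r) = G1 at *
  generalize q ^ ((((wt j : ℂ) - 2) * v + (((wt j : ℂ) - 2) ^ 2 - l * (l + 2)) / 4) * P / r) = G2 at *
  generalize q ^ ((2 * v + wt j - 1) * (P + wt j - 1) / r) = G3 at *
  generalize q ^ ((wt j * v + ((wt j : ℂ) ^ 2 - l * (l + 2)) / 4) * P / r) = G4 at *
  generalize q ^ (((l - wt j + 2) / 2 : ℂ) ^ 2 / r) = G5 at *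
  generalize q ^ ((l - wt j + 2) / 2 : ℂ) = B1
  generalize q ^ (-((l - wt j + 2) / 2) : ℂ) = B2
  generalize q - q⁻¹ = d at *
  generalize gaugeC q r v l aStar j = g
  have e1 : g * (-aStar * (C1 / C0) * (C3 / C2) * G1) * G2 *
      (a * (C4 * C2 / (C1 * C0) * ((B1 - B2) / d)) * (G3 * (T1 * T4 / (T2 * T3)))) =
      (G1 * G2 * G3) * (aStar * a * T4 / d) * (C1 / C1) * (C2 / C2) *
        (g * ((B2 - B1) * (C4 * C3 / C0 ^ 2)) * (T1 / (T2 * T3))) := by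
    ring
  rw [e1, key, ha, div_self hqq, div_self hpq, div_self hk]
  ring

lemma gauge_mul_ePlusCoeff (hq0 : q ≠ 0) (hq1 : ‖q‖ < 1) (hp : ‖q ^ (2 * r)‖ < 1)
    (hgen : ∀ j k : ℕ, 1 ≤ j → j ≤ l → 1 ≤ k → (q ^ (2 * r)) ^ k ≠ q ^ (2 * j))
    (ha : aStar * a * theta q r 1 / (q - q⁻¹) = 1) {i j : Fin (l + 1)} (hij : (j : ℕ) = i + 1)
    {u : ℂ} (hx : Generic q r l (u - v)) (P : ℂ) :
    gaugeFun q r v l aStar i (P - 1) * ePlusCoeff q r v l aStar (wt j) (P + 1) u =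
      -gaugeFun q r v l aStar j (P + 1) * (theta q r ((l + wt j + 2) / 2) *
        theta q r (u - v - (wt j + 1) / 2 - P) /
        (theta q r (u - v - (wt j + 1) / 2) * theta q r P)) := by
  have hr := r_ne_zero_of_norm_lt hp
  have hpp := poch_ne_zero_of_norm_lt hp hp
  have hqq := sub_inv_ne_zero_of_gauge ha
  have hu := hx.theta_ne_zero hq0 hq1 hp (e := wt j + 1) (by have := wt_bounds j; omega)
    (by have := wt_bounds j; omega)
  push_cast at hu
  have hwi : ((wt i : ℤ) : ℂ) = wt j + 2 := by rw [wt_eq_of_succ hij]; push_cast; ring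
  have hjl : (i : ℕ) + 1 ≤ l := by have := j.2; omega
  have hk := poch_ne_zero_of_generic hq0 hp hgen (j := l - i) (by omega) (by omega)
  have h2 := poch_ne_zero_of_generic hq0 hp hgen (j := 1) le_rfl (by omega)
  rw [Nat.cast_sub (by omega)] at hk
  rw [Nat.cast_one, mul_one] at h2
  have hwj : ((wt j : ℤ) : ℂ) = l - 2 * ((i : ℕ) + 1) := by
    rw [coe_wt, hij]; push_cast; ring
  rw [ePlusCoeff_eq hq0 hq1 hp v l aStar _ _ hu, uPlus_zetaPlus hq0 hq1 hp _ _ _ h2,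
    gaugeFun_eq hq0 hr, gaugeFun_eq hq0 hr, hwi, hij, gaugeC_succ hq0, qnum,
    theta_eq_mul_poch hq0 hp ((l + wt j + 2) / 2), theta_eq_mul_poch hq0 hp 1]
  have c1 : (-(l - wt j) : ℂ) = -(2 * ((i : ℕ) + 1 : ℂ)) := by rw [hwj]; ring
  have c2 : 2 * (((l : ℂ) + wt j + 2) / 2) = l + wt j + 2 := by ring
  have c3 : -(l + wt j + 2 : ℂ) = -(2 * (l - (i : ℕ) : ℂ)) := by rw [hwj]; ring
  have c4 : ((wt j + l + 2) / 2 : ℂ) = (l + wt j + 2) / 2 := by ring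
  have c5 : P + 1 - 1 = P := by ring
  have c6 : (2 : ℂ) * 1 = 2 := by ring
  have c7 : q ^ (-1 : ℂ) = q⁻¹ := Complex.cpow_neg_one q
  rw [c1, c2, c3, c4, c5, c6, c7, Complex.cpow_one]
  have key : q ^ (((wt j + 2) * v + (((wt j : ℂ) + 2) ^ 2 - l * (l + 2)) / 4) * (P - 1) / r) *
      q ^ (-((2 * v + wt j + 1) * P / r)) * q ^ ((1 : ℂ) ^ 2 / r) =
      q ^ ((((i : ℕ) + 1 : ℂ) ^ 2 - (l - 1 - 2 * (i : ℕ)) ^ 2) / r -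
        2 * v * (l - 1 - 2 * (i : ℕ)) / r) *
      q ^ ((wt j * v + ((wt j : ℂ) ^ 2 - l * (l + 2)) / 4) * (P + 1) / r) *
        q ^ (((l + wt j + 2) / 2 : ℂ) ^ 2 / r) := by
    simp only [← Complex.cpow_add _ _ hq0]
    congr 1
    rw [hwj]
    field_simp
    ring
  clear hx ha
  generalize theta q r (u - v - (wt j + 1) / 2 - P) = T1 at *
  generalize theta q r (u - v - (wt j + 1) / 2) = T2 at *
  generalize theta q r P = T3 at *
  generalize poch (q ^ (2 * r)) (q ^ (2 * r)) = C0 at *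
  generalize poch (q ^ (2 * r) * q ^ (2 : ℂ)) (q ^ (2 * r)) = C1 at *
  generalize poch (q ^ (2 * r) * q ^ (-2 : ℂ)) (q ^ (2 * r)) = C5 at *
  generalize poch (q ^ (2 * r) * q ^ (-(2 * (l - (i : ℕ) : ℂ)))) (q ^ (2 * r)) = C2 at *
  generalize poch (q ^ (2 * r) * q ^ (-(2 * ((i : ℕ) + 1 : ℂ)))) (q ^ (2 * r)) = C3 at *
  generalize poch (q ^ (2 * r) * q ^ (l + wt j + 2 : ℂ)) (q ^ (2 * r)) = C4 at *
  generalize q ^ ((((i : ℕ) + 1 : ℂ) ^ 2 - (l - 1 - 2 * (i : ℕ)) ^ 2) / r -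
        2 * v * (l - 1 - 2 * (i : ℕ)) / r) = G1 at *
  generalize q ^ (((wt j + 2) * v + (((wt j : ℂ) + 2) ^ 2 - l * (l + 2)) / 4) * (P - 1) / r) = G2 at *
  generalize q ^ (-((2 * v + wt j + 1) * P / r)) = G3 at *
  generalize q ^ ((wt j * v + ((wt j : ℂ) ^ 2 - l * (l + 2)) / 4) * (P + 1) / r) = G4 at *
  generalize q ^ (((l + wt j + 2) / 2 : ℂ) ^ 2 / r) = G5 at *
  generalize q ^ ((1 : ℂ) ^ 2 / r) = G6 at *
  generalize q ^ ((l + wt j + 2) / 2 : ℂ) = B1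
  generalize q ^ (-((l + wt j + 2) / 2) : ℂ) = B2
  rw [← neg_sub q q⁻¹]
  generalize q - q⁻¹ = d at *
  generalize gaugeC q r v l aStar i = g
  have e1 : g * G2 * (aStar * (C4 * C3 / (C0 * C5) * ((B1 - B2) / d)) *
        (G3 * (T1 * (G6 * -d * (C1 * C5 / C0 ^ 2)) / (T2 * T3)))) =
      (G2 * G3 * G6) * (d / d) * (C5 / C5) *
        (-g * aStar * (C4 * C3 / C0) * (B1 - B2) * (T1 * (C1 / C0 ^ 2) / (T2 * T3))) := by
    ring
  have e2 : -(g * (-aStar * (C1 / C0) * (C3 / C2) * G1) * G4) *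
        (G5 * (B2 - B1) * (C4 * C2 / C0 ^ 2) * T1 / (T2 * T3)) =
      (G1 * G4 * G5) * (C2 / C2) *
        (-g * aStar * (C4 * C3 / C0) * (B1 - B2) * (T1 * (C1 / C0 ^ 2) / (T2 * T3))) := by
    ring
  rw [e1, e2, key, div_self hqq, div_self h2, div_self hk]
  ring

end Relations

section Main

variable {q r v a aStar : ℂ} {l : ℕ}

lemma gauge_mul_kCoeff_inv (hq0 : q ≠ 0) (hq1 : ‖q‖ < 1) (hp : ‖q ^ (2 * r)‖ < 1) {u : ℂ}
    (hx : Generic q r l (u - v)) (i : Fin (l + 1)) (P : ℂ) :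
    gaugeFun q r v l aStar i P * (kCoeff q r v l u (wt i))⁻¹ =
      -(theta q r (u - v - (wt i - 1) / 2) / phiL q r l (u - v)) * gaugeFun q r v l aStar i (P - 1) := by
  rw [(kCoeff_inv hq0 hq1 hp (wt_bounds i).1 (wt_bounds i).2 hx).2,
    ← gaugeFun_sub_one hq0 (r_ne_zero_of_norm_lt hp)]
  ring

lemma gauge_mul_kCoeff (hq0 : q ≠ 0) (hq1 : ‖q‖ < 1) (hp : ‖q ^ (2 * r)‖ < 1) {u : ℂ}
    (hx : Generic q r l (u - 1 - v)) (i : Fin (l + 1)) (P : ℂ) :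
    gaugeFun q r v l aStar i P * kCoeff q r v l (u - 1) (wt i) =
      -(phiL q r l (u - v - 1) / theta q r (u - v - (wt i + 1) / 2)) *
        gaugeFun q r v l aStar i (P + 1) := by
  have hk := (kCoeff_inv hq0 hq1 hp (wt_bounds i).1 (wt_bounds i).2 hx).1
  have h := gauge_mul_kCoeff_inv (aStar := aStar) hq0 hq1 hp hx i (P + 1)
  have hθ := hx.theta_ne_zero hq0 hq1 hp (e := wt i - 1) (by have := wt_bounds i; omega)
    (by have := wt_bounds i; omega)
  push_cast at hθ
  have hφ := hx.phiL_ne_zero hq0 hq1 hp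
  rw [add_sub_cancel_right] at h
  rw [show u - 1 - v - ((wt i : ℂ) - 1) / 2 = u - v - (wt i + 1) / 2 by ring] at h hθ
  rw [sub_right_comm u 1 v] at h hφ
  generalize gaugeFun q r v l aStar i (P + 1) = A at *
  generalize gaugeFun q r v l aStar i P = B at *
  generalize kCoeff q r v l (u - 1) (wt i) = k at *
  generalize theta q r (u - v - (wt i + 1) / 2) = T at *
  generalize phiL q r l (u - v - 1) = φ at *
  field_simp at h ⊢
  linear_combination h

lemma gauge_mul_beta (hq0 : q ≠ 0) (hq1 : ‖q‖ < 1) (hp : ‖q ^ (2 * r)‖ < 1)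
    (hgen : ∀ j k : ℕ, 1 ≤ j → j ≤ l → 1 ≤ k → (q ^ (2 * r)) ^ k ≠ q ^ (2 * j))
    (ha : aStar * a * theta q r 1 / (q - q⁻¹) = 1) {i j : Fin (l + 1)} (hij : (i : ℕ) = j + 1)
    {u : ℂ} (hx : Generic q r l (u - v)) (P : ℂ) :
    gaugeFun q r v l aStar i P * (fPlusCoeff q r v l a (wt j) P u * (kCoeff q r v l u (wt j))⁻¹) =
      -(theta q r (u - v + (wt j - 1) / 2 + P) * theta q r ((l - wt j + 2) / 2) /
        (phiL q r l (u - v) * theta q r (P + wt j - 1))) * gaugeFun q r v l aStar j (P - 1) := by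
  have h1 := gauge_mul_fPlusCoeff hq0 hq1 hp hgen ha hij hx P
  have h2 := gauge_mul_kCoeff_inv (aStar := aStar) hq0 hq1 hp hx j P
  have hu := hx.theta_ne_zero hq0 hq1 hp (e := wt j - 1) (by have := wt_bounds j; omega)
    (by have := wt_bounds j; omega)
  push_cast at hu
  rw [← mul_assoc, h1, mul_right_comm, h2]
  generalize theta q r (u - v - (wt j - 1) / 2) = T at *
  field_simp

lemma gauge_mul_gamma (hq0 : q ≠ 0) (hq1 : ‖q‖ < 1) (hp : ‖q ^ (2 * r)‖ < 1)
    (hgen : ∀ j k : ℕ, 1 ≤ j → j ≤ l → 1 ≤ k → (q ^ (2 * r)) ^ k ≠ q ^ (2 * j))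
    (ha : aStar * a * theta q r 1 / (q - q⁻¹) = 1) {i j : Fin (l + 1)} (hij : (j : ℕ) = i + 1)
    {u : ℂ} (hx : Generic q r l (u - v)) (P : ℂ) :
    gaugeFun q r v l aStar i P *
        ((kCoeff q r v l u (wt i))⁻¹ * ePlusCoeff q r v l aStar (wt j) (P + 1) u) =
      theta q r (u - v - (wt j + 1) / 2 - P) * theta q r ((l + wt j + 2) / 2) /
        (phiL q r l (u - v) * theta q r P) * gaugeFun q r v l aStar j (P + 1) := by
  have h1 := gauge_mul_ePlusCoeff hq0 hq1 hp hgen ha hij hx P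
  have h2 := gauge_mul_kCoeff_inv (aStar := aStar) hq0 hq1 hp hx i P
  have hu := hx.theta_ne_zero hq0 hq1 hp (e := wt j + 1) (by have := wt_bounds j; omega)
    (by have := wt_bounds j; omega)
  push_cast at hu
  have hwi : ((wt i : ℤ) : ℂ) - 1 = wt j + 1 := by rw [wt_eq_of_succ hij]; push_cast; ring
  rw [hwi] at h2
  rw [← mul_assoc, h2, mul_assoc, h1]
  generalize theta q r (u - v - (wt j + 1) / 2) = T at *
  field_simp

lemma eventually_theta_ne_zero (hq0 : q ≠ 0) (hq1 : ‖q‖ < 1) (hp : ‖q ^ (2 * r)‖ < 1) (c : ℂ) :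
    ∀ᶠ P in codiscrete ℂ, theta q r (P + c) ≠ 0 := by
  obtain ⟨x, hx⟩ := exists_theta_ne_zero hq0 hq1 hp
  refine codiscrete_ne_zero (f := fun P => theta q r (P + c)) (x := x - c)
    ((differentiable_theta hq0 hp).comp (by fun_prop)) ?_
  simpa using hx

lemma alpha_combine {x y s t φ φ' : ℂ} (hφ : φ ≠ 0)
    (hC : theta q r (x - s) ≠ 0) (hA : theta q r (y - s) ≠ 0) (hB : theta q r (y + s) ≠ 0)
    (hφφ : φ' * φ = theta q r (x + t) * theta q r (x - t))
    (h3 : theta q r (x + s) * theta q r (x - s) * (theta q r (y - t) * theta q r (y + t)) =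
      theta q r (x + t) * theta q r (x - t) * (theta q r (y - s) * theta q r (y + s)) -
        theta q r (x + y) * theta q r (x - y) * (theta q r (t - s) * theta q r (t + s))) :
    -(φ' / theta q r (x - s)) + theta q r (x + y) * theta q r (x - y) * (theta q r (t - s) *
      theta q r (t + s)) / (φ * theta q r (y - s) * theta q r (y + s) * theta q r (x - s)) =
    -(theta q r (x + s) * theta q r (y - t) * theta q r (y + t) /
      (φ * theta q r (y - s) * theta q r (y + s))) := by
  have h4 := h3
  rw [← hφφ] at h4
  generalize theta q r (x - s) = a1 at *
  generalize theta q r (y - s) = a2 at *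
  generalize theta q r (y + s) = a3 at *
  field_simp
  linear_combination h4

lemma gauge_mul_alpha (hq0 : q ≠ 0) (hq1 : ‖q‖ < 1) (hp : ‖q ^ (2 * r)‖ < 1)
    {u : ℂ} (hx : Generic q r l (u - v)) (h2x : theta q r (2 * (u - v)) ≠ 0) (h : ℤ)
    (h1 : -(l : ℤ) ≤ h) (h2 : h ≤ l) {P : ℂ}
    (hA : theta q r P ≠ 0) (hB : theta q r (P + h + 1) ≠ 0) :
    -(phiL q r l (u - v - 1) / theta q r (u - v - (h + 1) / 2)) +
      theta q r (u - v + (h + 1) / 2 + P) * theta q r (u - v - (h + 1) / 2 - P) *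
        (theta q r ((l - h) / 2) * theta q r ((l + h + 2) / 2)) /
      (phiL q r l (u - v) * theta q r P * theta q r (P + h + 1) * theta q r (u - v - (h + 1) / 2)) =
    -(theta q r (u - v + (h + 1) / 2) * theta q r (P - (l - h) / 2) * theta q r (P + (l + h + 2) / 2) /
      (phiL q r l (u - v) * theta q r P * theta q r (P + h + 1))) := by
  have hs := hx.theta_ne_zero hq0 hq1 hp (e := h + 1) (by omega) (by omega)
  have hs' := hx.theta_ne_zero hq0 hq1 hp (e := -(h + 1)) (by omega) (by omega)
  have e0 : u - v - ((-(h + 1) : ℤ) : ℂ) / 2 = u - v + (h + 1) / 2 := by push_cast; ring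
  rw [e0] at hs'
  push_cast at hs
  have e1 : P = P + (h + 1) / 2 - (h + 1) / 2 := by ring
  have e2 : P + h + 1 = P + (h + 1) / 2 + (h + 1) / 2 := by ring
  have := alpha_combine (q := q) (r := r) (x := u - v) (y := P + (h + 1) / 2) (s := (h + 1) / 2)
    (t := (l + 1) / 2) (hx.phiL_ne_zero hq0 hq1 hp) hs (by rwa [← e1]) (by rwa [← e2])
    (phiL_mul_phiL hq0 hq1 hp hx) (theta_three_term hq0 hq1 hp h2x hs' hs _ _)
  rw [← e1, ← e2] at this
  convert this using 3 <;> ring_nf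

lemma meromorphic_theta (hq0 : q ≠ 0) (hp : ‖q ^ (2 * r)‖ < 1) {f : ℂ → ℂ}
    (hf : Differentiable ℂ f) : Meromorphic fun P => theta q r (f P) :=
  meromorphic_of_differentiable ((differentiable_theta hq0 hp).comp hf)

lemma meromorphic_ePlusCoeff (hq0 : q ≠ 0) (hq1 : ‖q‖ < 1) (hp : ‖q ^ (2 * r)‖ < 1) {u : ℂ}
    (h : ℤ) (hu : theta q r (u - v - (h + 1) / 2) ≠ 0) :
    Meromorphic fun P => ePlusCoeff q r v l aStar h P u := by
  simp only [ePlusCoeff_eq hq0 hq1 hp v l aStar h _ hu]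
  have hd : Meromorphic fun P : ℂ => q ^ (-((2 * v + h + 1) * (P - 1) / r)) :=
    meromorphic_of_differentiable fun P => DifferentiableAt.const_cpow (by fun_prop) (Or.inl hq0)
  exact (Meromorphic.const _).fun_mul (hd.fun_mul
    (((meromorphic_theta hq0 hp (by fun_prop)).fun_mul (Meromorphic.const _)).fun_div
      ((Meromorphic.const _).fun_mul (meromorphic_theta hq0 hp (by fun_prop)))))

lemma meromorphic_fPlusCoeff (hq0 : q ≠ 0) (hq1 : ‖q‖ < 1) (hp : ‖q ^ (2 * r)‖ < 1) {u : ℂ}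
    (h : ℤ) (hu : theta q r (u - v - (h - 1) / 2) ≠ 0) :
    Meromorphic fun P => fPlusCoeff q r v l a h P u := by
  simp only [fPlusCoeff_eq hq0 hq1 hp v l a h _ hu]
  have hd : Meromorphic fun P : ℂ => q ^ ((2 * v + h - 1) * (P + h - 1) / r) :=
    meromorphic_of_differentiable fun P => DifferentiableAt.const_cpow (by fun_prop) (Or.inl hq0)
  exact (Meromorphic.const _).fun_mul (hd.fun_mul
    (((meromorphic_theta hq0 hp (by fun_prop)).fun_mul (Meromorphic.const _)).fun_div
      ((Meromorphic.const _).fun_mul (meromorphic_theta hq0 hp (by fun_prop)))))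

lemma meromorphic_gaugeFun (hq0 : q ≠ 0) (hr : r ≠ 0) (i : Fin (l + 1)) :
    Meromorphic (gaugeFun q r v l aStar i) := by
  rw [funext (gaugeFun_eq hq0 hr v l aStar i)]
  exact meromorphic_of_differentiable fun P =>
    (DifferentiableAt.const_cpow (by fun_prop) (Or.inl hq0)).const_mul _

lemma gaugeC_ne_zero (hq0 : q ≠ 0) (hq1 : ‖q‖ < 1) (hp : ‖q ^ (2 * r)‖ < 1)
    (hgen : ∀ j k : ℕ, 1 ≤ j → j ≤ l → 1 ≤ k → (q ^ (2 * r)) ^ k ≠ q ^ (2 * j))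
    (ha : aStar ≠ 0) {m : ℕ} (hm : m ≤ l) : gaugeC q r v l aStar m ≠ 0 := by
  induction m with
  | zero => simp [gaugeC]
  | succ m ih =>
    have h1 := poch_ne_zero_of_generic hq0 hp hgen (j := l - m) (by omega) (by omega)
    have h2 := poch_ne_zero_of_generic hq0 hp hgen (j := m + 1) (by omega) (by omega)
    rw [Nat.cast_sub (by omega)] at h1
    push_cast at h2
    rw [gaugeC_succ hq0]
    exact mul_ne_zero (ih (by omega)) (mul_ne_zero (mul_ne_zero (mul_ne_zero (neg_ne_zero.2 ha)
      (div_ne_zero (poch_mul_sq_ne_zero hq1 hp) (poch_ne_zero_of_norm_lt hp hp)))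
      (div_ne_zero h2 h1)) (cpow_ne_zero hq0 _))

lemma isUnit_gaugeD (hq0 : q ≠ 0) (hq1 : ‖q‖ < 1) (hp : ‖q ^ (2 * r)‖ < 1)
    (hgen : ∀ j k : ℕ, 1 ≤ j → j ≤ l → 1 ≤ k → (q ^ (2 * r)) ^ k ≠ q ^ (2 * j))
    (ha : aStar ≠ 0) : IsUnit (gaugeD q r v l aStar) := by
  have hr := r_ne_zero_of_norm_lt hp
  refine isUnit_diagOp fun i => IsUnit.of_mul_eq_one
    (ofFun fun P => (gaugeFun q r v l aStar i P)⁻¹) ?_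
  change ofFun (gaugeFun q r v l aStar i) * _ = 1
  have hm := meromorphic_gaugeFun (v := v) (aStar := aStar) hq0 hr i
  rw [ofFun_mul hm hm.fun_inv, ← ofFun_one]
  congr 1
  funext P
  refine mul_inv_cancel₀ ?_
  rw [gaugeFun_eq hq0 hr]
  exact mul_ne_zero (gaugeC_ne_zero hq0 hq1 hp hgen ha (by omega)) (cpow_ne_zero hq0 _)

lemma Lop_eq (u : ℂ) (hk : ∀ i : Fin (l + 1), kCoeff q r v l u (wt i) ≠ 0) :
    Lop q r v l a aStar u =
      !![constShift l (kCoeff q r v l (u - 1)) 1 + Sminus l * hP l (fun h P =>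
            fPlusCoeff q r v l a h P u) * constShift l (fun h => (kCoeff q r v l u h)⁻¹) (-1) *
            (Splus l * expQ l 2 * hP l (fun h P => ePlusCoeff q r v l aStar h P u)),
        Sminus l * hP l (fun h P => fPlusCoeff q r v l a h P u) *
          constShift l (fun h => (kCoeff q r v l u h)⁻¹) (-1);
        constShift l (fun h => (kCoeff q r v l u h)⁻¹) (-1) *
          (Splus l * expQ l 2 * hP l (fun h P => ePlusCoeff q r v l aStar h P u)),
        constShift l (fun h => (kCoeff q r v l u h)⁻¹) (-1)] := by
  rw [Lop, Kplus_eq, Kplus_eq, inverse_constShift _ _ hk, Eplus, Fplus]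
  simp

end Main

end EllipticEval

end

open EllipticEval

theorem theorem4p14
    (q r v : ℂ) (l : ℕ) (a aStar : ℂ)
    (hq0 : q ≠ 0) (hq1 : ‖q‖ < 1) (hp : ‖q ^ (2 * r)‖ < 1)
    (hgen : ∀ j k : ℕ, 1 ≤ j → j ≤ l → 1 ≤ k → (q ^ (2 * r)) ^ k ≠ q ^ (2 * j))
    (ha : aStar * a * theta q r 1 / (q - q⁻¹) = 1) :
    IsUnit (gaugeD q r v l aStar) ∧
    ∀ᶠ u in Filter.codiscrete ℂ,
      gaugeD q r v l aStar * Lop q r v l a aStar u 0 0 =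
        -(hP l (fun h P =>
            theta q r (u - v + (h + 1) / 2) * theta q r (P - (l - h) / 2)
                * theta q r (P + (l + h + 2) / 2)
              / (phiL q r l (u - v) * theta q r P * theta q r (P + h + 1)))
          * expQ l 1) * gaugeD q r v l aStar ∧
      gaugeD q r v l aStar * Lop q r v l a aStar u 0 1 =
        -(Sminus l * hP l (fun h P =>
            theta q r (u - v + (h - 1) / 2 + P) * theta q r ((l - h + 2) / 2)
              / (phiL q r l (u - v) * theta q r (P + h - 1)))
          * expQ l (-1)) * gaugeD q r v l aStar ∧
      gaugeD q r v l aStar * Lop q r v l a aStar u 1 0 =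
        (Splus l * hP l (fun h P =>
            theta q r (u - v - (h + 1) / 2 - P) * theta q r ((l + h + 2) / 2)
              / (phiL q r l (u - v) * theta q r P))
          * expQ l 1) * gaugeD q r v l aStar ∧
      gaugeD q r v l aStar * Lop q r v l a aStar u 1 1 =
        -(hP l (fun h _ =>
            theta q r (u - v - (h - 1) / 2) / phiL q r l (u - v))
          * expQ l (-1)) * gaugeD q r v l aStar := by
  have hr := r_ne_zero_of_norm_lt hp
  have haS : aStar ≠ 0 := by rintro rfl; simp at ha
  refine ⟨isUnit_gaugeD hq0 hq1 hp hgen haS, ?_⟩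
  have h2x : ∀ᶠ u in codiscrete ℂ, theta q r (2 * (u - v)) ≠ 0 := by
    obtain ⟨x, hx⟩ := exists_theta_ne_zero hq0 hq1 hp
    refine codiscrete_ne_zero (f := fun u => theta q r (2 * (u - v))) (x := x / 2 + v)
      ((differentiable_theta hq0 hp).comp (by fun_prop)) ?_
    rwa [add_sub_cancel_right, mul_div_cancel₀ _ two_ne_zero]
  have hG := eventually_generic hq0 hq1 hp l v
  have hG' := eventually_generic hq0 hq1 hp l (1 + v)
  filter_upwards [h2x, hG, hG'] with u h2x hx hx'
  rw [← sub_sub] at hx'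
  have hD := fun i => meromorphic_gaugeFun (v := v) (aStar := aStar) (l := l) hq0 hr i
  have hec : ∀ i j : Fin (l + 1), (j : ℕ) = i + 1 →
      Meromorphic fun P => ePlusCoeff q r v l aStar (wt j) P u := fun i j _ =>
    meromorphic_ePlusCoeff hq0 hq1 hp _ (by
      have := hx.theta_ne_zero hq0 hq1 hp (e := wt j + 1) (by have := wt_bounds j; omega)
        (by have := wt_bounds j; omega)
      push_cast at this
      exact this)
  have hfc : ∀ i j : Fin (l + 1), (i : ℕ) = j + 1 →
      Meromorphic fun P => fPlusCoeff q r v l a (wt j) P u := fun i j _ =>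
    meromorphic_fPlusCoeff hq0 hq1 hp _ (by
      have := hx.theta_ne_zero hq0 hq1 hp (e := wt j - 1) (by have := wt_bounds j; omega)
        (by have := wt_bounds j; omega)
      push_cast at this
      exact this)
  have hk := fun i : Fin (l + 1) =>
    (kCoeff_inv hq0 hq1 hp (wt_bounds i).1 (wt_bounds i).2 hx).1
  have hθ : ∀ c : ℂ, Meromorphic fun P => theta q r (P + c) := fun c =>
    meromorphic_theta hq0 hp (by fun_prop)
  rw [Lop_eq u hk, gaugeD_eq]
  refine ⟨?_, ?_, ?_, ?_⟩
  · refine gauge_alpha hD hec hfc (fun i => ?_) ?_ fun i j hij => ?_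
    · exact (((Meromorphic.const _).fun_mul (meromorphic_theta hq0 hp (by fun_prop))).fun_mul
        (meromorphic_theta hq0 hp (by fun_prop))).fun_div (((Meromorphic.const _).fun_mul
        (meromorphic_theta hq0 hp (by fun_prop))).fun_mul (meromorphic_theta hq0 hp (by fun_prop)))
    · filter_upwards [eventually_theta_ne_zero hq0 hq1 hp 0,
        eventually_theta_ne_zero hq0 hq1 hp (wt (0 : Fin (l + 1)) + 1)] with P hA hB
      rw [add_zero] at hA
      rw [← add_assoc] at hB
      have h := gauge_mul_alpha hq0 hq1 hp hx h2x _ (wt_bounds 0).1 (wt_bounds 0).2 hA hB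
      rw [gauge_mul_kCoeff hq0 hq1 hp hx', ← h, coe_wt]
      simp [theta_zero hq0 hp]
    · filter_upwards [eventually_theta_ne_zero hq0 hq1 hp 0,
        eventually_theta_ne_zero hq0 hq1 hp (wt i + 1)] with P hA hB
      rw [add_zero] at hA
      rw [← add_assoc] at hB
      have h := gauge_mul_alpha hq0 hq1 hp hx h2x _ (wt_bounds i).1 (wt_bounds i).2 hA hB
      have hs := hx.theta_ne_zero hq0 hq1 hp (e := wt i + 1) (by have := wt_bounds i; omega)
        (by have := wt_bounds i; omega)
      push_cast at hs
      have hβ := gauge_mul_beta hq0 hq1 hp hgen ha hij hx P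
      have hE := gauge_mul_ePlusCoeff hq0 hq1 hp hgen ha hij hx P
      have hwj : ((wt j : ℤ) : ℂ) = wt i + 2 := by rw [wt_eq_of_succ hij]; push_cast; ring
      rw [hwj] at hβ
      rw [mul_add, gauge_mul_kCoeff hq0 hq1 hp hx', ← mul_assoc, hβ, mul_assoc, hE, ← h,
        show (wt i : ℂ) + 2 - 1 = wt i + 1 by ring, show P + (wt i + 2 : ℂ) - 1 = P + wt i + 1 by ring,
        show (l - (wt i + 2) + 2 : ℂ) = l - wt i by ring]
      have := hx.phiL_ne_zero hq0 hq1 hp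
      ring
  · refine gauge_beta hD hfc (fun i j _ => ?_) fun i j hij => Eventually.of_forall fun P => ?_
    · exact ((meromorphic_theta hq0 hp (by fun_prop)).fun_mul (Meromorphic.const _)).fun_div
        ((Meromorphic.const _).fun_mul (meromorphic_theta hq0 hp (by fun_prop)))
    · exact gauge_mul_beta hq0 hq1 hp hgen ha hij hx P
  · refine gauge_gamma hD hec (fun i j _ => ?_) fun i j hij => Eventually.of_forall fun P => ?_
    · exact ((meromorphic_theta hq0 hp (by fun_prop)).fun_mul (Meromorphic.const _)).fun_div
        ((Meromorphic.const _).fun_mul (meromorphic_theta hq0 hp (by fun_prop)))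
    · exact gauge_mul_gamma hq0 hq1 hp hgen ha hij hx P
  · exact gauge_delta hD fun i => Eventually.of_forall fun P =>
      gauge_mul_kCoeff_inv hq0 hq1 hp hx i P
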